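/- **Proposition (Bishop inequality).** Let $M$ be a (Hausdorff) $C^\infty$-manifold without boundary of dimension $n\ge 2$ and let $F:TM\to[0,\infty)$ be a $C^\infty$-Finsler structure: $F$ is $C^\infty$ on $TM\setminus 0$, $F(av)=aF(v)$ for $a>0$, and $g_{ij}(v)=\frac12\frac{\partial^2[F^2]}{\partial v^i\partial v^j}(v)$ is positive-definite for $v\ne 0$; write $g_v$ for the inner product on $T_xM$ with matrix $(g_{ij}(v))$. Let $\mathrm{Ric}$ be the Finsler Ricci curvature, $\mathrm{Ric}(v)=F^2(v)\sum_{i=1}^{n-1}\mathbf K(v,e_i)$ with $\mathbf K$ the flag curvature and $\{e_i\}_{i=1}^{n-1}\cup\{v/F(v)\}$ a $g_v$-orthonormal basis. Let $\psi:TM\setminus 0\to\mathbb R$ be $C^\infty$ and positively $0$-homogeneous, and write $\psi_\eta(t)=\psi(\dot\eta(t))$ for a nonconstant geodesic $\eta$. For $v\neq 0$ and the geodesic $\eta$ with $\dot\eta(0)=v$, set $$\mathrm{Ric}_N(v)=\mathrm{Ric}(v)+\psi_\eta''(0)-\frac{\psi_\eta'(0)^2}{N-n}\quad(N\in\mathbb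 R\setminus\{n\}),\qquad \mathrm{Ric}_\infty=\lim_{N\to\infty}\mathrm{Ric}_N,\qquad \mathrm{Ric}_n=\lim_{N\downarrow n}\mathrm{Ric}_N\in[-\infty,\infty),$$ and $\mathrm{Ric}_N(0)=0$. Let $v\in T_xM$ with $F(v)=1$, let $\eta:[0,l)\to M$ $(0<l\le\infty)$ be the geodesic with $\dot\eta(0)=v$, let $\{e_1,\dots,e_{n-1},v\}$ be an orthonormal basis of $(T_xM,g_v)$, let $E_i(t)=(\mathrm d\exp_x)_{tv}(te_i)$ be the associated Jacobi fields along $\eta$, and put $A(t)=\big(g_{\dot\eta(t)}(E_i(t),E_j(t))\big)_{i,j=1}^{n-1}$. Let $N\in(-\infty,1]\cup[n,\infty]$, let $\epsilon\in\mathbb R$ satisfy $$\epsilon=0\ \text{ if } N=1,\qquad |\epsilon|<\sqrt{\tfrac{N-1}{N-n}}\ \text{ if } N\ne 1,n,\qquad \epsilon\in\mathbb R\ \text{ if } N=n,$$ and let $c=\frac1{n-1}\big(1-\epsilon^2\frac{N-n}{N-1}\big)$, with $c=\frac1{n-1}$ for $N=1$ (for $N=\infty$ both quotients are read as $1$). Define,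 for $t\in[0,l)$, $$h(t)=e^{-c\psi_\eta(t)}(\det A(t))^{c/2},\qquad \varphi_\eta(t)=\int_0^t e^{\frac{2(\epsilon-1)}{n-1}\psi_\eta(s)}\,\mathrm ds,$$ $\varphi_\eta(l)=\lim_{t\uparrow l}\varphi_\eta(t)\in(0,\infty]$, and $h_1=h\circ\varphi_\eta^{-1}$ on $[0,\varphi_\eta(l))$. Then for every $\tau\in(0,\varphi_\eta(l))$ such that $E_1,\dots,E_{n-1}$ are linearly independent at the time $\varphi_\eta^{-1}(\tau)$ (equivalently $\det A(\varphi_\eta^{-1}(\tau))\neq 0$), the function $h_1$ is $C^2$ near $\tau$ and $$h_1''(\tau)\le -c\,h_1(\tau)\,\mathrm{Ric}_N\big((\eta\circ\varphi_\eta^{-1})'(\tau)\big).$$ (For $N=n$ the right-hand side may be $+\infty$.) -/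

import Mathlib

open Set Filter Topology MeasureTheory
open scoped Manifold ContDiff ENNReal

noncomputable section

namespace Finsler

/-! ### Calculus in fibre-wise linear coordinates

`x` is the base point and `v` the fibre coordinate; a function of `(x, v)` is written in curried
form. -/

section Coordinates

variable {n : ℕ}

/-- `∂f/∂x^j`. -/
def dX (j : Fin n) (f : EuclideanSpace ℝ (Fin n) → EuclideanSpace ℝ (Fin n) → ℝ) :
    EuclideanSpace ℝ (Fin n) → EuclideanSpace ℝ (Fin n) → ℝ :=
  fun x v => fderiv ℝ (fun y => f y v) x (EuclideanSpace.single j 1)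

/-- `∂f/∂v^j`. -/
def dV (j : Fin n) (f : EuclideanSpace ℝ (Fin n) → EuclideanSpace ℝ (Fin n) → ℝ) :
    EuclideanSpace ℝ (Fin n) → EuclideanSpace ℝ (Fin n) → ℝ :=
  fun x v => fderiv ℝ (fun w => f x w) v (EuclideanSpace.single j 1)

variable (F : EuclideanSpace ℝ (Fin n) → EuclideanSpace ℝ (Fin n) → ℝ)

/-- `g_{ij}(v) = (1/2) ∂²[F²]/∂v^i∂v^j`. -/
def gLow (i j : Fin n) : EuclideanSpace ℝ (Fin n) → EuclideanSpace ℝ (Fin n) → ℝ :=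
  fun x v => (1 / 2) * dV i (dV j (fun y w => F y w ^ 2)) x v

/-- The matrix `(g_{ij}(v))`. -/
def gMatrix (x v : EuclideanSpace ℝ (Fin n)) : Matrix (Fin n) (Fin n) ℝ :=
  Matrix.of fun i j => gLow F i j x v

/-- The inverse matrix `g^{ij}(v)`. -/
def gUp (i j : Fin n) (x v : EuclideanSpace ℝ (Fin n)) : ℝ := (gMatrix F x v)⁻¹ i j

/-- The formal Christoffel symbol `γ^i_{jk}(v)`. -/
def formalChristoffel (i j k : Fin n) (x v : EuclideanSpace ℝ (Fin n)) : ℝ :=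
  (1 / 2) * ∑ l, gUp F i l x v *
    (dX j (gLow F l k) x v + dX k (gLow F j l) x v - dX l (gLow F j k) x v)

/-- The geodesic spray coefficients `G^i(v) = (1/2) ∑ γ^i_{jk}(v) v^j v^k` (so `G^i(0) = 0`). -/
def spray (i : Fin n) (x v : EuclideanSpace ℝ (Fin n)) : ℝ :=
  (1 / 2) * ∑ j, ∑ k, formalChristoffel F i j k x v * v j * v k

/-- The nonlinear connection `N^i_j(v) = ∂G^i/∂v^j`. -/
def nonlinConn (i j : Fin n) : EuclideanSpace ℝ (Fin n) → EuclideanSpace ℝ (Fin n) → ℝ :=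
  dV j (spray F i)

/-- The components `R^i_j(v)` of the curvature tensor. -/
def curvCoeff (i j : Fin n) (x v : EuclideanSpace ℝ (Fin n)) : ℝ :=
  2 * dX j (spray F i) x v
    - ∑ k, (dX k (nonlinConn F i j) x v * v k - 2 * dV k (nonlinConn F i j) x v * spray F k x v)
    - ∑ k, nonlinConn F i k x v * nonlinConn F k j x v

end Coordinates

/-! ### Finsler manifolds -/

section Manifold

variable {n : ℕ} {M : Type*} [TopologicalSpace M] [ChartedSpace (EuclideanSpace ℝ (Fin n)) M]
  [IsManifold (𝓡 n) ∞ M]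

/-- A function on `TM` written in the coordinates `(x^i, v^j)` of `TU` induced by the preferred
chart `U ∋ p`. At `p` itself this chart induces the identity `T_pM = ℝⁿ`. -/
def inChart (F : TangentBundle (𝓡 n) M → ℝ) (p : M)
    (x v : EuclideanSpace ℝ (Fin n)) : ℝ :=
  F ((extChartAt (𝓡 n).tangent (⟨p, 0⟩ : TangentBundle (𝓡 n) M)).symm (x, v))

/-- `C^∞`-Finsler structures on `M`. -/
structure IsFinslerStructure (F : TangentBundle (𝓡 n) M → ℝ) : Prop where
  nonneg : ∀ v, 0 ≤ F v
  smooth : ContMDiffOn (𝓡 n).tangent 𝓘(ℝ, ℝ) ∞ F {v | v.2 ≠ 0}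
  homog : ∀ (x : M) (v : TangentSpace (𝓡 n) x) (a : ℝ), 0 < a → F ⟨x, a • v⟩ = a * F ⟨x, v⟩
  convex : ∀ (x : M) (v : TangentSpace (𝓡 n) x), v ≠ 0 →
    (gMatrix (inChart F x) (extChartAt (𝓡 n) x x) v).PosDef

/-- Weight functions: positively `0`-homogeneous `C^∞`-functions on the slit tangent bundle
(values on the zero section are irrelevant). -/
structure IsWeight (ψ : TangentBundle (𝓡 n) M → ℝ) : Prop where
  smooth : ContMDiffOn (𝓡 n).tangent 𝓘(ℝ, ℝ) ∞ ψ {v | v.2 ≠ 0}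
  homog : ∀ (x : M) (v : TangentSpace (𝓡 n) x) (a : ℝ), v ≠ 0 → 0 < a → ψ ⟨x, a • v⟩ = ψ ⟨x, v⟩

variable (F : TangentBundle (𝓡 n) M → ℝ)

/-- `g_v(a, b)` for `v, a, b ∈ T_pM`. -/
def gInner (p : M) (v a b : TangentSpace (𝓡 n) p) : ℝ :=
  ∑ i : Fin n, ∑ j : Fin n, gLow (inChart F p) i j (extChartAt (𝓡 n) p p) v *
    (show EuclideanSpace ℝ (Fin n) from a) i * (show EuclideanSpace ℝ (Fin n) from b) j

/-- `R_v(w)` for `v, w ∈ T_pM`. -/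
def curvature (p : M) (v w : TangentSpace (𝓡 n) p) : TangentSpace (𝓡 n) p :=
  (WithLp.toLp 2 fun i : Fin n => ∑ j : Fin n,
    curvCoeff (inChart F p) i j (extChartAt (𝓡 n) p p) v *
      (show EuclideanSpace ℝ (Fin n) from w) j : EuclideanSpace ℝ (Fin n))

/-- The flag curvature `K(v, w)`. -/
def flagCurvature (p : M) (v w : TangentSpace (𝓡 n) p) : ℝ :=
  gInner F p v (curvature F p v w) w /
    (F ⟨p, v⟩ ^ 2 * gInner F p v w w - gInner F p v v w ^ 2)

/-- `e_1, …, e_{n-1}` together with `v / F(v)` form an orthonormal basis of `(T_pM, g_v)`. -/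
def IsAdapted (p : M) (v : TangentSpace (𝓡 n) p) (e : Fin (n - 1) → TangentSpace (𝓡 n) p) : Prop :=
  (∀ i j, gInner F p v (e i) (e j) = if i = j then 1 else 0) ∧ ∀ i, gInner F p v (e i) v = 0

open Classical in
/-- The Ricci curvature `Ric(v) = F²(v) ∑ K(v, e_i)`, where `e_1, …, e_{n-1}, v / F(v)` is an
orthonormal basis of `(T_pM, g_v)` (any choice gives the same value), and `Ric(0) = 0`. -/
def ricci (p : M) (v : TangentSpace (𝓡 n) p) : ℝ :=
  if h : v ≠ 0 ∧ ∃ e, IsAdapted F p v e then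
    F ⟨p, v⟩ ^ 2 * ∑ i, flagCurvature F p v (h.2.choose i)
  else 0

/-! ### Curves, geodesics and the exponential map -/

/-- The velocity `γ'(t)` of a curve `γ : S → M`, `S ⊆ ℝ` (one-sided at end points of `S`). -/
def velocity (γ : ℝ → M) (S : Set ℝ) (t : ℝ) : TangentBundle (𝓡 n) M :=
  ⟨γ t, mfderivWithin 𝓘(ℝ, ℝ) (𝓡 n) γ S t (1 : ℝ)⟩

/-- `γ : S → M` is a geodesic, `S` being an interval: it is `C^∞` and satisfies the geodesic
equation `γ̈^i + 2 G^i(γ̇) = 0`, written at time `t` in the chart around `γ(t)`. -/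
def IsGeodesicOn (γ : ℝ → M) (S : Set ℝ) : Prop :=
  ContMDiffOn 𝓘(ℝ, ℝ) (𝓡 n) ∞ γ S ∧
  ∀ t ∈ S, ∀ i : Fin n,
    derivWithin (derivWithin (fun s => extChartAt (𝓡 n) (γ t) (γ s)) S) S t i +
      2 * spray (inChart F (γ t)) i (extChartAt (𝓡 n) (γ t) (γ t))
        (derivWithin (fun s => extChartAt (𝓡 n) (γ t) (γ s)) S t) = 0

open Classical in
/-- The exponential map: `exp_x(v) = γ(1)` if there is a geodesic `γ : [0,1] → M` with `γ'(0) = v`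
(with the value `x` elsewhere). -/
def expMap (x : M) (v : TangentSpace (𝓡 n) x) : M :=
  if h : ∃ γ : ℝ → M, IsGeodesicOn F γ (Icc 0 1) ∧ velocity γ (Icc 0 1) 0 = ⟨x, v⟩ then
    h.choose 1
  else x

/-! ### The weighted Ricci curvature -/

/-- `ψ_γ(t) = ψ(γ'(t))`. -/
def alongCurve (ψ : TangentBundle (𝓡 n) M → ℝ) (γ : ℝ → M) (S : Set ℝ) (t : ℝ) : ℝ :=
  ψ (velocity γ S t)

open Classical in
/-- A geodesic `γ : (-δ, δ) → M` with `γ'(0) = v` (unique near `0`). -/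
def geodesicThrough (p : M) (v : TangentSpace (𝓡 n) p) : ℝ → M :=
  if h : ∃ γ : ℝ → M, ∃ δ > 0, IsGeodesicOn F γ (Ioo (-δ) δ) ∧
      velocity γ (Ioo (-δ) δ) 0 = ⟨p, v⟩ then
    h.choose
  else fun _ => p

variable (ψ : TangentBundle (𝓡 n) M → ℝ)

/-- `ψ_η'(0)` for the geodesic `η` with `η'(0) = v`. -/
def dWeight (p : M) (v : TangentSpace (𝓡 n) p) : ℝ :=
  deriv (alongCurve ψ (geodesicThrough F p v) univ) 0

/-- `ψ_η''(0)` for the geodesic `η` with `η'(0) = v`. -/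
def ddWeight (p : M) (v : TangentSpace (𝓡 n) p) : ℝ :=
  deriv (deriv (alongCurve ψ (geodesicThrough F p v) univ)) 0

open Classical in
/-- The weighted Ricci curvature `Ric_N(v)`, as an extended real number:
`Ric_N(v) = Ric(v) + ψ_η''(0) - ψ_η'(0)² / (N - n)` for real `N ≠ n`, `Ric_∞` and `Ric_n` are the
limits as `N → ∞` and `N ↓ n` (see `tendsto_weightedRicci_top`, `tendsto_weightedRicci_dim`), and
`Ric_N(0) = 0`. -/
def weightedRicci (N : WithTop ℝ) (p : M) (v : TangentSpace (𝓡 n) p) : EReal :=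
  if v = 0 then 0 else
    match N with
    | ⊤ => ((ricci F p v + ddWeight F ψ p v : ℝ) : EReal)
    | (N : ℝ) =>
      if N = n then
        if dWeight F ψ p v = 0 then ((ricci F p v + ddWeight F ψ p v : ℝ) : EReal) else ⊥
      else ((ricci F p v + ddWeight F ψ p v - dWeight F ψ p v ^ 2 / (N - n) : ℝ) : EReal)

theorem tendsto_weightedRicci_top (p : M) (v : TangentSpace (𝓡 n) p) :
    Tendsto (fun N : ℝ => weightedRicci F ψ (N : WithTop ℝ) p v) atTop
      (𝓝 (weightedRicci F ψ ⊤ p v)) := by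
  by_cases hv : v = 0
  · simp [weightedRicci, hv]
  have h1 : Tendsto (fun N : ℝ => ricci F p v + ddWeight F ψ p v - dWeight F ψ p v ^ 2 / (N - n))
      atTop (𝓝 (ricci F p v + ddWeight F ψ p v - 0)) :=
    tendsto_const_nhds.sub
      (tendsto_const_nhds.div_atTop (tendsto_atTop_add_const_right _ (-(n : ℝ)) tendsto_id))
  rw [sub_zero] at h1
  have h2 := (continuous_coe_real_ereal.tendsto _).comp h1
  simp only [weightedRicci, hv, if_false]
  refine h2.congr' ?_
  filter_upwards [eventually_gt_atTop (n : ℝ)] with N hN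
  simp [hN.ne']

theorem tendsto_weightedRicci_dim (p : M) (v : TangentSpace (𝓡 n) p) :
    Tendsto (fun N : ℝ => weightedRicci F ψ (N : WithTop ℝ) p v) (𝓝[>] (n : ℝ))
      (𝓝 (weightedRicci F ψ ((n : ℝ) : WithTop ℝ) p v)) := by
  by_cases hv : v = 0
  · simp [weightedRicci, hv]
  simp only [weightedRicci, hv, if_false]
  by_cases hd : dWeight F ψ p v = 0
  · refine tendsto_const_nhds.congr' ?_
    filter_upwards [self_mem_nhdsWithin] with N hN
    simp [(show (n : ℝ) < N from hN).ne', hd]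
  · have h0 : Tendsto (fun N : ℝ => N - n) (𝓝[>] (n : ℝ)) (𝓝[>] 0) := by
      refine tendsto_nhdsWithin_iff.2 ⟨?_, ?_⟩
      · have : Tendsto (fun N : ℝ => N - n) (𝓝 (n : ℝ)) (𝓝 ((n : ℝ) - n)) :=
          tendsto_id.sub tendsto_const_nhds
        rw [sub_self] at this
        exact this.mono_left nhdsWithin_le_nhds
      · filter_upwards [self_mem_nhdsWithin] with N hN
        exact sub_pos.2 (show (n : ℝ) < N from hN)
    have h1 : Tendsto (fun N : ℝ => ricci F p v + ddWeight F ψ p v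
        + -(dWeight F ψ p v ^ 2 * (N - n)⁻¹)) (𝓝[>] (n : ℝ)) atBot :=
      tendsto_atBot_add_const_left _ _ (tendsto_neg_atTop_atBot.comp
        (Tendsto.const_mul_atTop (by positivity) (tendsto_inv_nhdsGT_zero.comp h0)))
    have h2 := EReal.tendsto_coe_nhds_bot_iff.2 h1
    simp only [hd, if_false, if_true]
    refine h2.congr' ?_
    filter_upwards [self_mem_nhdsWithin] with N hN
    rw [if_neg (show (n : ℝ) < N from hN).ne', ← sub_eq_add_neg, div_eq_mul_inv]

/-! ### Jacobi fields from a point, and the functions entering the Bishop inequality -/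

/-- The interval `[0, l)`, `l ∈ (0, ∞]`. -/
def timeInterval (l : EReal) : Set ℝ := {t | 0 ≤ t ∧ (t : EReal) < l}

/-- The Jacobi field `E(t) = (d exp_x)_{tv}(t e)` along the geodesic `t ↦ exp_x(tv)`. -/
def jacobiField (x : M) (v e : TangentSpace (𝓡 n) x) (t : ℝ) :
    TangentSpace (𝓡 n) (expMap F x (t • v)) :=
  mfderiv 𝓘(ℝ, EuclideanSpace ℝ (Fin n)) (𝓡 n)
    (fun w : EuclideanSpace ℝ (Fin n) => expMap F x w) (t • v) (t • e)

/-- `A(t) = (g_{η'(t)}(E_i(t), E_j(t)))_{ij}` for `η : S → M` the geodesic with `η(0) = x` and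
`η'(0) = v`, so that `η(t) = exp_x(tv)`. -/
def jacobiGram (x : M) (v : TangentSpace (𝓡 n) x) (e : Fin (n - 1) → TangentSpace (𝓡 n) x)
    (η : ℝ → M) (S : Set ℝ) (t : ℝ) : Matrix (Fin (n - 1)) (Fin (n - 1)) ℝ :=
  Matrix.of fun i j =>
    gInner F (η t) (velocity η S t).2 (jacobiField F x v (e i) t) (jacobiField F x v (e j) t)

end Manifold

/-- The `ε`-range: `ε = 0` for `N = 1`, `|ε| < √((N-1)/(N-n))` for `N ≠ 1, n` (the right-hand side
is `1` for `N = ∞`), and `ε ∈ ℝ` for `N = n`. -/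
def EpsilonRange (n : ℕ) (N : WithTop ℝ) (ε : ℝ) : Prop :=
  match N with
  | ⊤ => |ε| < 1
  | (N : ℝ) => if N = 1 then ε = 0 else if N = n then True else |ε| < √((N - 1) / (N - n))

/-- `c(N, ε) = (1/(n-1)) (1 - ε² (N-n)/(N-1))`, where `(N-n)/(N-1)` is `1` for `N = ∞`, and
`c(1, 0) = 1/(n-1)`. -/
def bishopConst (n : ℕ) (N : WithTop ℝ) (ε : ℝ) : ℝ :=
  match N with
  | ⊤ => 1 / ((n : ℝ) - 1) * (1 - ε ^ 2)
  | (N : ℝ) =>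
    if N = 1 then 1 / ((n : ℝ) - 1)
    else 1 / ((n : ℝ) - 1) * (1 - ε ^ 2 * ((N - n) / (N - 1)))

/-- The density `e^{2(ε-1)ψ_η(t)/(n-1)}` of the reparametrization, for `f = ψ_η`. -/
def paramDensity (n : ℕ) (ε : ℝ) (f : ℝ → ℝ) (t : ℝ) : ℝ :=
  Real.exp (2 * (ε - 1) / ((n : ℝ) - 1) * f t)

/-- `φ_η(t) = ∫₀ᵗ e^{2(ε-1)ψ_η(s)/(n-1)} ds`, for `f = ψ_η`. -/
def paramFun (n : ℕ) (ε : ℝ) (f : ℝ → ℝ) (t : ℝ) : ℝ :=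
  ∫ s in (0 : ℝ)..t, paramDensity n ε f s

/-- `φ_η(l) ∈ (0, ∞]`. -/
def paramEnd (n : ℕ) (ε : ℝ) (f : ℝ → ℝ) (l : EReal) : ℝ≥0∞ :=
  ∫⁻ s in timeInterval l, ENNReal.ofReal (paramDensity n ε f s)

/-- `φ_η⁻¹ : [0, φ_η(l)) → [0, l)`. -/
def paramInv (n : ℕ) (ε : ℝ) (f : ℝ → ℝ) (l : EReal) : ℝ → ℝ :=
  Function.invFunOn (paramFun n ε f) (timeInterval l)

/-- `h(t) = e^{-cψ_η(t)} (det A(t))^{c/2}`, for `f = ψ_η`. -/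
def bishopFun {m : ℕ} (c : ℝ) (f : ℝ → ℝ) (A : ℝ → Matrix (Fin m) (Fin m) ℝ) (t : ℝ) : ℝ :=
  Real.exp (-c * f t) * (A t).det ^ (c / 2)

end Finsler

end

noncomputable section

set_option linter.unusedSectionVars false

namespace Finsler

/-! ### Smooth dependence of the flow of a vector field on the initial value -/

section Flow

open scoped NNReal

/-! The theorem is a Riccati comparison followed by completing a square. Fix the time t = φ⁻¹(τ) > 0
and a chart centred at η(t). Let J have as columns η' and the Jacobi fields E_i, let N be the
nonlinear connection along η', let J₁ hold the covariant derivatives of the columns of J, and let R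
be the curvature R_{η'}. Then J' = J₁ - NJ, J₁' = -RJ - NJ₁ and g' = gN + (gN)ᵀ, so B = J⁻¹J₁
satisfies B' = -B² - J⁻¹RJ.

Three facts reduce this to dimension n-1. The velocity is parallel, so its column in B vanishes. By
the Gauss lemma (`IsGeodFamily.two_mul_gInner_velocity_jacobi`) the Jacobi fields stay orthogonal to
η', so the Gram matrix of J splits into 1 and A. The Jacobi fields are variations of geodesics
issuing from one point, so their Wronskian is symmetric (`IsGeodFamily.wronskian_symm`) and the
remaining block of B is self-adjoint for A. Hence u = tr B = ½(log det A)', and Cauchy–Schwarz gives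
u' ≤ -Ric(η') - u²/(n-1); see `riccati_trace_le`, `IsLocalFinsler.log_det_gram_deriv_le` and
`jacobiGram_riccati`.

Write f = ψ_η, w = u - f' = (log h)'/c and k = 2(ε-1)/(n-1). Since (φ⁻¹)' = exp(-k f), two
differentiations give h₁'' = c h₁ ((φ⁻¹)')² (w' - k f' w + c w²) (`deriv_deriv_exp_comp`). Inserting
the Riccati inequality, the claim becomes nonnegativity of a quadratic form in w and f'
(`bishop_algebra`). With κ = (N-n)/(N-1) > 0 this form is (κεw + f')²/κ; the constant c and the
density of φ are chosen to produce this square. The values N = 1, n, ∞ are treated separately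
(`bishop_quadratic_nonneg`). The factor ((φ⁻¹)')² is absorbed because Ric_N is homogeneous of degree
two (`ricci_smul`, `dWeight_smul`, `ddWeight_smul`).

What remains is foundational. The exponential map and the weighted curvature are defined through
chosen geodesics, so uniqueness is needed (`IsRegularGeodesic.eqOn`,
`IsRegularGeodesic.eventuallyEq`). Differentiating exp requires smooth dependence on the initial
velocity: the flow of a smooth field is smooth (`IsFlowOf.contDiff`), and flow boxes are chained
along a compact geodesic segment (`hasGeodFamily`). Independence of the chart is deduced from the
Euler–Lagrange equation of F² (`geodesic_coordChange`) rather than from a transformation law for the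
spray. The same Euler–Lagrange identity, differentiated in the fibre, yields the compatibility of N
with g. -/

theorem gronwallBound_le_add_mul_exp {δ K ε x : ℝ} (hK : 1 ≤ K) (hε : 0 ≤ ε) (hx : 0 ≤ x) :
    gronwallBound δ K ε x ≤ (δ + ε) * Real.exp (K * x) := by
  rw [gronwallBound_of_K_ne_0 (by linarith)]
  have h1 : 1 ≤ Real.exp (K * x) := Real.one_le_exp (by positivity)
  have h2 : ε / K ≤ ε := div_le_self hε hK
  nlinarith

/-- Grönwall's inequality runs forward in time; negative times are handled by applying it to s ↦
y(-s). Assuming K ≥ 1 allows the initial error δ and the defect ε to enter through the single factor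
δ + ε. -/
theorem norm_le_of_norm_deriv_le {E : Type*} [NormedAddCommGroup E] [NormedSpace ℝ E]
    {y y' : ℝ → E} {T K δ ε : ℝ} (hK : 1 ≤ K) (hε : 0 ≤ ε)
    (hy : ∀ t ∈ Icc (-T) T, HasDerivWithinAt y (y' t) (Icc (-T) T) t) (h0 : ‖y 0‖ ≤ δ)
    (hb : ∀ t ∈ Icc (-T) T, ‖y' t‖ ≤ K * ‖y t‖ + ε) :
    ∀ t ∈ Icc (-T) T, ‖y t‖ ≤ (δ + ε) * Real.exp (K * T) := by
  have hδ : 0 ≤ δ := (norm_nonneg _).trans h0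
  have forward : ∀ (z z' : ℝ → E), (∀ t ∈ Icc (-T) T, HasDerivWithinAt z (z' t) (Icc (-T) T) t) →
      ‖z 0‖ ≤ δ → (∀ t ∈ Icc (-T) T, ‖z' t‖ ≤ K * ‖z t‖ + ε) →
      ∀ t ∈ Icc 0 T, ‖z t‖ ≤ (δ + ε) * Real.exp (K * T) := by
    intro z z' hz hz0 hzb t ht
    have hT : 0 ≤ T := ht.1.trans ht.2
    have hsub : Icc 0 T ⊆ Icc (-T) T := Icc_subset_Icc_left (by linarith)
    have := norm_le_gronwallBound_of_norm_deriv_right_le (f := z) (f' := z') (δ := δ) (K := K)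
      (ε := ε) (a := 0) (b := T)
      (fun s hs => ((hz s (hsub hs)).continuousWithinAt).mono hsub)
      (fun s hs => ((hz s (hsub ⟨hs.1, hs.2.le⟩)).mono_of_mem_nhdsWithin
        (by
          have : Icc s T ∈ 𝓝[≥] s := Icc_mem_nhdsGE hs.2
          exact mem_of_superset this (Icc_subset_Icc_left (by linarith [hs.1])))))
      hz0 (fun s hs => hzb s (hsub ⟨hs.1, hs.2.le⟩)) t ht
    refine this.trans ((gronwallBound_le_add_mul_exp hK hε (by linarith [ht.1])).trans ?_)
    gcongr
    linarith [ht.2]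
  intro t ht
  rcases le_total 0 t with h | h
  · exact forward y y' hy h0 hb t ⟨h, ht.2⟩
  · have hmaps : MapsTo (fun s : ℝ => -s) (Icc (-T) T) (Icc (-T) T) := fun s hs =>
      ⟨by linarith [hs.2], by linarith [hs.1]⟩
    have := forward (fun s => y (-s)) (fun s => -y' (-s))
      (fun s hs => by
        have h1 := (hy (-s) (hmaps hs)).scomp s (hasDerivAt_neg s).hasDerivWithinAt hmaps
        simpa [Function.comp_def] using h1)
      (by simpa using h0) (fun s hs => by simpa using hb (-s) (hmaps hs)) (-t)
      ⟨by linarith, by linarith [ht.1]⟩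
    simpa using this

/-! ### Global existence for Lipschitz equations -/

section Existence

variable {E : Type*} [NormedAddCommGroup E] [NormedSpace ℝ E] [FiniteDimensional ℝ E]

/-- Existence of solutions of `y' = X(t, y)` on `[-T, T]` if `X` is Lipschitz in `y`. -/
theorem exists_solution_Icc {X : ℝ → E → E} (hX : ∀ y, Continuous fun t => X t y) {T : ℝ}
    (hT : 0 ≤ T) {K : ℝ≥0} (hK : ∀ t ∈ Icc (-T) T, LipschitzWith K (X t)) (y₀ : E) :
    ∃ y : ℝ → E, y 0 = y₀ ∧
      ∀ t ∈ Icc (-T) T, HasDerivWithinAt y (X t (y t)) (Icc (-T) T) t := by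
  obtain ⟨C, hC⟩ := isCompact_Icc.exists_bound_of_continuousOn
    ((hX 0).continuousOn (s := Icc (-T) T))
  have hC0 : 0 ≤ C := (norm_nonneg _).trans (hC 0 ⟨by linarith, hT⟩)
  set K' : ℝ := K + 1 with hK'
  have hK1 : 1 ≤ K' := by simp [hK']
  -- By Grönwall every solution is bounded by R - 1. The truncation `P`, which is the identity on
  -- the ball of radius R, is therefore invisible to it.
  set R : ℝ := (‖y₀‖ + C) * Real.exp (K' * T) + 1 with hR
  have hR0 : 0 < R := by positivity
  let b : ContDiffBump (0 : E) := ⟨R, R + 1, hR0, by linarith⟩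
  let P : E → E := fun y => b y • y
  have hP1 : ∀ y, ‖y‖ ≤ R → P y = y := fun y hy => by
    have : b y = 1 := b.one_of_mem_closedBall (by simpa using hy)
    simp [P, this]
  have hP2 : ∀ y, ‖P y‖ ≤ ‖y‖ := fun y => by
    rw [norm_smul, Real.norm_of_nonneg b.nonneg]
    exact mul_le_of_le_one_left (norm_nonneg _) b.le_one
  have hPc : ContDiff ℝ 1 P := b.contDiff.smul contDiff_id
  have hPs : HasCompactSupport P := b.hasCompactSupport.smul_right
  obtain ⟨KP, hKP⟩ := hPc.lipschitzWith_of_hasCompactSupport hPs one_ne_zero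
  have hP3 : ∀ y, ‖P y‖ ≤ R + 1 := fun y => by
    by_cases hy : ‖y‖ ≤ R + 1
    · exact (hP2 y).trans hy
    · have : b y = 0 := b.zero_of_le_dist (by simpa using (not_le.1 hy).le)
      simp only [P, this, zero_smul, norm_zero]
      linarith
  have hlin : ∀ t ∈ Icc (-T) T, ∀ y, ‖X t (P y)‖ ≤ K * ‖P y‖ + C := fun t ht y => by
    have h1 := (hK t ht).dist_le_mul (P y) 0
    rw [dist_eq_norm, dist_zero_right] at h1
    calc ‖X t (P y)‖ = ‖(X t (P y) - X t 0) + X t 0‖ := by simp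
      _ ≤ _ := (norm_add_le _ _).trans (add_le_add h1 (hC t ht))
  obtain ⟨B, hB⟩ : ∃ B : ℝ≥0, (B : ℝ) = K * (R + 1) + C := ⟨⟨_, by positivity⟩, rfl⟩
  obtain ⟨S, hS⟩ : ∃ S : ℝ≥0, (S : ℝ) = T := ⟨⟨T, hT⟩, rfl⟩
  -- The truncated field is bounded by B everywhere, so in time T a solution travels at most B * S.
  -- This supplies the radius that Picard–Lindelöf requires, with no smallness condition on T.
  have hmain : IsPicardLindelof (fun t y => X t (P y)) (⟨0, by linarith, hT⟩ : Icc (-T) T) y₀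
      (B * S) 0 B (K * KP) := by
    refine ⟨fun t ht => ((hK t ht).comp hKP).lipschitzOnWith, fun y _ => (hX _).continuousOn,
      fun t ht y _ => ?_, ?_⟩
    · refine (hlin t ht y).trans ?_
      rw [hB]
      gcongr
      exact hP3 y
    · simp [hS]
  obtain ⟨y, hy0, hy⟩ := hmain.exists_eq_forall_mem_Icc_hasDerivWithinAt₀
  refine ⟨y, hy0, fun t ht => ?_⟩
  have hb := norm_le_of_norm_deriv_le hK1 hC0 hy (δ := ‖y₀‖) (le_of_eq (by rw [← hy0])) (fun t ht => by
    refine (hlin t ht _).trans ?_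
    have := hP2 (y t)
    have h3 := norm_nonneg (y t)
    have : (K : ℝ) * ‖P (y t)‖ ≤ K * ‖y t‖ := by gcongr
    rw [hK']
    linarith) t ht
  have := hy t ht
  rwa [hP1 _ (hb.trans (by linarith))] at this

/-- Global existence of solutions of `y' = X(t, y)` if `X` is Lipschitz in `y`, locally uniformly
in `t`. -/
theorem exists_solution {X : ℝ → E → E} (hX : ∀ y, Continuous fun t => X t y)
    (hK : ∀ T : ℝ, ∃ K : ℝ≥0, ∀ t ∈ Icc (-T) T, LipschitzWith K (X t)) (y₀ : E) :
    ∃ y : ℝ → E, y 0 = y₀ ∧ ∀ t, HasDerivAt y (X t (y t)) t := by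
  have hex : ∀ T : ℝ, 0 ≤ T → ∃ y : ℝ → E, y 0 = y₀ ∧
      ∀ t ∈ Ioo (-T) T, HasDerivAt y (X t (y t)) t := fun T hT => by
    obtain ⟨K, hK⟩ := hK T
    obtain ⟨y, h0, hy⟩ := exists_solution_Icc hX hT hK y₀
    exact ⟨y, h0, fun t ht => (hy t (Ioo_subset_Icc_self ht)).hasDerivAt (Icc_mem_nhds ht.1 ht.2)⟩
  choose! y hy0 hy using hex
  have huniq : ∀ S T : ℝ, 0 < S → S ≤ T → EqOn (y S) (y T) (Ioo (-S) S) := fun S T hS hST => by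
    obtain ⟨K, hK⟩ := hK S
    refine ODE_solution_unique_of_mem_Ioo (s := fun _ => univ) (v := X) (K := K) (t₀ := 0)
      (fun t ht => (hK t (Ioo_subset_Icc_self ht)).lipschitzOnWith) ⟨by linarith, hS⟩
      (fun t ht => ⟨hy S hS.le t ht, trivial⟩)
      (fun t ht => ⟨hy T (by linarith) t ⟨by linarith [ht.1], by linarith [ht.2]⟩, trivial⟩) ?_
    rw [hy0 S hS.le, hy0 T (by linarith)]
  -- The solutions on growing intervals are glued by uniqueness; the margin 1 makes t an interior
  -- time of the interval used at t.
  refine ⟨fun t => y (|t| + 1) t, by simp [hy0], fun t => ?_⟩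
  have ht : t ∈ Ioo (-(|t| + 1)) (|t| + 1) :=
    ⟨by linarith [neg_abs_le t], by linarith [le_abs_self t]⟩
  refine (hy (|t| + 1) (by positivity) t ht).congr_of_eventuallyEq ?_
  filter_upwards [Ioo_mem_nhds ht.1 ht.2] with s hs
  rcases le_total (|s| + 1) (|t| + 1) with h | h
  · exact huniq _ _ (by positivity) h
      ⟨by linarith [neg_abs_le s], by linarith [le_abs_self s]⟩
  · exact (huniq _ _ (by positivity) h hs).symm

end Existence

/-! ### Dependence of a flow on its initial value -/

section Dependence

variable {E : Type*} [NormedAddCommGroup E] [NormedSpace ℝ E] [FiniteDimensional ℝ E]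

theorem exists_lipschitzOnWith_closedBall {G : Type*} [NormedAddCommGroup G] [NormedSpace ℝ G]
    {f : E → G} (hf : ContDiff ℝ 1 f) (R : ℝ) :
    ∃ K : ℝ≥0, LipschitzOnWith K f (Metric.closedBall 0 R) :=
  hf.locallyLipschitz.locallyLipschitzOn.exists_lipschitzOnWith_of_compact
    (isCompact_closedBall 0 R)

/-- A `C¹` field is Lipschitz only on bounded sets, but two continuous curves on a compact interval
lie in a common ball, and uniqueness for Lipschitz fields applies there. -/
theorem eqOn_Icc_of_solutions {f : E → E} (hf : ContDiff ℝ 1 f) {y₁ y₂ : ℝ → E} {T : ℝ}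
    (h₁ : ∀ t ∈ Icc (-T) T, HasDerivWithinAt y₁ (f (y₁ t)) (Icc (-T) T) t)
    (h₂ : ∀ t ∈ Icc (-T) T, HasDerivWithinAt y₂ (f (y₂ t)) (Icc (-T) T) t)
    (h0 : y₁ 0 = y₂ 0) : EqOn y₁ y₂ (Icc (-T) T) := by
  rcases le_or_gt T 0 with hT | hT
  · intro t ht
    have : t = 0 := le_antisymm (ht.2.trans hT) (by linarith [ht.1])
    rw [this, h0]
  have c₁ : ContinuousOn y₁ (Icc (-T) T) := fun t ht => (h₁ t ht).continuousWithinAt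
  have c₂ : ContinuousOn y₂ (Icc (-T) T) := fun t ht => (h₂ t ht).continuousWithinAt
  obtain ⟨R₁, hR₁⟩ := isCompact_Icc.exists_bound_of_continuousOn c₁
  obtain ⟨R₂, hR₂⟩ := isCompact_Icc.exists_bound_of_continuousOn c₂
  obtain ⟨K, hK⟩ := exists_lipschitzOnWith_closedBall hf (max R₁ R₂)
  refine ODE_solution_unique_of_mem_Icc (v := fun _ => f) (t₀ := 0)
    (s := fun _ => Metric.closedBall 0 (max R₁ R₂)) (fun t _ => hK) ⟨by linarith, hT⟩ c₁
    (fun t ht => (h₁ t (Ioo_subset_Icc_self ht)).hasDerivAt (Icc_mem_nhds ht.1 ht.2))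
    (fun t ht => ?_) c₂
    (fun t ht => (h₂ t (Ioo_subset_Icc_self ht)).hasDerivAt (Icc_mem_nhds ht.1 ht.2))
    (fun t ht => ?_) h0
  · simpa using (hR₁ t (Ioo_subset_Icc_self ht)).trans (le_max_left _ _)
  · simpa using (hR₂ t (Ioo_subset_Icc_self ht)).trans (le_max_right _ _)

/-- Global solution maps of autonomous equations. -/
structure IsFlowOf (f : E → E) (Φ : ℝ → E → E) : Prop where
  zero : ∀ z, Φ 0 z = z
  deriv : ∀ z t, HasDerivAt (fun s => Φ s z) (f (Φ t z)) t

variable {f : E → E} {Φ : ℝ → E → E}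

/-- Cut f off outside a ball containing the reference orbit. The cut-off field is globally
Lipschitz, so Grönwall controls its solutions; those starting close enough to z₀ never leave the
ball and hence are orbits of f. -/
theorem IsFlowOf.exists_dist_le (hΦ : IsFlowOf f Φ) (hf : ContDiff ℝ 1 f) (z₀ : E) {T : ℝ}
    (hT : 0 ≤ T) : ∃ C, 0 ≤ C ∧ ∃ ρ > 0, ∀ z, ‖z - z₀‖ ≤ ρ → ∀ t ∈ Icc (-T) T,
      ‖Φ t z - Φ t z₀‖ ≤ C * ‖z - z₀‖ := by
  obtain ⟨R₀, hR₀⟩ := (isCompact_Icc (a := -T) (b := T)).exists_bound_of_continuousOn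
    (f := fun t => Φ t z₀) (fun t _ => (hΦ.deriv z₀ t).continuousAt.continuousWithinAt)
  set R := |R₀| + 1 with hR
  have hRpos : 0 < R := by positivity
  let b : ContDiffBump (0 : E) := ⟨R, R + 1, hRpos, by linarith⟩
  let X : E → E := fun y => b y • f y
  have hX1 : ∀ y, ‖y‖ ≤ R → X y = f y := fun y hy => by
    have : b y = 1 := b.one_of_mem_closedBall (by simpa using hy)
    simp [X, this]
  have hXc : ContDiff ℝ 1 X := b.contDiff.smul hf
  obtain ⟨K, hK⟩ : ∃ K, LipschitzWith K X := hXc.lipschitzWith_of_hasCompactSupport b.hasCompactSupport.smul_right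
    one_ne_zero
  have hz₀ : ∀ t ∈ Icc (-T) T, HasDerivWithinAt (fun s => Φ s z₀) (X (Φ t z₀)) (Icc (-T) T) t :=
    fun t ht => by
      rw [hX1 _ ((hR₀ t ht).trans (by linarith [le_abs_self R₀]))]
      exact (hΦ.deriv z₀ t).hasDerivWithinAt
  set C := Real.exp ((K + 1) * T) with hC
  have hCpos : 0 < C := Real.exp_pos _
  -- With ‖z - z₀‖ ≤ 1 / C the solution stays within distance 1 of the reference orbit, which is the
  -- room left by R = |R₀| + 1.
  refine ⟨C, hCpos.le, 1 / C, by positivity, fun z hz t ht => ?_⟩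
  obtain ⟨y, hy0, hy⟩ := exists_solution_Icc (X := fun _ => X) (fun _ => continuous_const) hT
    (fun t _ => hK) z
  have key : ∀ t ∈ Icc (-T) T, ‖y t - Φ t z₀‖ ≤ C * ‖z - z₀‖ := fun t ht => by
    have := norm_le_of_norm_deriv_le (K := K + 1) (ε := 0) (δ := ‖z - z₀‖) (by simp) le_rfl
      (fun t ht => (hy t ht).sub (hz₀ t ht)) (by simp [hy0, hΦ.zero]) (fun t _ => by
        have := hK.dist_le_mul (y t) (Φ t z₀)
        rw [dist_eq_norm, dist_eq_norm] at this
        have h3 := norm_nonneg (y t - Φ t z₀)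
        simp only [Pi.sub_apply]
        linarith) t ht
    simp only [Pi.sub_apply, add_zero] at this
    linarith [this]
  have hyR : ∀ t ∈ Icc (-T) T, ‖y t‖ ≤ R := fun t ht => by
    have h1 := key t ht
    have h2 : C * ‖z - z₀‖ ≤ 1 := by
      calc C * ‖z - z₀‖ ≤ C * (1 / C) := by gcongr
        _ = 1 := by field_simp
    calc ‖y t‖ = ‖(y t - Φ t z₀) + Φ t z₀‖ := by simp
      _ ≤ 1 + R₀ := (norm_add_le _ _).trans (add_le_add (h1.trans h2) (hR₀ t ht))
      _ ≤ R := by linarith [le_abs_self R₀]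
  have := eqOn_Icc_of_solutions hf (y₁ := y) (y₂ := fun s => Φ s z)
    (fun t ht => by have := hy t ht; rwa [hX1 _ (hyR t ht)] at this)
    (fun t _ => (hΦ.deriv z t).hasDerivWithinAt) (by rw [hy0, hΦ.zero]) ht
  simp only at this
  rw [← this]
  exact key t ht

theorem IsFlowOf.continuous (hΦ : IsFlowOf f Φ) (hf : ContDiff ℝ 1 f) :
    Continuous fun p : ℝ × E => Φ p.1 p.2 := by
  rw [continuous_iff_continuousAt]
  rintro ⟨t₀, z₀⟩
  obtain ⟨C, hC, ρ, hρ, h⟩ := hΦ.exists_dist_le hf z₀ (T := |t₀| + 1) (by positivity)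
  have h1 : Tendsto (fun p : ℝ × E => Φ p.1 z₀) (𝓝 (t₀, z₀)) (𝓝 (Φ t₀ z₀)) :=
    ((hΦ.deriv z₀ t₀).continuousAt).tendsto.comp (continuous_fst.tendsto _)
  have h2 : Tendsto (fun p : ℝ × E => Φ p.1 p.2 - Φ p.1 z₀) (𝓝 (t₀, z₀)) (𝓝 0) := by
    have h3 : Tendsto (fun p : ℝ × E => C * ‖p.2 - z₀‖) (𝓝 (t₀, z₀)) (𝓝 0) := by
      have : Continuous fun p : ℝ × E => C * ‖p.2 - z₀‖ := by fun_prop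
      simpa using this.tendsto (t₀, z₀)
    refine squeeze_zero_norm' ?_ h3
    have hz : ∀ᶠ p : ℝ × E in 𝓝 (t₀, z₀), p.2 ∈ Metric.closedBall z₀ ρ :=
      continuous_snd.continuousAt.eventually (Metric.closedBall_mem_nhds z₀ hρ)
    have ht : ∀ᶠ p : ℝ × E in 𝓝 (t₀, z₀), p.1 ∈ Icc (-(|t₀| + 1)) (|t₀| + 1) :=
      continuous_fst.continuousAt.eventually (Icc_mem_nhds (by linarith [neg_abs_le t₀])
        (by linarith [le_abs_self t₀]))
    filter_upwards [hz, ht] with p hp1 hp2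
    exact h p.2 (by simpa [dist_eq_norm] using hp1) p.1 hp2
  simpa [ContinuousAt] using h2.add h1

/-- The linearization of the flow. -/
theorem IsFlowOf.exists_linearization (hΦ : IsFlowOf f Φ) (hf : ContDiff ℝ 1 f) :
    ∃ Y : ℝ → E → E →L[ℝ] E, (∀ z, Y 0 z = ContinuousLinearMap.id ℝ E) ∧
      ∀ z t, HasDerivAt (fun s => Y s z) ((fderiv ℝ f (Φ t z)).comp (Y t z)) t := by
  have hex : ∀ z, ∃ Y : ℝ → E →L[ℝ] E, Y 0 = ContinuousLinearMap.id ℝ E ∧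
      ∀ t, HasDerivAt Y ((fderiv ℝ f (Φ t z)).comp (Y t)) t := fun z => by
    have hcont : Continuous fun t => fderiv ℝ f (Φ t z) :=
      (hf.continuous_fderiv one_ne_zero).comp
        (continuous_iff_continuousAt.2 fun t => (hΦ.deriv z t).continuousAt)
    -- The equation is linear in B. On [-T, T] its Lipschitz constant is a bound for the derivative
    -- of f along a compact piece of orbit, so solutions are global.
    refine exists_solution (X := fun t B => (fderiv ℝ f (Φ t z)).comp B)
      (fun B => hcont.clm_comp continuous_const) (fun T => ?_) _
    obtain ⟨C, hC⟩ := isCompact_Icc.exists_bound_of_continuousOn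
      (hcont.continuousOn (s := Icc (-T) T))
    refine ⟨C.toNNReal, fun t ht => LipschitzWith.of_dist_le_mul fun B₁ B₂ => ?_⟩
    rw [dist_eq_norm, dist_eq_norm, ← ContinuousLinearMap.comp_sub]
    refine (ContinuousLinearMap.opNorm_comp_le _ _).trans ?_
    gcongr
    exact (hC t ht).trans (Real.le_coe_toNNReal C)
  choose Y hY0 hY using hex
  exact ⟨fun t z => Y z t, hY0, hY⟩

theorem norm_sub_sub_le_of_lipschitzOnWith_fderiv {f : E → E} (hf : Differentiable ℝ f) {R : ℝ}
    {K : ℝ≥0} (hK : LipschitzOnWith K (fderiv ℝ f) (Metric.closedBall 0 R)) {a b : E}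
    (ha : ‖a‖ ≤ R) (hb : ‖b‖ ≤ R) :
    ‖f b - f a - fderiv ℝ f a (b - a)‖ ≤ K * ‖b - a‖ ^ 2 := by
  have hsub : segment ℝ a b ⊆ Metric.closedBall 0 R :=
    (convex_closedBall 0 R).segment_subset (by simpa using ha) (by simpa using hb)
  have := (convex_segment a b).norm_image_sub_le_of_norm_hasFDerivWithin_le' (f := f)
    (f' := fderiv ℝ f) (φ := fderiv ℝ f a) (C := K * ‖b - a‖)
    (fun x _ => (hf x).hasFDerivAt.hasFDerivWithinAt) (fun x hx => ?_)
    (left_mem_segment ℝ a b) (right_mem_segment ℝ a b)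
  · rwa [mul_assoc, ← sq] at this
  · have h1 := hK.dist_le_mul x (hsub hx) a (by simpa using ha)
    rw [dist_eq_norm, dist_eq_norm] at h1
    refine h1.trans ?_
    gcongr
    exact norm_sub_le_of_mem_segment hx

/-- The defect Φ_t z - Φ_t z₀ - Y_t(z - z₀) starts at 0 and solves the linearized equation up to a
Taylor remainder of order ‖z - z₀‖². Grönwall turns this into a quadratic bound, hence
differentiability. -/
theorem IsFlowOf.hasFDerivAt_right (hΦ : IsFlowOf f Φ) (hf : ContDiff ℝ 2 f)
    {Y : ℝ → E → E →L[ℝ] E} (hY0 : ∀ z, Y 0 z = ContinuousLinearMap.id ℝ E)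
    (hY : ∀ z t, HasDerivAt (fun s => Y s z) ((fderiv ℝ f (Φ t z)).comp (Y t z)) t)
    (t₀ : ℝ) (z₀ : E) : HasFDerivAt (fun z => Φ t₀ z) (Y t₀ z₀) z₀ := by
  set T := |t₀| with hTdef
  have hT : 0 ≤ T := abs_nonneg _
  have ht₀ : t₀ ∈ Icc (-T) T := ⟨neg_abs_le t₀, le_abs_self t₀⟩
  have hf1 : ContDiff ℝ 1 f := hf.of_le (by norm_num)
  have hf' : ContDiff ℝ 1 (fderiv ℝ f) := hf.fderiv_right (by norm_num)
  obtain ⟨C, hC, ρ, hρ, h⟩ := hΦ.exists_dist_le hf1 z₀ hT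
  have hcont : Continuous fun t => Φ t z₀ :=
    continuous_iff_continuousAt.2 fun t => (hΦ.deriv z₀ t).continuousAt
  obtain ⟨R₀, hR₀⟩ := isCompact_Icc.exists_bound_of_continuousOn
    (hcont.continuousOn (s := Icc (-T) T))
  obtain ⟨A, hA⟩ := isCompact_Icc.exists_bound_of_continuousOn
    ((hf'.continuous.comp hcont).continuousOn (s := Icc (-T) T))
  obtain ⟨K, hK⟩ := exists_lipschitzOnWith_closedBall hf' (R₀ + C * ρ)
  have key : ∀ z, ‖z - z₀‖ ≤ ρ → ‖Φ t₀ z - Φ t₀ z₀ - Y t₀ z₀ (z - z₀)‖ ≤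
      (K * C ^ 2 * Real.exp ((|A| + 1) * T)) * ‖z - z₀‖ ^ 2 := fun z hz => by
    have hbound : ∀ t ∈ Icc (-T) T, ‖f (Φ t z) - f (Φ t z₀)
        - fderiv ℝ f (Φ t z₀) (Φ t z - Φ t z₀)‖ ≤ K * C ^ 2 * ‖z - z₀‖ ^ 2 := fun t ht => by
      have h1 := h z hz t ht
      have h2 : ‖Φ t z₀‖ ≤ R₀ + C * ρ := (hR₀ t ht).trans (by
        have : 0 ≤ C * ρ := by positivity
        linarith)
      have h3 : ‖Φ t z‖ ≤ R₀ + C * ρ := by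
        calc ‖Φ t z‖ = ‖Φ t z₀ + (Φ t z - Φ t z₀)‖ := by simp
          _ ≤ R₀ + C * ‖z - z₀‖ := (norm_add_le _ _).trans (add_le_add (hR₀ t ht) h1)
          _ ≤ _ := by gcongr
      refine (norm_sub_sub_le_of_lipschitzOnWith_fderiv (hf1.differentiable one_ne_zero) hK
        h2 h3).trans ?_
      calc (K : ℝ) * ‖Φ t z - Φ t z₀‖ ^ 2 ≤ K * (C * ‖z - z₀‖) ^ 2 := by gcongr
        _ = _ := by ring
    have hd : ∀ t ∈ Icc (-T) T, HasDerivWithinAt (fun t => Φ t z - Φ t z₀ - Y t z₀ (z - z₀))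
        (f (Φ t z) - f (Φ t z₀) - fderiv ℝ f (Φ t z₀) (Y t z₀ (z - z₀))) (Icc (-T) T) t :=
      fun t _ => ((((hΦ.deriv z t).sub (hΦ.deriv z₀ t)).sub
        ((hY z₀ t).clm_apply (hasDerivAt_const t (z - z₀)))).congr_deriv
          (by simp)).hasDerivWithinAt
    have := norm_le_of_norm_deriv_le (K := |A| + 1) (ε := K * C ^ 2 * ‖z - z₀‖ ^ 2) (δ := 0)
      (by linarith [abs_nonneg A]) (by positivity) hd (by simp [hΦ.zero, hY0]) (fun t ht => by
        have e : f (Φ t z) - f (Φ t z₀) - fderiv ℝ f (Φ t z₀) (Y t z₀ (z - z₀)) =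
            fderiv ℝ f (Φ t z₀) (Φ t z - Φ t z₀ - Y t z₀ (z - z₀)) +
            (f (Φ t z) - f (Φ t z₀) - fderiv ℝ f (Φ t z₀) (Φ t z - Φ t z₀)) := by
          simp only [map_sub]; abel
        rw [e]
        refine (norm_add_le _ _).trans (add_le_add ?_ (hbound t ht))
        refine ((fderiv ℝ f (Φ t z₀)).le_opNorm _).trans ?_
        gcongr
        exact (hA t ht).trans (by linarith [le_abs_self A])) t₀ ht₀
    rw [zero_add] at this
    linarith [this]
  rw [hasFDerivAt_iff_isLittleO_nhds_zero]
  refine Asymptotics.IsBigO.trans_isLittleO (g := fun h : E => ‖h‖ ^ 2) ?_ ?_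
  · refine Asymptotics.IsBigO.of_bound (K * C ^ 2 * Real.exp ((|A| + 1) * T)) ?_
    filter_upwards [Metric.closedBall_mem_nhds (0 : E) hρ] with w hw
    have := key (z₀ + w) (by simpa using hw)
    simpa using this
  · simpa using! (Asymptotics.isLittleO_norm_pow_id one_lt_two : (fun h : E => ‖h‖ ^ 2) =o[𝓝 0] id)

/-- A flow together with its linearization is again a flow, on E × E. This makes smoothness of the
linearization an instance of smoothness of flows and drives the induction below. -/
theorem IsFlowOf.tangent (hΦ : IsFlowOf f Φ)
    {Y : ℝ → E → E →L[ℝ] E} (hY0 : ∀ z, Y 0 z = ContinuousLinearMap.id ℝ E)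
    (hY : ∀ z t, HasDerivAt (fun s => Y s z) ((fderiv ℝ f (Φ t z)).comp (Y t z)) t) :
    IsFlowOf (fun p : E × E => (f p.1, fderiv ℝ f p.1 p.2))
      (fun t p => (Φ t p.1, Y t p.1 p.2)) :=
  ⟨fun p => by simp [hΦ.zero, hY0], fun p t => (hΦ.deriv p.1 t).prodMk
    (((hY p.1 t).clm_apply (hasDerivAt_const t p.2)).congr_deriv (by simp))⟩

end Dependence

/-- The flow of a smooth vector field is smooth. -/
theorem IsFlowOf.contDiff_nat (k : ℕ) : ∀ {E : Type*} [NormedAddCommGroup E] [NormedSpace ℝ E]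
    [FiniteDimensional ℝ E] {f : E → E} {Φ : ℝ → E → E}, IsFlowOf f Φ → ContDiff ℝ ∞ f →
    ContDiff ℝ k fun p : ℝ × E => Φ p.1 p.2 := by
  induction k with
  | zero =>
    intro E _ _ _ f Φ hΦ hf
    exact contDiff_zero.2 (hΦ.continuous (hf.of_le (by exact_mod_cast le_top)))
  | succ k ih =>
    intro E _ _ _ f Φ hΦ hf
    have hf1 : ContDiff ℝ 1 f := hf.of_le (by exact_mod_cast le_top)
    have hf2 : ContDiff ℝ 2 f := hf.of_le (WithTop.coe_le_coe.2 le_top)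
    obtain ⟨Y, hY0, hY⟩ := hΦ.exists_linearization hf1
    have hf' : ContDiff ℝ ∞ (fderiv ℝ f) := hf.fderiv_right (by simp)
    -- The induction hypothesis is used on E × E, which is why the space is quantified inside the
    -- induction on k.
    have hT := ih (hΦ.tangent hY0 hY)
      ((hf.comp contDiff_fst).prodMk ((hf'.comp contDiff_fst).clm_apply contDiff_snd))
    have hYk : ContDiff ℝ k fun p : ℝ × E => Y p.1 p.2 := by
      rw [contDiff_clm_apply_iff]
      intro y
      exact hT.snd.comp (contDiff_fst.prodMk (contDiff_snd.prodMk contDiff_const) :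
        ContDiff ℝ k fun p : ℝ × E => (p.1, (p.2, y)))
    have hΦk := ih hΦ hf
    have hfk : ContDiff ℝ k fun p : ℝ × E => f (Φ p.1 p.2) :=
      (hf.of_le (by exact_mod_cast le_top)).comp hΦk
    push_cast
    rw [contDiff_succ_iff_hasFDerivAt]
    refine ⟨fun p => ((ContinuousLinearMap.toSpanSingleton ℝ (f (Φ p.1 p.2))).coprod
      (Y p.1 p.2)), ?_, fun p => ?_⟩
    · rw [contDiff_clm_apply_iff]
      rintro ⟨s, y⟩
      simpa using (contDiff_const.smul hfk).add (hYk.clm_apply contDiff_const)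
    -- The partial derivatives in time and in space exist everywhere and are jointly continuous, so
    -- the total derivative exists.
    · have := hasStrictFDerivAt_uncurry_coprod (f := Φ) (u := p)
        (f₁ := fun t z => ContinuousLinearMap.toSpanSingleton ℝ (f (Φ t z))) (f₂ := Y)
        (Eventually.of_forall fun v => (hΦ.deriv v.2 v.1).hasFDerivAt)
        (Eventually.of_forall fun v => hΦ.hasFDerivAt_right hf2 hY0 hY v.1 v.2)
        ?_ hYk.continuous.continuousAt
      · exact this.hasFDerivAt
      · exact ((ContinuousLinearMap.toSpanSingletonCLE (𝕜 := ℝ) (E := E)).continuous.comp hfk.continuous).continuousAt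

theorem IsFlowOf.contDiff {E : Type*} [NormedAddCommGroup E] [NormedSpace ℝ E]
    [FiniteDimensional ℝ E] {f : E → E} {Φ : ℝ → E → E} (hΦ : IsFlowOf f Φ)
    (hf : ContDiff ℝ ∞ f) : ContDiff ℝ ∞ fun p : ℝ × E => Φ p.1 p.2 :=
  contDiff_infty.2 fun k => hΦ.contDiff_nat k hf

/-- A compactly supported smooth vector field has a global flow. -/
theorem exists_isFlowOf {E : Type*} [NormedAddCommGroup E] [NormedSpace ℝ E]
    [FiniteDimensional ℝ E] {f : E → E} (hf : ContDiff ℝ ∞ f) (hs : HasCompactSupport f) :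
    ∃ Φ, IsFlowOf f Φ := by
  obtain ⟨K, hK⟩ := hf.lipschitzWith_of_hasCompactSupport hs (by simp)
  choose y hy0 hy using exists_solution (X := fun _ => f) (fun _ => continuous_const)
    (fun _ => ⟨K, fun _ _ => hK⟩)
  exact ⟨fun t z => y z t, hy0, hy⟩

end Flow

/-! ### Calculus in coordinates -/

section CoordinateCalculus

variable {n : ℕ}

/-- The coordinate space. -/
abbrev Vec (n : ℕ) := EuclideanSpace ℝ (Fin n)

/-- The slit tangent bundle of an open set in coordinates. -/
def slit (O : Set (Vec n)) : Set (Vec n × Vec n) := O ×ˢ {0}ᶜ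

theorem mem_slit {O : Set (Vec n)} {x v : Vec n} : (x, v) ∈ slit O ↔ x ∈ O ∧ v ≠ 0 := Iff.rfl

theorem isOpen_slit {O : Set (Vec n)} (hO : IsOpen O) : IsOpen (slit O) :=
  hO.prod isOpen_compl_singleton

/-- Smooth functions of `(x, v)` on the slit tangent bundle of `O`. -/
def SmoothOnSlit (O : Set (Vec n)) (f : Vec n → Vec n → ℝ) : Prop :=
  ContDiffOn ℝ ∞ (fun p : Vec n × Vec n => f p.1 p.2) (slit O)

variable {O : Set (Vec n)} {f g : Vec n → Vec n → ℝ} {x v : Vec n}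

theorem SmoothOnSlit.contDiffAt (hf : SmoothOnSlit O f) (hO : IsOpen O) (hx : x ∈ O) (hv : v ≠ 0) :
    ContDiffAt ℝ ∞ (fun p : Vec n × Vec n => f p.1 p.2) (x, v) :=
  ContDiffOn.contDiffAt hf ((isOpen_slit hO).mem_nhds ⟨hx, hv⟩)

theorem SmoothOnSlit.differentiableAt (hf : SmoothOnSlit O f) (hO : IsOpen O) (hx : x ∈ O)
    (hv : v ≠ 0) : DifferentiableAt ℝ (fun p : Vec n × Vec n => f p.1 p.2) (x, v) :=
  (hf.contDiffAt hO hx hv).differentiableAt (by simp)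

theorem SmoothOnSlit.add (hf : SmoothOnSlit O f) (hg : SmoothOnSlit O g) :
    SmoothOnSlit O fun x v => f x v + g x v := ContDiffOn.add hf hg

theorem SmoothOnSlit.sub (hf : SmoothOnSlit O f) (hg : SmoothOnSlit O g) :
    SmoothOnSlit O fun x v => f x v - g x v := ContDiffOn.sub hf hg

theorem SmoothOnSlit.mul (hf : SmoothOnSlit O f) (hg : SmoothOnSlit O g) :
    SmoothOnSlit O fun x v => f x v * g x v := ContDiffOn.mul hf hg

theorem SmoothOnSlit.const (c : ℝ) : SmoothOnSlit O fun _ _ => c := contDiffOn_const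

theorem SmoothOnSlit.sum {ι : Type*} {s : Finset ι} {f : ι → Vec n → Vec n → ℝ}
    (hf : ∀ i ∈ s, SmoothOnSlit O (f i)) : SmoothOnSlit O fun x v => ∑ i ∈ s, f i x v :=
  ContDiffOn.sum hf

theorem SmoothOnSlit.coord (j : Fin n) : SmoothOnSlit O fun _ v => v j := by
  have : ContDiff ℝ ∞ fun p : Vec n × Vec n => p.2 j :=
    (EuclideanSpace.proj (𝕜 := ℝ) j).contDiff.comp contDiff_snd
  exact this.contDiffOn

theorem SmoothOnSlit.hasFDerivAt_left (hf : SmoothOnSlit O f) (hO : IsOpen O) (hx : x ∈ O)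
    (hv : v ≠ 0) : HasFDerivAt (fun y => f y v)
      ((fderiv ℝ (fun p : Vec n × Vec n => f p.1 p.2) (x, v)).comp
        (ContinuousLinearMap.inl ℝ (Vec n) (Vec n))) x :=
  HasFDerivAt.comp x (g := fun p : Vec n × Vec n => f p.1 p.2) (f := fun y => (y, v))
    (hf.differentiableAt hO hx hv).hasFDerivAt (hasFDerivAt_prodMk_left x v)

theorem SmoothOnSlit.hasFDerivAt_right (hf : SmoothOnSlit O f) (hO : IsOpen O) (hx : x ∈ O)
    (hv : v ≠ 0) : HasFDerivAt (fun w => f x w)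
      ((fderiv ℝ (fun p : Vec n × Vec n => f p.1 p.2) (x, v)).comp
        (ContinuousLinearMap.inr ℝ (Vec n) (Vec n))) v :=
  HasFDerivAt.comp v (g := fun p : Vec n × Vec n => f p.1 p.2) (f := fun w => (x, w))
    (hf.differentiableAt hO hx hv).hasFDerivAt (hasFDerivAt_prodMk_right x v)

theorem SmoothOnSlit.dX_eq (hf : SmoothOnSlit O f) (hO : IsOpen O) (hx : x ∈ O) (hv : v ≠ 0)
    (j : Fin n) : dX j f x v =
      fderiv ℝ (fun p : Vec n × Vec n => f p.1 p.2) (x, v) (EuclideanSpace.single j 1, 0) := by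
  rw [dX, (hf.hasFDerivAt_left hO hx hv).fderiv]
  simp

theorem SmoothOnSlit.dV_eq (hf : SmoothOnSlit O f) (hO : IsOpen O) (hx : x ∈ O) (hv : v ≠ 0)
    (j : Fin n) : dV j f x v =
      fderiv ℝ (fun p : Vec n × Vec n => f p.1 p.2) (x, v) (0, EuclideanSpace.single j 1) := by
  rw [dV, (hf.hasFDerivAt_right hO hx hv).fderiv]
  simp

theorem SmoothOnSlit.fderiv_apply (hf : SmoothOnSlit O f) (hO : IsOpen O) (h : Vec n × Vec n) :
    ContDiffOn ℝ ∞ (fun p => fderiv ℝ (fun p : Vec n × Vec n => f p.1 p.2) p h) (slit O) :=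
  (ContDiffOn.fderiv_of_isOpen hf (isOpen_slit hO) (by simp)).clm_apply contDiffOn_const

theorem SmoothOnSlit.dX (hf : SmoothOnSlit O f) (hO : IsOpen O) (j : Fin n) :
    SmoothOnSlit O (dX j f) :=
  (hf.fderiv_apply hO (EuclideanSpace.single j 1, 0)).congr
    fun _ hp => hf.dX_eq hO hp.1 hp.2 j

theorem SmoothOnSlit.dV (hf : SmoothOnSlit O f) (hO : IsOpen O) (j : Fin n) :
    SmoothOnSlit O (dV j f) :=
  (hf.fderiv_apply hO (0, EuclideanSpace.single j 1)).congr
    fun _ hp => hf.dV_eq hO hp.1 hp.2 j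

theorem vec_eq_sum (v : Vec n) : v = ∑ j, v j • EuclideanSpace.single j (1 : ℝ) := by
  ext i
  simp [Pi.single_apply]

theorem SmoothOnSlit.fderiv_eq_sum (hf : SmoothOnSlit O f) (hO : IsOpen O) (hx : x ∈ O)
    (hv : v ≠ 0) (a b : Vec n) :
    fderiv ℝ (fun p : Vec n × Vec n => f p.1 p.2) (x, v) (a, b) =
      ∑ j, Finsler.dX j f x v * a j + ∑ j, Finsler.dV j f x v * b j := by
  have : (a, b) = ∑ j, a j • ((EuclideanSpace.single j (1 : ℝ), 0) : Vec n × Vec n) +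
      ∑ j, b j • ((0, EuclideanSpace.single j (1 : ℝ)) : Vec n × Vec n) := by
    ext1
    · simp [Prod.fst_sum, ← vec_eq_sum]
    · simp [Prod.snd_sum, ← vec_eq_sum]
  rw [this, map_add, map_sum, map_sum]
  simp only [map_smul, smul_eq_mul]
  congr 1 <;> refine Finset.sum_congr rfl fun j _ => ?_
  · rw [hf.dX_eq hO hx hv, mul_comm]
  · rw [hf.dV_eq hO hx hv, mul_comm]

theorem SmoothOnSlit.hasDerivWithinAt (hf : SmoothOnSlit O f) (hO : IsOpen O) {y w : ℝ → Vec n}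
    {y' w' : Vec n} {S : Set ℝ} {t : ℝ} (hx : y t ∈ O) (hv : w t ≠ 0)
    (hy : HasDerivWithinAt y y' S t) (hw : HasDerivWithinAt w w' S t) :
    HasDerivWithinAt (fun s => f (y s) (w s))
      (∑ j, Finsler.dX j f (y t) (w t) * y' j + ∑ j, Finsler.dV j f (y t) (w t) * w' j) S t := by
  rw [← hf.fderiv_eq_sum hO hx hv]
  exact (hf.differentiableAt hO hx hv).hasFDerivAt.comp_hasDerivWithinAt (f := fun s => (y s, w s))
    t (hy.prodMk hw)

theorem SmoothOnSlit.hasDerivAt (hf : SmoothOnSlit O f) (hO : IsOpen O) {y w : ℝ → Vec n}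
    {y' w' : Vec n} {t : ℝ} (hx : y t ∈ O) (hv : w t ≠ 0)
    (hy : HasDerivAt y y' t) (hw : HasDerivAt w w' t) :
    HasDerivAt (fun s => f (y s) (w s))
      (∑ j, Finsler.dX j f (y t) (w t) * y' j + ∑ j, Finsler.dV j f (y t) (w t) * w' j) t := by
  rw [← hasDerivWithinAt_univ] at *
  exact hf.hasDerivWithinAt hO hx hv hy hw

theorem SmoothOnSlit.fderiv_fderiv_comm (hf : SmoothOnSlit O f) (hO : IsOpen O) (hx : x ∈ O)
    (hv : v ≠ 0) (h k : Vec n × Vec n) :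
    fderiv ℝ (fun q => fderiv ℝ (fun p : Vec n × Vec n => f p.1 p.2) q h) (x, v) k =
      fderiv ℝ (fun q => fderiv ℝ (fun p : Vec n × Vec n => f p.1 p.2) q k) (x, v) h := by
  have hc := hf.contDiffAt hO hx hv
  have hd : DifferentiableAt ℝ (fderiv ℝ fun p : Vec n × Vec n => f p.1 p.2) (x, v) :=
    (hc.fderiv_right (m := ∞) (by simp)).differentiableAt (by simp)
  rw [fderiv_clm_apply hd (differentiableAt_const _), fderiv_clm_apply hd (differentiableAt_const _)]
  have := (hc.isSymmSndFDerivAt (by simp only [minSmoothness_of_isRCLikeNormedField]; exact WithTop.coe_le_coe.2 le_top)) h k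
  simpa using this.symm

theorem fderiv_congr_slit {f g : Vec n × Vec n → ℝ} (hO : IsOpen O) (hx : x ∈ O) (hv : v ≠ 0)
    (h : ∀ p ∈ slit O, f p = g p) : fderiv ℝ f (x, v) = fderiv ℝ g (x, v) :=
  Filter.EventuallyEq.fderiv_eq
    (eventually_of_mem ((isOpen_slit hO).mem_nhds (mem_slit.2 ⟨hx, hv⟩)) h)

theorem SmoothOnSlit.dV_dV_comm (hf : SmoothOnSlit O f) (hO : IsOpen O) (hx : x ∈ O)
    (hv : v ≠ 0) (i j : Fin n) :
    Finsler.dV i (Finsler.dV j f) x v = Finsler.dV j (Finsler.dV i f) x v := by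
  rw [(hf.dV hO j).dV_eq hO hx hv, (hf.dV hO i).dV_eq hO hx hv,
    fderiv_congr_slit hO hx hv fun p hp => hf.dV_eq hO hp.1 hp.2 j,
    fderiv_congr_slit hO hx hv fun p hp => hf.dV_eq hO hp.1 hp.2 i]
  exact hf.fderiv_fderiv_comm hO hx hv _ _

theorem SmoothOnSlit.dX_dV_comm (hf : SmoothOnSlit O f) (hO : IsOpen O) (hx : x ∈ O)
    (hv : v ≠ 0) (i j : Fin n) :
    Finsler.dX i (Finsler.dV j f) x v = Finsler.dV j (Finsler.dX i f) x v := by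
  rw [(hf.dV hO j).dX_eq hO hx hv, (hf.dX hO i).dV_eq hO hx hv,
    fderiv_congr_slit hO hx hv fun p hp => hf.dV_eq hO hp.1 hp.2 j,
    fderiv_congr_slit hO hx hv fun p hp => hf.dX_eq hO hp.1 hp.2 i]
  exact hf.fderiv_fderiv_comm hO hx hv _ _

theorem dV_congr (hx : x ∈ O) (hv : v ≠ 0) (h : ∀ y ∈ O, ∀ w ≠ 0, f y w = g y w) (j : Fin n) :
    dV j f x v = dV j g x v := by
  rw [dV, dV]
  congr 1
  exact Filter.EventuallyEq.fderiv_eq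
    (eventually_of_mem (isOpen_compl_singleton.mem_nhds hv) fun w hw => h x hx w hw)

theorem dX_congr (hO : IsOpen O) (hx : x ∈ O) (hv : v ≠ 0)
    (h : ∀ y ∈ O, ∀ w ≠ 0, f y w = g y w) (j : Fin n) : dX j f x v = dX j g x v := by
  rw [dX, dX]
  congr 1
  exact Filter.EventuallyEq.fderiv_eq
    (eventually_of_mem (hO.mem_nhds hx) fun y hy => h y hy v hv)

theorem SmoothOnSlit.differentiableAt_left (hf : SmoothOnSlit O f) (hO : IsOpen O) (hx : x ∈ O)
    (hv : v ≠ 0) : DifferentiableAt ℝ (fun y => f y v) x :=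
  (hf.hasFDerivAt_left hO hx hv).differentiableAt

theorem SmoothOnSlit.differentiableAt_right (hf : SmoothOnSlit O f) (hO : IsOpen O) (hx : x ∈ O)
    (hv : v ≠ 0) : DifferentiableAt ℝ (fun w => f x w) v :=
  (hf.hasFDerivAt_right hO hx hv).differentiableAt

theorem SmoothOnSlit.dV_mul (hf : SmoothOnSlit O f) (hg : SmoothOnSlit O g) (hO : IsOpen O)
    (hx : x ∈ O) (hv : v ≠ 0) (j : Fin n) : Finsler.dV j (fun x v => f x v * g x v) x v =
      Finsler.dV j f x v * g x v + f x v * Finsler.dV j g x v := by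
  rw [Finsler.dV, fderiv_fun_mul (hf.differentiableAt_right hO hx hv)
    (hg.differentiableAt_right hO hx hv)]
  simp [Finsler.dV]
  ring

theorem SmoothOnSlit.dV_sub (hf : SmoothOnSlit O f) (hg : SmoothOnSlit O g) (hO : IsOpen O)
    (hx : x ∈ O) (hv : v ≠ 0) (j : Fin n) : Finsler.dV j (fun x v => f x v - g x v) x v =
      Finsler.dV j f x v - Finsler.dV j g x v := by
  rw [Finsler.dV, fderiv_fun_sub (hf.differentiableAt_right hO hx hv)
    (hg.differentiableAt_right hO hx hv)]
  simp [Finsler.dV]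

theorem SmoothOnSlit.dV_sum {ι : Type*} {s : Finset ι} {f : ι → Vec n → Vec n → ℝ}
    (hf : ∀ i ∈ s, SmoothOnSlit O (f i)) (hO : IsOpen O) (hx : x ∈ O) (hv : v ≠ 0) (j : Fin n) :
    Finsler.dV j (fun x v => ∑ i ∈ s, f i x v) x v = ∑ i ∈ s, Finsler.dV j (f i) x v := by
  rw [Finsler.dV, fderiv_fun_sum fun i hi => (hf i hi).differentiableAt_right hO hx hv]
  simp [Finsler.dV]

theorem dV_coord (i j : Fin n) : dV j (fun _ v => v i) x v = if i = j then 1 else 0 := by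
  have : HasFDerivAt (fun w : Vec n => w i) (EuclideanSpace.proj (𝕜 := ℝ) i) v :=
    (EuclideanSpace.proj (𝕜 := ℝ) i).hasFDerivAt
  rw [dV, this.fderiv]
  simp

theorem dV_const_mul (c : ℝ) (j : Fin n) : dV j (fun x v => c * f x v) x v = c * dV j f x v := by
  have := fderiv_const_smul_field (𝕜 := ℝ) (f := fun w => f x w) c
  exact congrArg (fun L => L v (EuclideanSpace.single j (1 : ℝ))) this

theorem dX_const_mul (c : ℝ) (j : Fin n) : dX j (fun x v => c * f x v) x v = c * dX j f x v := by
  have := fderiv_const_smul_field (𝕜 := ℝ) (f := fun y => f y v) c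
  exact congrArg (fun L => L x (EuclideanSpace.single j (1 : ℝ))) this

/-! #### Homogeneity -/

/-- Positive homogeneity of degree `k` in `v ≠ 0`. -/
def HomogOn (O : Set (Vec n)) (k : ℤ) (f : Vec n → Vec n → ℝ) : Prop :=
  ∀ x ∈ O, ∀ v ≠ 0, ∀ a : ℝ, 0 < a → f x (a • v) = a ^ k * f x v

/-- Differentiate the homogeneity relation in the scale at a = 1. This is the source of the
contractions with the velocity used for the spray and for g. -/
theorem HomogOn.euler {k : ℤ} (h : HomogOn O k f) (hf : SmoothOnSlit O f) (hO : IsOpen O)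
    (hx : x ∈ O) (hv : v ≠ 0) : ∑ j, dV j f x v * v j = k * f x v := by
  have h1 : HasDerivAt (fun a : ℝ => f x (a • v)) (∑ j, dV j f x v * v j) 1 := by
    have := hf.hasDerivAt hO (y := fun _ => x) (w := fun a : ℝ => a • v) (t := 1) hx
      (by simpa using hv) (hasDerivAt_const _ _) ((hasDerivAt_id (1 : ℝ)).smul_const v)
    simpa using this
  have h2 : HasDerivAt (fun a : ℝ => a ^ k * f x v) (k * f x v) 1 := by
    have := (hasDerivAt_zpow k (1 : ℝ) (Or.inl one_ne_zero)).mul_const (f x v)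
    simpa using this
  refine h1.unique (h2.congr_of_eventuallyEq ?_)
  filter_upwards [lt_mem_nhds one_pos] with a ha using h x hx v hv a ha

theorem HomogOn.dV {k : ℤ} (h : HomogOn O k f) (hf : SmoothOnSlit O f) (hO : IsOpen O)
    (j : Fin n) : HomogOn O (k - 1) (Finsler.dV j f) := fun x hx v hv a ha => by
  have h1 : HasFDerivAt (fun w => f x (a • w)) (a • fderiv ℝ (fun w => f x w) (a • v)) v := by
    have := (hf.differentiableAt_right hO hx (smul_ne_zero ha.ne' hv)).hasFDerivAt.comp v
      ((hasFDerivAt_id (𝕜 := ℝ) v).const_smul a)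
    refine this.congr_fderiv ?_
    ext
    simp
  have h2 : HasFDerivAt (fun w => f x (a • w)) (a ^ k • fderiv ℝ (fun w => f x w) v) v := by
    refine ((hf.differentiableAt_right hO hx hv).hasFDerivAt.const_mul (a ^ k)).congr_of_eventuallyEq
      ?_
    filter_upwards [isOpen_compl_singleton.mem_nhds hv] with w hw using h x hx w hw a ha
  have := congrArg (fun L => L (EuclideanSpace.single j (1 : ℝ))) (h1.unique h2)
  simp only [smul_apply, smul_eq_mul] at this
  simp only [Finsler.dV]
  rw [zpow_sub_one₀ ha.ne']
  field_simp
  linarith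

theorem HomogOn.dX {k : ℤ} (h : HomogOn O k f) (hf : SmoothOnSlit O f) (hO : IsOpen O)
    (j : Fin n) : HomogOn O k (Finsler.dX j f) := fun x hx v hv a ha => by
  simp only [Finsler.dX]
  have : fderiv ℝ (fun y => f y (a • v)) x = fderiv ℝ (fun y => a ^ k * f y v) x :=
    Filter.EventuallyEq.fderiv_eq (eventually_of_mem (hO.mem_nhds hx) fun y hy => h y hy v hv a ha)
  rw [this, fderiv_const_mul (hf.differentiableAt_left hO hx hv)]
  simp

theorem HomogOn.mul {k l : ℤ} (hf : HomogOn O k f) (hg : HomogOn O l g) :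
    HomogOn O (k + l) fun x v => f x v * g x v := fun x hx v hv a ha => by
  simp only [hf x hx v hv a ha, hg x hx v hv a ha, zpow_add₀ ha.ne']
  ring

theorem HomogOn.add {k : ℤ} (hf : HomogOn O k f) (hg : HomogOn O k g) :
    HomogOn O k fun x v => f x v + g x v := fun x hx v hv a ha => by
  simp only [hf x hx v hv a ha, hg x hx v hv a ha]
  ring

theorem HomogOn.sub {k : ℤ} (hf : HomogOn O k f) (hg : HomogOn O k g) :
    HomogOn O k fun x v => f x v - g x v := fun x hx v hv a ha => by
  simp only [hf x hx v hv a ha, hg x hx v hv a ha]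
  ring

theorem HomogOn.const_mul {k : ℤ} (hf : HomogOn O k f) (c : ℝ) :
    HomogOn O k fun x v => c * f x v := fun x hx v hv a ha => by
  simp only [hf x hx v hv a ha]
  ring

theorem HomogOn.sum {k : ℤ} {ι : Type*} {s : Finset ι} {f : ι → Vec n → Vec n → ℝ}
    (hf : ∀ i ∈ s, HomogOn O k (f i)) : HomogOn O k fun x v => ∑ i ∈ s, f i x v :=
  fun x hx v hv a ha => by
    simp only [Finset.mul_sum]
    exact Finset.sum_congr rfl fun i hi => hf i hi x hx v hv a ha

theorem HomogOn.coord (j : Fin n) : HomogOn O 1 fun _ v => v j := fun x _ v _ a _ => by simp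

end CoordinateCalculus

/-! ### The spray, the nonlinear connection and the curvature in coordinates -/

section LocalFinsler

variable {n : ℕ}

/-- Finsler structures on an open set of the coordinate space. -/
structure IsLocalFinsler (O : Set (Vec n)) (F : Vec n → Vec n → ℝ) : Prop where
  isOpen : IsOpen O
  smooth : SmoothOnSlit O F
  homog : ∀ x ∈ O, ∀ v, ∀ a : ℝ, 0 < a → F x (a • v) = a * F x v
  posDef : ∀ x ∈ O, ∀ v ≠ 0, (gMatrix F x v).PosDef

/-- `F²`. -/
abbrev energy (F : Vec n → Vec n → ℝ) : Vec n → Vec n → ℝ := fun y w => F y w ^ 2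

theorem SmoothOnSlit.prod {O : Set (Vec n)} {ι : Type*} {s : Finset ι} {f : ι → Vec n → Vec n → ℝ}
    (hf : ∀ i ∈ s, SmoothOnSlit O (f i)) : SmoothOnSlit O fun x v => ∏ i ∈ s, f i x v :=
  contDiffOn_prod hf

theorem SmoothOnSlit.det {O : Set (Vec n)} {m : ℕ} {A : Vec n → Vec n → Matrix (Fin m) (Fin m) ℝ}
    (hA : ∀ i j, SmoothOnSlit O fun x v => A x v i j) : SmoothOnSlit O fun x v => (A x v).det := by
  simp only [Matrix.det_apply']
  exact SmoothOnSlit.sum fun σ _ => (SmoothOnSlit.const _).mul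
    (SmoothOnSlit.prod fun i _ => hA (σ i) i)

/-- Cramer's rule: the inverse is the adjugate over the determinant, and an entry of the adjugate is
the determinant of a matrix with one row replaced by constants. -/
theorem SmoothOnSlit.matrix_inv {O : Set (Vec n)} {m : ℕ}
    {A : Vec n → Vec n → Matrix (Fin m) (Fin m) ℝ}
    (hA : ∀ i j, SmoothOnSlit O fun x v => A x v i j)
    (hdet : ∀ x ∈ O, ∀ v ≠ 0, (A x v).det ≠ 0) (i j : Fin m) :
    SmoothOnSlit O fun x v => (A x v)⁻¹ i j := by
  have h1 : SmoothOnSlit O fun x v => ((A x v).det)⁻¹ :=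
    ContDiffOn.inv (SmoothOnSlit.det hA) fun p hp => hdet p.1 hp.1 p.2 hp.2
  have h2 : SmoothOnSlit O fun x v => (A x v).adjugate i j := by
    simp only [Matrix.adjugate_apply]
    refine SmoothOnSlit.det fun k l => ?_
    by_cases hk : k = j
    · subst hk
      simpa using SmoothOnSlit.const _
    · simpa [Matrix.updateRow_ne hk] using hA k l
  simpa [Matrix.inv_def, Ring.inverse_eq_inv'] using h1.mul h2

variable {O : Set (Vec n)} {F : Vec n → Vec n → ℝ} {x v : Vec n}

namespace IsLocalFinsler

theorem smooth_energy (h : IsLocalFinsler O F) : SmoothOnSlit O (energy F) :=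
  ContDiffOn.pow h.smooth 2

theorem homog_energy (h : IsLocalFinsler O F) : HomogOn O 2 (energy F) := fun x hx v _ a ha => by
  simp only [energy, h.homog x hx v a ha]
  rw [mul_pow]
  norm_cast

theorem smooth_gLow (h : IsLocalFinsler O F) (i j : Fin n) : SmoothOnSlit O (gLow F i j) :=
  (SmoothOnSlit.const (1 / 2)).mul ((h.smooth_energy.dV h.isOpen j).dV h.isOpen i)

theorem gLow_symm (h : IsLocalFinsler O F) (hx : x ∈ O) (hv : v ≠ 0) (i j : Fin n) :
    gLow F i j x v = gLow F j i x v := by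
  rw [gLow, gLow, h.smooth_energy.dV_dV_comm h.isOpen hx hv]

theorem homog_gLow (h : IsLocalFinsler O F) (i j : Fin n) : HomogOn O 0 (gLow F i j) :=
  ((h.homog_energy.dV h.smooth_energy h.isOpen j).dV (h.smooth_energy.dV h.isOpen j)
    h.isOpen i).const_mul (1 / 2)

theorem det_ne_zero (h : IsLocalFinsler O F) (hx : x ∈ O) (hv : v ≠ 0) :
    (gMatrix F x v).det ≠ 0 := (h.posDef x hx v hv).det_pos.ne'

theorem smooth_gUp (h : IsLocalFinsler O F) (i j : Fin n) : SmoothOnSlit O (gUp F i j) :=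
  SmoothOnSlit.matrix_inv (A := gMatrix F) (fun i j => h.smooth_gLow i j)
    (fun _ hx _ hv => h.det_ne_zero hx hv) i j

theorem homog_gMatrix (h : IsLocalFinsler O F) (hx : x ∈ O) (hv : v ≠ 0) {a : ℝ} (ha : 0 < a) :
    gMatrix F x (a • v) = gMatrix F x v := by
  ext i j
  simpa [gMatrix] using h.homog_gLow i j x hx v hv a ha

theorem homog_gUp (h : IsLocalFinsler O F) (i j : Fin n) : HomogOn O 0 (gUp F i j) :=
  fun x hx v hv a ha => by simp [gUp, h.homog_gMatrix hx hv ha]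

theorem sum_gLow_mul_gUp (h : IsLocalFinsler O F) (hx : x ∈ O) (hv : v ≠ 0) (m l : Fin n) :
    ∑ i, gLow F m i x v * gUp F i l x v = if m = l then 1 else 0 := by
  have := congrFun (congrFun (Matrix.mul_nonsing_inv (gMatrix F x v)
    (isUnit_iff_ne_zero.2 (h.det_ne_zero hx hv))) m) l
  simpa [Matrix.mul_apply, Matrix.one_apply, gUp, gMatrix] using this

theorem smooth_formalChristoffel (h : IsLocalFinsler O F) (i j k : Fin n) :
    SmoothOnSlit O (formalChristoffel F i j k) :=
  (SmoothOnSlit.const _).mul (SmoothOnSlit.sum fun l _ => (h.smooth_gUp i l).mul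
    ((((h.smooth_gLow l k).dX h.isOpen j).add ((h.smooth_gLow j l).dX h.isOpen k)).sub
      ((h.smooth_gLow j k).dX h.isOpen l)))

theorem homog_formalChristoffel (h : IsLocalFinsler O F) (i j k : Fin n) :
    HomogOn O 0 (formalChristoffel F i j k) :=
  HomogOn.const_mul (HomogOn.sum fun l _ => (h.homog_gUp i l).mul
    ((((h.homog_gLow l k).dX (h.smooth_gLow l k) h.isOpen j).add
      ((h.homog_gLow j l).dX (h.smooth_gLow j l) h.isOpen k)).sub
      ((h.homog_gLow j k).dX (h.smooth_gLow j k) h.isOpen l))) _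

theorem smooth_spray (h : IsLocalFinsler O F) (i : Fin n) : SmoothOnSlit O (spray F i) :=
  (SmoothOnSlit.const _).mul (SmoothOnSlit.sum fun j _ => SmoothOnSlit.sum fun k _ =>
    ((h.smooth_formalChristoffel i j k).mul (SmoothOnSlit.coord j)).mul (SmoothOnSlit.coord k))

theorem homog_spray (h : IsLocalFinsler O F) (i : Fin n) : HomogOn O 2 (spray F i) :=
  HomogOn.const_mul (HomogOn.sum fun j _ => HomogOn.sum fun k _ =>
    ((h.homog_formalChristoffel i j k).mul (HomogOn.coord j)).mul (HomogOn.coord k)) _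

theorem smooth_nonlinConn (h : IsLocalFinsler O F) (i j : Fin n) :
    SmoothOnSlit O (nonlinConn F i j) := (h.smooth_spray i).dV h.isOpen j

theorem homog_nonlinConn (h : IsLocalFinsler O F) (i j : Fin n) :
    HomogOn O 1 (nonlinConn F i j) := (h.homog_spray i).dV (h.smooth_spray i) h.isOpen j

theorem homog_curvCoeff (h : IsLocalFinsler O F) (i j : Fin n) :
    HomogOn O 2 (curvCoeff F i j) := by
  have hN := h.homog_nonlinConn
  exact ((HomogOn.const_mul ((h.homog_spray i).dX (h.smooth_spray i) h.isOpen j) 2).sub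
    (HomogOn.sum fun k _ =>
      (((hN i j).dX (h.smooth_nonlinConn i j) h.isOpen k).mul (HomogOn.coord k)).sub
      ((((hN i j).dV (h.smooth_nonlinConn i j) h.isOpen k).const_mul 2).mul
        (h.homog_spray k)))).sub
    (HomogOn.sum fun k _ => (hN i k).mul (hN k j))

/-- Euler's identity for the spray, of degree two. Along a geodesic it expresses that the velocity
is parallel. -/
theorem sum_nonlinConn_mul (h : IsLocalFinsler O F) (hx : x ∈ O) (hv : v ≠ 0) (i : Fin n) :
    ∑ j, nonlinConn F i j x v * v j = 2 * spray F i x v := by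
  have := (h.homog_spray i).euler (h.smooth_spray i) h.isOpen hx hv
  simpa [nonlinConn] using this

theorem sum_dV_energy_mul (h : IsLocalFinsler O F) (hx : x ∈ O) (hv : v ≠ 0) :
    ∑ j, dV j (energy F) x v * v j = 2 * energy F x v := by
  have := h.homog_energy.euler h.smooth_energy h.isOpen hx hv
  simpa using this

/-- Euler's identity for the fibre derivatives of F², of degree one. It identifies g_v(v, ·) with
the momentum, that is, half the fibre differential of F². -/
theorem sum_gLow_mul (h : IsLocalFinsler O F) (hx : x ∈ O) (hv : v ≠ 0) (i : Fin n) :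
    ∑ j, gLow F i j x v * v j = 1 / 2 * dV i (energy F) x v := by
  have := (h.homog_energy.dV h.smooth_energy h.isOpen i).euler (h.smooth_energy.dV h.isOpen i)
    h.isOpen hx hv
  have e : ∀ j, gLow F i j x v * v j = 1 / 2 * (dV j (dV i (energy F)) x v * v j) := fun j => by
    rw [h.gLow_symm hx hv, gLow]; ring
  simp only [e, ← Finset.mul_sum, this]
  norm_num

theorem sum_sum_gLow_mul (h : IsLocalFinsler O F) (hx : x ∈ O) (hv : v ≠ 0) :
    ∑ i, ∑ j, gLow F i j x v * v i * v j = energy F x v := by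
  have e : ∀ i, ∑ j, gLow F i j x v * v i * v j = 1 / 2 * (dV i (energy F) x v * v i) := fun i => by
    have := h.sum_gLow_mul hx hv i
    calc ∑ j, gLow F i j x v * v i * v j = (∑ j, gLow F i j x v * v j) * v i := by
          rw [Finset.sum_mul]; exact Finset.sum_congr rfl fun j _ => by ring
      _ = _ := by rw [this]; ring
  simp only [e, ← Finset.mul_sum, h.sum_dV_energy_mul hx hv]
  ring

/-- The Euler–Lagrange expression of `F²` at the spray vanishes. -/
theorem four_mul_sum_gLow_mul_spray (h : IsLocalFinsler O F) (hx : x ∈ O) (hv : v ≠ 0)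
    (m : Fin n) : 4 * ∑ i, gLow F m i x v * spray F i x v =
      ∑ j, v j * dX j (dV m (energy F)) x v - dX m (energy F) x v := by
  have hQ := h.smooth_energy
  have hdX : ∀ a b c : Fin n, dX c (gLow F a b) x v =
      1 / 2 * dX c (dV a (dV b (energy F))) x v := fun a b c => dX_const_mul _ _
  -- Euler's identity in degree one: contracting one fibre index of a second fibre derivative of F²
  -- with v removes that index. In `hsum2` the degree is two, which produces the factor 2.
  have hsum1 : ∀ j a : Fin n, ∑ k, dX j (dV a (dV k (energy F))) x v * v k =
      dX j (dV a (energy F)) x v := fun j a => by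
    have hd : SmoothOnSlit O (dX j (dV a (energy F))) := (hQ.dV h.isOpen a).dX h.isOpen j
    have := ((h.homog_energy.dV hQ h.isOpen a).dX (hQ.dV h.isOpen a) h.isOpen j).euler hd
      h.isOpen hx hv
    norm_num at this
    rw [← this]
    refine Finset.sum_congr rfl fun k _ => ?_
    rw [← (hQ.dV h.isOpen a).dX_dV_comm h.isOpen hx hv,
      dX_congr h.isOpen hx hv (fun y hy w hw => hQ.dV_dV_comm h.isOpen hy hw a k)]
  have hsum2 : ∑ j, dX m (dV j (energy F)) x v * v j = 2 * dX m (energy F) x v := by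
    have := (h.homog_energy.dX hQ h.isOpen m).euler (hQ.dX h.isOpen m) h.isOpen hx hv
    rw [← (by simpa using this : _ = 2 * dX m (energy F) x v)]
    exact Finset.sum_congr rfl fun k _ => by rw [hQ.dX_dV_comm h.isOpen hx hv]
  have hG : ∀ i, spray F i x v = 1 / 4 * ∑ l, gUp F i l x v * ∑ j, ∑ k,
      (dX j (gLow F l k) x v + dX k (gLow F j l) x v - dX l (gLow F j k) x v) * v j * v k :=
    fun i => by
      simp only [spray, formalChristoffel, Finset.mul_sum, Finset.sum_mul]
      rw [Finset.sum_comm_cycle]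
      exact Finset.sum_congr rfl fun l _ => Finset.sum_congr rfl fun j _ =>
        Finset.sum_congr rfl fun k _ => by ring
  -- Lowering the free index of the spray cancels the inverse metric in its definition, leaving only
  -- first derivatives of g_{ij}.
  have hinv : ∀ B : Fin n → ℝ, ∑ i, gLow F m i x v * ∑ l, gUp F i l x v * B l = B m := fun B => by
    simp only [Finset.mul_sum]
    rw [Finset.sum_comm]
    have : ∀ l, ∑ i, gLow F m i x v * (gUp F i l x v * B l) = (if m = l then 1 else 0) * B l :=
      fun l => by
        rw [← h.sum_gLow_mul_gUp hx hv, Finset.sum_mul]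
        exact Finset.sum_congr rfl fun i _ => by ring
    simp [this]
  have e1 : 4 * ∑ i, gLow F m i x v * spray F i x v = ∑ j, ∑ k,
      (dX j (gLow F m k) x v + dX k (gLow F j m) x v - dX m (gLow F j k) x v) * v j * v k := by
    rw [← hinv fun l => ∑ j, ∑ k,
      (dX j (gLow F l k) x v + dX k (gLow F j l) x v - dX l (gLow F j k) x v) * v j * v k,
      Finset.mul_sum]
    exact Finset.sum_congr rfl fun i _ => by rw [hG i]; ring
  have t1 : ∑ j, ∑ k, dX j (gLow F m k) x v * v j * v k =
      1 / 2 * ∑ j, v j * dX j (dV m (energy F)) x v := by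
    rw [Finset.mul_sum]
    refine Finset.sum_congr rfl fun j _ => ?_
    rw [← hsum1 j m, Finset.mul_sum, Finset.mul_sum]
    exact Finset.sum_congr rfl fun k _ => by rw [hdX]; ring
  have t2 : ∑ j, ∑ k, dX k (gLow F j m) x v * v j * v k =
      1 / 2 * ∑ j, v j * dX j (dV m (energy F)) x v := by
    rw [Finset.sum_comm, ← t1]
    refine Finset.sum_congr rfl fun j _ => Finset.sum_congr rfl fun k _ => ?_
    rw [dX_congr h.isOpen hx hv (fun y hy w hw => h.gLow_symm hy hw k m)]
    ring
  have t3 : ∑ j, ∑ k, dX m (gLow F j k) x v * v j * v k = dX m (energy F) x v := by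
    have : ∀ j, ∑ k, dX m (gLow F j k) x v * v j * v k =
        1 / 2 * (dX m (dV j (energy F)) x v * v j) := fun j => by
      rw [← hsum1 m j, Finset.sum_mul, Finset.mul_sum]
      exact Finset.sum_congr rfl fun k _ => by rw [hdX]; ring
    simp only [this, ← Finset.mul_sum, hsum2]
    ring
  rw [e1]
  simp only [sub_mul, add_mul, Finset.sum_sub_distrib, Finset.sum_add_distrib, t1, t2, t3]
  ring

/-- The fibre derivative of g is half a third fibre derivative of F² (the Cartan tensor), so its
indices may be permuted. -/
theorem dV_gLow_symm (h : IsLocalFinsler O F) (hx : x ∈ O) (hv : v ≠ 0) (i j k : Fin n) :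
    dV i (gLow F j k) x v = dV j (gLow F i k) x v := by
  have hQ := h.smooth_energy
  have hdV : ∀ a b c : Fin n, dV c (gLow F a b) x v =
      1 / 2 * dV c (dV a (dV b (energy F))) x v := fun a b c => dV_const_mul _ _
  rw [hdV, hdV, (hQ.dV h.isOpen k).dV_dV_comm h.isOpen hx hv]

/-- This is the fibre derivative of the Euler–Lagrange identity; the first term on the right comes
from differentiating the explicit factor v^k. Its antisymmetric and symmetric parts in (m, j) are
the next two results. -/
theorem dV_four_mul_sum (h : IsLocalFinsler O F) (hx : x ∈ O) (hv : v ≠ 0) (m j : Fin n) :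
    4 * ∑ i, (dV j (gLow F m i) x v * spray F i x v + gLow F m i x v * nonlinConn F i j x v) =
      dX j (dV m (energy F)) x v + ∑ k, v k * dV j (dX k (dV m (energy F))) x v
        - dV j (dX m (energy F)) x v := by
  have hQ := h.smooth_energy
  have hO := h.isOpen
  have h1 := dV_congr hx hv (fun y hy w hw => h.four_mul_sum_gLow_mul_spray hy hw m) j
  have hs : ∀ i ∈ (Finset.univ : Finset (Fin n)),
      SmoothOnSlit O fun x v => gLow F m i x v * spray F i x v :=
    fun i _ => (h.smooth_gLow m i).mul (h.smooth_spray i)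
  have hs2 : ∀ k ∈ (Finset.univ : Finset (Fin n)),
      SmoothOnSlit O fun x v => v k * dX k (dV m (energy F)) x v :=
    fun k _ => (SmoothOnSlit.coord k).mul ((hQ.dV hO m).dX hO k)
  rw [dV_const_mul, SmoothOnSlit.dV_sum hs hO hx hv,
    SmoothOnSlit.dV_sub (SmoothOnSlit.sum hs2) (hQ.dX hO m) hO hx hv,
    SmoothOnSlit.dV_sum hs2 hO hx hv] at h1
  have e1 : ∀ i, dV j (fun x v => gLow F m i x v * spray F i x v) x v =
      dV j (gLow F m i) x v * spray F i x v + gLow F m i x v * nonlinConn F i j x v := fun i =>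
    SmoothOnSlit.dV_mul (h.smooth_gLow m i) (h.smooth_spray i) hO hx hv j
  have e2 : ∀ k, dV j (fun x v => v k * dX k (dV m (energy F)) x v) x v =
      (if k = j then 1 else 0) * dX k (dV m (energy F)) x v +
        v k * dV j (dX k (dV m (energy F))) x v := fun k => by
    rw [SmoothOnSlit.dV_mul (SmoothOnSlit.coord k) ((hQ.dV hO m).dX hO k) hO hx hv, dV_coord]
  simp only [e1, e2, Finset.sum_add_distrib, ite_mul, one_mul, zero_mul, Finset.sum_ite_eq',
    Finset.mem_univ, if_true] at h1
  rw [Finset.sum_add_distrib]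
  exact h1

/-- The antisymmetric part of `g_{mi} N^i_j`. -/
theorem sum_gLow_mul_nonlinConn_sub (h : IsLocalFinsler O F) (hx : x ∈ O) (hv : v ≠ 0)
    (m j : Fin n) : 2 * (∑ i, gLow F m i x v * nonlinConn F i j x v
        - ∑ i, gLow F j i x v * nonlinConn F i m x v) =
      dX j (dV m (energy F)) x v - dX m (dV j (energy F)) x v := by
  have hQ := h.smooth_energy
  have h1 := h.dV_four_mul_sum hx hv m j
  have h2 := h.dV_four_mul_sum hx hv j m
  have e1 : ∀ i, dV j (gLow F m i) x v = dV m (gLow F j i) x v := fun i => h.dV_gLow_symm hx hv _ _ _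
  have e2 : ∀ k, dV j (dX k (dV m (energy F))) x v = dV m (dX k (dV j (energy F))) x v := fun k => by
    rw [← (hQ.dV h.isOpen m).dX_dV_comm h.isOpen hx hv,
      ← (hQ.dV h.isOpen j).dX_dV_comm h.isOpen hx hv,
      dX_congr h.isOpen hx hv (fun y hy w hw => hQ.dV_dV_comm h.isOpen hy hw j m)]
  have e3 := hQ.dX_dV_comm h.isOpen hx hv m j
  have e4 := hQ.dX_dV_comm h.isOpen hx hv j m
  simp only [Finset.sum_add_distrib, e1, e2] at h1 h2
  -- Subtracting the two identities cancels the Cartan terms and the sums over v^k, both symmetric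
  -- in m and j. The remaining mixed derivatives pair up through `e3` and `e4`.
  linarith

/-- Compatibility of the nonlinear connection with `g`. -/
theorem sum_gLow_mul_nonlinConn_add (h : IsLocalFinsler O F) (hx : x ∈ O) (hv : v ≠ 0)
    (m j : Fin n) : ∑ i, gLow F m i x v * nonlinConn F i j x v
        + ∑ i, gLow F j i x v * nonlinConn F i m x v =
      ∑ k, dX k (gLow F m j) x v * v k - 2 * ∑ k, dV k (gLow F m j) x v * spray F k x v := by
  have hQ := h.smooth_energy
  have h1 := h.dV_four_mul_sum hx hv m j
  have h2 := h.dV_four_mul_sum hx hv j m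
  have hdX : ∀ c : Fin n, dX c (gLow F m j) x v =
      1 / 2 * dX c (dV m (dV j (energy F))) x v := fun c => dX_const_mul _ _
  have e0 : ∀ a b i, dV a (gLow F b i) x v = dV i (gLow F b a) x v := fun a b i => by
    rw [h.dV_gLow_symm hx hv a b i, dV_congr hx hv (fun y hy w hw => h.gLow_symm hy hw a i),
      h.dV_gLow_symm hx hv b i a]
  have e1 : ∀ i, dV j (gLow F m i) x v = dV i (gLow F m j) x v := fun i => e0 _ _ _
  have e1' : ∀ i, dV m (gLow F j i) x v = dV i (gLow F m j) x v := fun i => by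
    rw [e0, dV_congr hx hv (fun y hy w hw => h.gLow_symm hy hw j m)]
  have e2 : ∀ k, v k * dV j (dX k (dV m (energy F))) x v = 2 * (dX k (gLow F m j) x v * v k) :=
    fun k => by
      rw [hdX, ← (hQ.dV h.isOpen m).dX_dV_comm h.isOpen hx hv,
        dX_congr h.isOpen hx hv (fun y hy w hw => hQ.dV_dV_comm h.isOpen hy hw j m)]
      ring
  have e2' : ∀ k, v k * dV m (dX k (dV j (energy F))) x v = 2 * (dX k (gLow F m j) x v * v k) :=
    fun k => by
      rw [hdX, ← (hQ.dV h.isOpen j).dX_dV_comm h.isOpen hx hv]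
      ring
  have e3 := hQ.dX_dV_comm h.isOpen hx hv m j
  have e4 := hQ.dX_dV_comm h.isOpen hx hv j m
  simp only [Finset.sum_add_distrib, e1, e2, e1', e2', ← Finset.mul_sum] at h1 h2
  -- Adding the two identities cancels the mixed derivatives of F² with free indices m and j; the
  -- Cartan terms and the sums over v^k double.
  linarith

end IsLocalFinsler

end LocalFinsler

/-! ### Matrices: derivatives and a trace inequality -/

section MatrixLemmas

open Matrix

theorem PosDef.exists_eq_transpose_mul_self {m : ℕ} {G : Matrix (Fin m) (Fin m) ℝ} (hG : G.PosDef) :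
    ∃ L : Matrix (Fin m) (Fin m) ℝ, G = Lᵀ * L ∧ IsUnit L.det := by
  open scoped MatrixOrder in
  obtain ⟨L, hL⟩ := CStarAlgebra.nonneg_iff_eq_star_mul_self.mp hG.posSemidef.nonneg
  have hL' : G = Lᵀ * L := by
    rw [hL, Matrix.star_eq_conjTranspose, Matrix.conjTranspose_eq_transpose_of_trivial]
  refine ⟨L, hL', isUnit_iff_ne_zero.2 fun h => ?_⟩
  have := hG.det_pos
  rw [hL', Matrix.det_mul, h, mul_zero] at this
  exact this.false

/-- Writing G = LᵀL, a G-self-adjoint V is conjugate by L to a symmetric S, and tr V² = tr S² is the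
sum of the squares of the entries of S. -/
theorem trace_mul_self_nonneg_of_symm {m : ℕ} {G V : Matrix (Fin m) (Fin m) ℝ} (hG : G.PosDef)
    (hV : (G * V)ᵀ = G * V) : 0 ≤ (V * V).trace := by
  obtain ⟨L, rfl, hL⟩ := PosDef.exists_eq_transpose_mul_self hG
  set S := L * V * L⁻¹ with hS
  have hLT : IsUnit Lᵀ.det := by rwa [det_transpose]
  have hsymm : Sᵀ = S := by
    have e : S = (Lᵀ)⁻¹ * (Lᵀ * L * V) * L⁻¹ := by
      rw [hS, Matrix.mul_assoc Lᵀ, nonsing_inv_mul_cancel_left _ _ hLT]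
    rw [e, transpose_mul, transpose_mul, hV]
    simp only [transpose_nonsing_inv, transpose_transpose, Matrix.mul_assoc]
  have htr : (V * V).trace = (S * S).trace := by
    have : S * S = L * (V * V) * L⁻¹ := by
      rw [hS]
      simp only [Matrix.mul_assoc, nonsing_inv_mul_cancel_left _ _ hL]
    rw [this, trace_mul_comm (L * (V * V)), nonsing_inv_mul_cancel_left _ _ hL]
  rw [htr, trace]
  refine Finset.sum_nonneg fun i _ => ?_
  rw [diag_apply, mul_apply]
  refine Finset.sum_nonneg fun j _ => ?_
  have : S j i = S i j := by rw [← transpose_apply S, hsymm]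
  rw [this]
  exact mul_self_nonneg _

/-- Apply the preceding positivity to the trace-free part of B. This is the Cauchy–Schwarz
inequality for the eigenvalues of B. -/
theorem trace_sq_le_of_symm {m : ℕ} {G B : Matrix (Fin m) (Fin m) ℝ} (hG : G.PosDef)
    (hB : (G * B)ᵀ = G * B) : B.trace ^ 2 ≤ m * (B * B).trace := by
  rcases Nat.eq_zero_or_pos m with rfl | hm
  · simp [trace]
  have hm' : (0 : ℝ) < m := by exact_mod_cast hm
  have hGs : Gᵀ = G := hG.isHermitian
  have := trace_mul_self_nonneg_of_symm hG (V := B - (B.trace / m) • (1 : Matrix (Fin m) (Fin m) ℝ))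
    (by rw [Matrix.mul_sub, transpose_sub, hB]; simp [hGs])
  have e : ((B - (B.trace / m) • (1 : Matrix (Fin m) (Fin m) ℝ)) *
      (B - (B.trace / m) • (1 : Matrix (Fin m) (Fin m) ℝ))).trace =
      (B * B).trace - B.trace ^ 2 / m := by
    simp only [Matrix.sub_mul, Matrix.mul_sub, Matrix.mul_smul, Matrix.smul_mul, Matrix.mul_one,
      Matrix.one_mul, trace_sub, trace_smul, trace_one, Fintype.card_fin, smul_eq_mul]
    field_simp
    ring
  rw [e, sub_nonneg, div_le_iff₀ hm'] at this
  linarith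

/-- Entrywise derivatives of matrix-valued functions. -/
def HasMatDerivAt {m k : ℕ} (A : ℝ → Matrix (Fin m) (Fin k) ℝ) (A' : Matrix (Fin m) (Fin k) ℝ)
    (t : ℝ) : Prop := ∀ i j, HasDerivAt (fun s => A s i j) (A' i j) t

namespace HasMatDerivAt

variable {m k l : ℕ} {t : ℝ}

theorem mul {A : ℝ → Matrix (Fin m) (Fin k) ℝ} {B : ℝ → Matrix (Fin k) (Fin l) ℝ}
    {A' : Matrix (Fin m) (Fin k) ℝ} {B' : Matrix (Fin k) (Fin l) ℝ} (hA : HasMatDerivAt A A' t)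
    (hB : HasMatDerivAt B B' t) : HasMatDerivAt (fun s => A s * B s) (A' * B t + A t * B') t := by
  intro i j
  simp only [mul_apply, Matrix.add_apply, ← Finset.sum_add_distrib]
  exact HasDerivAt.fun_sum fun a _ => (hA i a).mul (hB a j)

theorem trace {A : ℝ → Matrix (Fin m) (Fin m) ℝ} {A' : Matrix (Fin m) (Fin m) ℝ}
    (hA : HasMatDerivAt A A' t) : HasDerivAt (fun s => (A s).trace) A'.trace t := by
  simp only [Matrix.trace, diag_apply]
  exact HasDerivAt.fun_sum fun a _ => hA a a

/-- Jacobi's formula: by the product rule in the Leibniz expansion one column at a time is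
differentiated, and Cramer's rule recognizes the result as an adjugate entry. -/
theorem det {A : ℝ → Matrix (Fin m) (Fin m) ℝ} {A' : Matrix (Fin m) (Fin m) ℝ}
    (hA : HasMatDerivAt A A' t) :
    HasDerivAt (fun s => (A s).det) ((A t).adjugate * A').trace t := by
  have h1 : HasDerivAt (fun s => (A s).det) (∑ σ : Equiv.Perm (Fin m), (σ.sign : ℝ) *
      ∑ k, (∏ i ∈ Finset.univ.erase k, A t (σ i) i) * A' (σ k) k) t := by
    simp only [det_apply']
    exact HasDerivAt.fun_sum fun σ _ => (HasDerivAt.fun_finsetProd fun i _ => hA (σ i) i).const_mul _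
  convert h1 using 1
  have h2 : ∀ k, ((A t).updateCol k fun i => A' i k).det =
      ∑ σ : Equiv.Perm (Fin m), (σ.sign : ℝ) *
        ((∏ i ∈ Finset.univ.erase k, A t (σ i) i) * A' (σ k) k) := fun k => by
    rw [det_apply']
    refine Finset.sum_congr rfl fun σ _ => ?_
    rw [← Finset.prod_erase_mul _ _ (Finset.mem_univ k)]
    congr 2
    · exact Finset.prod_congr rfl fun i hi => by simp [updateCol_ne (Finset.ne_of_mem_erase hi)]
    · simp
  simp only [Finset.mul_sum]
  rw [Finset.sum_comm, Matrix.trace]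
  refine Finset.sum_congr rfl fun k _ => ?_
  rw [← h2, ← cramer_apply, cramer_eq_adjugate_mulVec]
  rfl

theorem inv {A : ℝ → Matrix (Fin m) (Fin m) ℝ} {A' : Matrix (Fin m) (Fin m) ℝ}
    (hA : HasMatDerivAt A A' t) (hdet : (A t).det ≠ 0) :
    HasMatDerivAt (fun s => (A s)⁻¹) (-((A t)⁻¹ * A' * (A t)⁻¹)) t := by
  -- Differentiability of the inverse comes first, from Cramer's rule and with no explicit
  -- derivative. The value is then forced by differentiating A A⁻¹ = 1.
  have hex : ∀ i j, ∃ d, HasDerivAt (fun s => (A s)⁻¹ i j) d t := fun i j => by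
    have h2 : ∃ d, HasDerivAt (fun s => (A s).adjugate i j) d t := by
      simp only [adjugate_apply]
      refine ⟨_, HasMatDerivAt.det (A' := Matrix.of fun k l => if k = j then 0 else A' k l)
        fun k l => ?_⟩
      by_cases hk : k = j
      · subst hk
        simpa using hasDerivAt_const t _
      · simpa [updateRow_ne hk, hk] using hA k l
    obtain ⟨d, hd⟩ := h2
    refine ⟨_, ((hA.det.inv hdet).mul hd).congr_of_eventuallyEq (Eventually.of_forall fun s => ?_)⟩
    simp [Matrix.inv_def, Ring.inverse_eq_inv']
  choose D hD using hex
  have hprod := hA.mul (B := fun s => (A s)⁻¹) (B' := Matrix.of D) hD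
  have hone : A' * (A t)⁻¹ + A t * Matrix.of D = 0 := by
    ext i j
    refine (hprod i j).unique ((hasDerivAt_const t ((1 : Matrix (Fin m) (Fin m) ℝ) i j)).congr_of_eventuallyEq ?_)
    filter_upwards [hA.det.continuousAt.eventually_ne hdet] with s hs
    rw [mul_nonsing_inv _ (isUnit_iff_ne_zero.2 hs)]
  have hK : Matrix.of D = -((A t)⁻¹ * A' * (A t)⁻¹) := by
    have := congrArg (fun B => (A t)⁻¹ * B) (eq_neg_of_add_eq_zero_right hone)
    simp only [nonsing_inv_mul_cancel_left _ _ (isUnit_iff_ne_zero.2 hdet)] at this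
    rw [this, Matrix.mul_neg, Matrix.mul_assoc]
  rw [← hK]
  exact hD

end HasMatDerivAt

theorem det_succ_of_column_zero {m : ℕ} {G : Matrix (Fin (m + 1)) (Fin (m + 1)) ℝ}
    (h : ∀ a : Fin m, G 0 a.succ = 0) :
    G.det = G 0 0 * (G.submatrix Fin.succ Fin.succ).det := by
  rw [det_succ_row_zero, Fin.sum_univ_succ]
  simp [h]

/-- The matrix Riccati inequality. -/
theorem riccati_trace_le {m : ℕ} {J J₁ N R g : ℝ → Matrix (Fin (m + 1)) (Fin (m + 1)) ℝ} {t₀ : ℝ}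
    {C : ℝ} {D : ℝ → ℝ}
    (hJ : ∀ᶠ t in 𝓝 t₀, HasMatDerivAt J (J₁ t - N t * J t) t)
    (hJ₁ : HasMatDerivAt J₁ (-(R t₀ * J t₀) - N t₀ * J₁ t₀) t₀)
    (hg : ∀ᶠ t in 𝓝 t₀, HasMatDerivAt g (g t * N t + (g t * N t)ᵀ) t)
    (hgpos : ∀ᶠ t in 𝓝 t₀, (g t).PosDef)
    (hcol : ∀ i, J₁ t₀ i 0 = 0)
    (hperp : ∀ᶠ t in 𝓝 t₀, ∀ a : Fin m, ((J t)ᵀ * g t * J t) 0 a.succ = 0)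
    (hsymm : ∀ a b : Fin m, ((J t₀)ᵀ * g t₀ * J₁ t₀) a.succ b.succ =
      ((J t₀)ᵀ * g t₀ * J₁ t₀) b.succ a.succ)
    (hC : 0 < C) (h00 : ∀ᶠ t in 𝓝 t₀, ((J t)ᵀ * g t * J t) 0 0 = C)
    (hD : ∀ᶠ t in 𝓝 t₀, D t = (((J t)ᵀ * g t * J t).submatrix Fin.succ Fin.succ).det)
    (hD0 : D t₀ ≠ 0) :
    0 < D t₀ ∧ ∃ u : ℝ → ℝ, (∀ᶠ t in 𝓝 t₀, HasDerivAt (fun s => Real.log (D s)) (2 * u t) t) ∧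
      ∃ u', HasDerivAt u u' t₀ ∧ u' ≤ -(R t₀).trace - u t₀ ^ 2 / m := by
  -- The Gram matrix of J is block diagonal with blocks C and the Gram matrix of the last m columns.
  -- Comparing determinants also shows that J is invertible where D ≠ 0.
  have hDdet : ∀ᶠ t in 𝓝 t₀, (J t).det ^ 2 * (g t).det = C * D t := by
    filter_upwards [hperp, h00, hD] with t h1 h2 h3
    rw [h3, ← h2, ← det_succ_of_column_zero h1, det_mul, det_mul, det_transpose]
    ring
  have hJdet : (J t₀).det ≠ 0 := fun h => by
    have := hDdet.self_of_nhds
    rw [h] at this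
    simp only [ne_eq, OfNat.ofNat_ne_zero, not_false_eq_true, zero_pow, zero_mul] at this
    exact (mul_ne_zero hC.ne' hD0) this.symm
  have hJev : ∀ᶠ t in 𝓝 t₀, (J t).det ≠ 0 :=
    (hJ.self_of_nhds.det.continuousAt).eventually_ne hJdet
  have hDpos : ∀ᶠ t in 𝓝 t₀, 0 < D t := by
    filter_upwards [hDdet, hJev, hgpos] with t h1 h2 h3
    have : 0 < C * D t := by
      rw [← h1]
      have := h3.det_pos
      positivity
    exact (pos_iff_pos_of_mul_pos this).1 hC
  refine ⟨hDpos.self_of_nhds, fun t => ((J t)⁻¹ * J₁ t).trace, ?_, ?_⟩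
  · filter_upwards [hDdet.eventually_nhds, hJev, hgpos, hDpos, hJ, hg] with t h1 h2 h3 h4 h5 h6
    have hg0 := h3.det_pos
    have e1 : HasDerivAt (fun s => 2 * Real.log (J s).det + Real.log (g s).det - Real.log C)
        (2 * (((J t).adjugate * (J₁ t - N t * J t)).trace / (J t).det) +
          ((g t).adjugate * (g t * N t + (g t * N t)ᵀ)).trace / (g t).det) t :=
      (((h5.det.log h2).const_mul 2).add (h6.det.log hg0.ne')).sub_const _
    -- The connection contributes -2 tr N through J and +2 tr N through g, so the logarithmic
    -- derivative of D sees only tr(J⁻¹J₁).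
    have a1 : ((J t).adjugate * (J₁ t - N t * J t)).trace / (J t).det =
        ((J t)⁻¹ * J₁ t).trace - (N t).trace := by
      have : ((J t).adjugate * (J₁ t - N t * J t)).trace / (J t).det =
          ((J t)⁻¹ * (J₁ t - N t * J t)).trace := by
        rw [Matrix.inv_def, Ring.inverse_eq_inv', Matrix.smul_mul, trace_smul, smul_eq_mul,
          div_eq_inv_mul]
      rw [this, Matrix.mul_sub, trace_sub, trace_mul_comm (J t)⁻¹ (N t * J t), Matrix.mul_assoc,
        mul_nonsing_inv _ (isUnit_iff_ne_zero.2 h2), Matrix.mul_one]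
    have a2 : ((g t).adjugate * (g t * N t + (g t * N t)ᵀ)).trace / (g t).det =
        2 * (N t).trace := by
      have hgs : (g t)ᵀ = g t := h3.isHermitian
      have hgu : IsUnit (g t).det := isUnit_iff_ne_zero.2 hg0.ne'
      have : ((g t).adjugate * (g t * N t + (g t * N t)ᵀ)).trace / (g t).det =
          ((g t)⁻¹ * (g t * N t + (g t * N t)ᵀ)).trace := by
        rw [Matrix.inv_def, Ring.inverse_eq_inv', Matrix.smul_mul, trace_smul, smul_eq_mul,
          div_eq_inv_mul]
      rw [this, Matrix.mul_add, trace_add, nonsing_inv_mul_cancel_left _ _ hgu, transpose_mul, hgs,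
        trace_mul_comm, Matrix.mul_assoc, mul_nonsing_inv _ hgu, Matrix.mul_one, trace_transpose]
      ring
    rw [a1, a2] at e1
    have e2 : (fun s => Real.log (D s)) =ᶠ[𝓝 t]
        fun s => 2 * Real.log (J s).det + Real.log (g s).det - Real.log C := by
      filter_upwards [h1, h5.det.continuousAt.eventually_ne h2,
        h6.det.continuousAt.eventually_ne hg0.ne'] with s k1 k2 k3
      have k4 : C ≠ 0 := hC.ne'
      have hDs : D s = (J s).det ^ 2 * (g s).det / C := by field_simp; linarith
      rw [hDs, Real.log_div (mul_ne_zero (pow_ne_zero 2 k2) k3) k4,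
        Real.log_mul (pow_ne_zero 2 k2) k3, Real.log_pow]
      norm_num
    refine (e1.congr_of_eventuallyEq e2).congr_deriv ?_
    ring
  · have hJ0 := hJ.self_of_nhds
    have hu := ((hJ0.inv hJdet).mul hJ₁).trace
    refine ⟨_, hu, ?_⟩
    set K := (J t₀)⁻¹ with hKdef
    set B := K * J₁ t₀ with hB
    have hJu : IsUnit (J t₀).det := isUnit_iff_ne_zero.2 hJdet
    have hJK : J t₀ * K = 1 := mul_nonsing_inv _ hJu
    have hKJ : K * J t₀ = 1 := nonsing_inv_mul _ hJu
    have hJB : J t₀ * B = J₁ t₀ := by rw [hB, ← Matrix.mul_assoc, hJK, Matrix.one_mul]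
    -- The matrix Riccati equation: the two terms containing N cancel, and what is left is -B² -
    -- J⁻¹RJ.
    have e1 : -(K * (J₁ t₀ - N t₀ * J t₀) * K) * J₁ t₀ + K * (-(R t₀ * J t₀) - N t₀ * J₁ t₀) =
        -(B * B) - K * (R t₀ * J t₀) := by
      have : K * (J₁ t₀ - N t₀ * J t₀) * K * J₁ t₀ = B * B - K * (N t₀ * J₁ t₀) := by
        rw [Matrix.mul_assoc, ← hB, Matrix.mul_sub, Matrix.sub_mul, ← hB, Matrix.mul_assoc K,
          Matrix.mul_assoc K (N t₀ * J t₀), Matrix.mul_assoc (N t₀), hJB]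
      rw [Matrix.neg_mul, this, Matrix.mul_sub, Matrix.mul_neg]
      abel
    have e2 : (K * (R t₀ * J t₀)).trace = (R t₀).trace := by
      rw [trace_mul_comm, Matrix.mul_assoc, hJK, Matrix.mul_one]
    rw [e1, trace_sub, trace_neg, e2]
    -- The column belonging to the parallel velocity vanishes, so the traces of B and of B² equal
    -- those of the lower m × m block B'.
    have hB0 : ∀ i, B i 0 = 0 := fun i => by
      rw [hB, mul_apply]
      simp [hcol]
    set G := (J t₀)ᵀ * g t₀ * J t₀ with hG
    set B' := B.submatrix (Fin.succ : Fin m → _) Fin.succ with hB'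
    have hGpos : G.PosDef := by
      have := hgpos.self_of_nhds.conjTranspose_mul_mul_same (B := J t₀)
        (mulVec_injective_iff_isUnit.2 ((isUnit_iff_isUnit_det _).2 hJu))
      simpa using this
    have hGs : Gᵀ = G := hGpos.isHermitian
    have hApos : (G.submatrix (Fin.succ : Fin m → _) Fin.succ).PosDef :=
      hGpos.submatrix (Fin.succ_injective m)
    have hGB : G * B = (J t₀)ᵀ * g t₀ * J₁ t₀ := by rw [hG, Matrix.mul_assoc, hJB]
    have hAB : G.submatrix (Fin.succ : Fin m → _) Fin.succ * B' =
        (G * B).submatrix Fin.succ Fin.succ := by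
      ext a b
      have h0 : G a.succ 0 = 0 := by
        rw [← hGs, transpose_apply]
        exact hperp.self_of_nhds a
      simp [mul_apply, Fin.sum_univ_succ, hB', h0]
    have htr : B.trace = B'.trace := by
      simp [Matrix.trace, Fin.sum_univ_succ, hB0, hB']
    have htr2 : (B * B).trace = (B' * B').trace := by
      simp [Matrix.trace, Fin.sum_univ_succ, hB0, hB', mul_apply]
    -- Cauchy–Schwarz is applied to the block B', not to B; this is what gives the constant m rather
    -- than m + 1.
    have key := trace_sq_le_of_symm hApos (B := B') (by
      rw [hAB]
      ext a b
      simp only [transpose_apply, submatrix_apply, hGB]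
      exact hsymm b a)
    change -(B * B).trace - (R t₀).trace ≤ -(R t₀).trace - B.trace ^ 2 / m
    rw [htr, htr2]
    rcases Nat.eq_zero_or_pos m with rfl | hm
    · simp [Matrix.trace]
    · have hm' : (0 : ℝ) < m := by exact_mod_cast hm
      have : B'.trace ^ 2 / m ≤ (B' * B').trace := by
        rw [div_le_iff₀ hm']
        linarith
      linarith

end MatrixLemmas

/-! ### Geodesics and Jacobi fields in coordinates -/

section LocalGeodesics

variable {n : ℕ}

theorem hasDerivWithinAt_vec {y : ℝ → Vec n} {y' : Vec n} {S : Set ℝ} {t : ℝ} :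
    HasDerivWithinAt y y' S t ↔ ∀ i, HasDerivWithinAt (fun s => y s i) (y' i) S t := by
  rw [hasDerivWithinAt_iff_hasFDerivWithinAt, hasFDerivWithinAt_euclidean]
  refine forall_congr' fun i => ?_
  rw [hasDerivWithinAt_iff_hasFDerivWithinAt]
  have : (EuclideanSpace.proj i).comp (ContinuousLinearMap.toSpanSingleton ℝ y') =
      ContinuousLinearMap.toSpanSingleton ℝ (y' i) := by
    ext
    simp
  rw [← this]

theorem hasDerivAt_vec {y : ℝ → Vec n} {y' : Vec n} {t : ℝ} :
    HasDerivAt y y' t ↔ ∀ i, HasDerivAt (fun s => y s i) (y' i) t := by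
  simp only [← hasDerivWithinAt_univ]
  exact hasDerivWithinAt_vec

/-- The vector `(-2 G^i(v))_i`, the acceleration of geodesics. -/
def geodAcc (F : Vec n → Vec n → ℝ) (x v : Vec n) : Vec n :=
  WithLp.toLp 2 fun i => -2 * spray F i x v

@[simp] theorem geodAcc_apply (F : Vec n → Vec n → ℝ) (x v : Vec n) (i : Fin n) :
    geodAcc F x v i = -2 * spray F i x v := rfl

/-- The acceleration of Jacobi fields. -/
def jacobiAcc (F : Vec n → Vec n → ℝ) (x v a b : Vec n) : Vec n :=
  WithLp.toLp 2 fun i => -2 * (∑ j, dX j (spray F i) x v * a j + ∑ j, nonlinConn F i j x v * b j)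

@[simp] theorem jacobiAcc_apply (F : Vec n → Vec n → ℝ) (x v a b : Vec n) (i : Fin n) :
    jacobiAcc F x v a b i =
      -2 * (∑ j, dX j (spray F i) x v * a j + ∑ j, nonlinConn F i j x v * b j) := rfl

namespace IsLocalFinsler

variable {O : Set (Vec n)} {F : Vec n → Vec n → ℝ} {x v : Vec n} {y w : ℝ → Vec n} {S : Set ℝ}
  {t : ℝ}

/-- Contract the Euler–Lagrange identity with v and simplify by Euler's identity. The outcome is
that F² is annihilated by the geodesic field. -/
theorem sum_dX_energy_mul (h : IsLocalFinsler O F) (hx : x ∈ O) (hv : v ≠ 0) :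
    ∑ j, dX j (energy F) x v * v j = 2 * ∑ i, dV i (energy F) x v * spray F i x v := by
  have hQ := h.smooth_energy
  have h1 : ∑ m, v m * (4 * ∑ i, gLow F m i x v * spray F i x v) =
      2 * ∑ i, dV i (energy F) x v * spray F i x v := by
    simp only [Finset.mul_sum]
    rw [Finset.sum_comm]
    refine Finset.sum_congr rfl fun i _ => ?_
    have := h.sum_gLow_mul hx hv i
    calc ∑ m, v m * (4 * (gLow F m i x v * spray F i x v))
        = 4 * (∑ m, gLow F i m x v * v m) * spray F i x v := by
          rw [Finset.mul_sum, Finset.sum_mul]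
          exact Finset.sum_congr rfl fun m _ => by rw [h.gLow_symm hx hv m i]; ring
      _ = _ := by rw [this]; ring
  have h2 : ∑ m, v m * ∑ j, v j * dX j (dV m (energy F)) x v =
      2 * ∑ j, dX j (energy F) x v * v j := by
    simp only [Finset.mul_sum]
    rw [Finset.sum_comm]
    refine Finset.sum_congr rfl fun j _ => ?_
    have := (h.homog_energy.dX hQ h.isOpen j).euler (hQ.dX h.isOpen j) h.isOpen hx hv
    calc ∑ m, v m * (v j * dX j (dV m (energy F)) x v)
        = (∑ m, dV m (dX j (energy F)) x v * v m) * v j := by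
          rw [Finset.sum_mul]
          exact Finset.sum_congr rfl fun m _ => by rw [hQ.dX_dV_comm h.isOpen hx hv]; ring
      _ = _ := by rw [this]; push_cast; ring
  have h3 : ∑ m, v m * dX m (energy F) x v = ∑ j, dX j (energy F) x v * v j :=
    Finset.sum_congr rfl fun m _ => mul_comm _ _
  have h4 : ∑ m, v m * (4 * ∑ i, gLow F m i x v * spray F i x v) =
      ∑ m, v m * ∑ j, v j * dX j (dV m (energy F)) x v - ∑ m, v m * dX m (energy F) x v := by
    rw [← Finset.sum_sub_distrib]
    exact Finset.sum_congr rfl fun m _ => by rw [h.four_mul_sum_gLow_mul_spray hx hv]; ring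
  linarith

/-- Geodesics have constant speed. -/
theorem hasDerivWithinAt_energy (h : IsLocalFinsler O F) (hx : y t ∈ O) (hv : w t ≠ 0)
    (hy : HasDerivWithinAt y (w t) S t) (hw : HasDerivWithinAt w (geodAcc F (y t) (w t)) S t) :
    HasDerivWithinAt (fun s => energy F (y s) (w s)) 0 S t := by
  refine (h.smooth_energy.hasDerivWithinAt h.isOpen hx hv hy hw).congr_deriv ?_
  rw [h.sum_dX_energy_mul hx hv, Finset.mul_sum, ← Finset.sum_add_distrib]
  exact Finset.sum_eq_zero fun i _ => by simp only [geodAcc_apply]; ring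

theorem dV_dV_energy (j m : Fin n) :
    dV j (dV m (energy F)) x v = 2 * gLow F j m x v := by rw [gLow]; ring

/-- The Euler–Lagrange equation. -/
theorem hasDerivWithinAt_dV_energy (h : IsLocalFinsler O F) (hx : y t ∈ O) (hv : w t ≠ 0)
    (hy : HasDerivWithinAt y (w t) S t) (hw : HasDerivWithinAt w (geodAcc F (y t) (w t)) S t)
    (m : Fin n) : HasDerivWithinAt (fun s => dV m (energy F) (y s) (w s))
      (dX m (energy F) (y t) (w t)) S t := by
  refine ((h.smooth_energy.dV h.isOpen m).hasDerivWithinAt h.isOpen hx hv hy hw).congr_deriv ?_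
  have := h.four_mul_sum_gLow_mul_spray hx hv m
  have e : ∑ j, dV j (dV m (energy F)) (y t) (w t) * geodAcc F (y t) (w t) j =
      -(4 * ∑ i, gLow F m i (y t) (w t) * spray F i (y t) (w t)) := by
    rw [Finset.mul_sum, ← Finset.sum_neg_distrib]
    exact Finset.sum_congr rfl fun i _ => by
      rw [dV_dV_energy, geodAcc_apply, h.gLow_symm hx hv i m]; ring
  rw [e, this]
  have : ∑ j, w t j * dX j (dV m (energy F)) (y t) (w t) =
      ∑ j, dX j (dV m (energy F)) (y t) (w t) * w t j :=
    Finset.sum_congr rfl fun m _ => mul_comm _ _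
  linarith

/-- A curve satisfying the Euler–Lagrange equation is a geodesic. -/
theorem eq_geodAcc_of_hasDerivWithinAt (h : IsLocalFinsler O F) (hx : y t ∈ O) (hv : w t ≠ 0)
    (hS : UniqueDiffWithinAt ℝ S t) {w' : Vec n}
    (hy : HasDerivWithinAt y (w t) S t) (hw : HasDerivWithinAt w w' S t)
    (hEL : ∀ m, HasDerivWithinAt (fun s => dV m (energy F) (y s) (w s))
      (dX m (energy F) (y t) (w t)) S t) : w' = geodAcc F (y t) (w t) := by
  have key : ∀ m, ∑ j, gLow F m j (y t) (w t) * (w' j - geodAcc F (y t) (w t) j) = 0 := fun m => by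
    have e1 := hS.eq_deriv _
      ((h.smooth_energy.dV h.isOpen m).hasDerivWithinAt h.isOpen hx hv hy hw) (hEL m)
    have e2 := h.four_mul_sum_gLow_mul_spray hx hv m
    have e3 : ∑ j, w t j * dX j (dV m (energy F)) (y t) (w t) =
        ∑ j, dX j (dV m (energy F)) (y t) (w t) * w t j :=
      Finset.sum_congr rfl fun m _ => mul_comm _ _
    have e4 : ∑ j, dV j (dV m (energy F)) (y t) (w t) * w' j =
        2 * ∑ j, gLow F m j (y t) (w t) * w' j := by
      rw [Finset.mul_sum]
      exact Finset.sum_congr rfl fun i _ => by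
        rw [dV_dV_energy, h.gLow_symm hx hv i m]; ring
    have e5 : ∑ j, gLow F m j (y t) (w t) * (w' j - geodAcc F (y t) (w t) j) =
        ∑ j, gLow F m j (y t) (w t) * w' j +
          2 * ∑ i, gLow F m i (y t) (w t) * spray F i (y t) (w t) := by
      rw [Finset.mul_sum, ← Finset.sum_add_distrib]
      exact Finset.sum_congr rfl fun i _ => by rw [geodAcc_apply]; ring
    rw [e5]
    linarith
  -- The Euler–Lagrange equation determines the acceleration only after lowering its index;
  -- nondegeneracy of g recovers it.
  have hz : (gMatrix F (y t) (w t)).mulVec (fun j => w' j - geodAcc F (y t) (w t) j) = 0 := by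
    ext m
    simpa [Matrix.mulVec, dotProduct, gMatrix] using key m
  have := Matrix.eq_zero_of_mulVec_eq_zero (h.det_ne_zero hx hv) hz
  ext i
  have := congrFun this i
  simp only [Pi.zero_apply] at this
  linarith

/-- The chain rule with acceleration -2G produces the derivative of g along the spray, which is the
right-hand side of `sum_gLow_mul_nonlinConn_add`. -/
theorem hasMatDerivAt_gMatrix (h : IsLocalFinsler O F) (hx : y t ∈ O) (hv : w t ≠ 0)
    (hy : HasDerivAt y (w t) t) (hw : HasDerivAt w (geodAcc F (y t) (w t)) t) :
    HasMatDerivAt (fun s => gMatrix F (y s) (w s))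
      (gMatrix F (y t) (w t) * (Matrix.of fun i j => nonlinConn F i j (y t) (w t)) +
        (gMatrix F (y t) (w t) *
          (Matrix.of fun i j => nonlinConn F i j (y t) (w t))).transpose) t := fun i j => by
  refine ((h.smooth_gLow i j).hasDerivAt h.isOpen hx hv hy hw).congr_deriv ?_
  simp only [Matrix.add_apply, Matrix.transpose_apply, Matrix.mul_apply, gMatrix, Matrix.of_apply]
  rw [h.sum_gLow_mul_nonlinConn_add hx hv, sub_eq_add_neg, Finset.mul_sum,
    ← Finset.sum_neg_distrib]
  congr 1
  exact Finset.sum_congr rfl fun k _ => by rw [geodAcc_apply]; ring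

/-- The second covariant derivative of a Jacobi field. -/
theorem hasDerivAt_covDeriv (h : IsLocalFinsler O F) (hx : y t ∈ O) (hv : w t ≠ 0)
    (hy : HasDerivAt y (w t) t) (hw : HasDerivAt w (geodAcc F (y t) (w t)) t)
    {Y Z : ℝ → Vec n} (hY : HasDerivAt Y (Z t) t)
    (hZ : HasDerivAt Z (jacobiAcc F (y t) (w t) (Y t) (Z t)) t) (i : Fin n) :
    HasDerivAt (fun s => Z s i + ∑ j, nonlinConn F i j (y s) (w s) * Y s j)
      (-(∑ j, curvCoeff F i j (y t) (w t) * Y t j) -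
        ∑ k, nonlinConn F i k (y t) (w t) *
          (Z t k + ∑ j, nonlinConn F k j (y t) (w t) * Y t j)) t := by
  -- The ∂G terms of the Jacobi equation and the derivative of N along the geodesic build up the
  -- curvature except for its N² term. That term is compensated by applying N to the covariant
  -- derivative.
  have h1 := (hasDerivAt_vec.1 hZ i).add (HasDerivAt.fun_sum fun j (_ : j ∈ Finset.univ) =>
    ((h.smooth_nonlinConn i j).hasDerivAt h.isOpen hx hv hy hw).mul (hasDerivAt_vec.1 hY j))
  refine h1.congr_deriv ?_
  simp only [jacobiAcc_apply, geodAcc_apply, curvCoeff, sub_mul, add_mul, mul_add,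
    Finset.sum_sub_distrib, Finset.sum_add_distrib]
  have e : ∑ j, (∑ k, nonlinConn F i k (y t) (w t) * nonlinConn F k j (y t) (w t)) * Y t j =
      ∑ k, nonlinConn F i k (y t) (w t) * ∑ j, nonlinConn F k j (y t) (w t) * Y t j := by
    simp only [Finset.sum_mul, Finset.mul_sum]
    rw [Finset.sum_comm]
    exact Finset.sum_congr rfl fun k _ => Finset.sum_congr rfl fun j _ => by ring
  have e2 : ∑ j, (∑ k, dV k (nonlinConn F i j) (y t) (w t) * (-2 * spray F k (y t) (w t))) * Y t j
      = -∑ j, (∑ k, 2 * dV k (nonlinConn F i j) (y t) (w t) * spray F k (y t) (w t)) * Y t j := by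
    rw [← Finset.sum_neg_distrib]
    refine Finset.sum_congr rfl fun j _ => ?_
    rw [← neg_mul, ← Finset.sum_neg_distrib]
    congr 1
    exact Finset.sum_congr rfl fun k _ => by ring
  have e3 : ∑ j, 2 * dX j (spray F i) (y t) (w t) * Y t j =
      2 * ∑ j, dX j (spray F i) (y t) (w t) * Y t j := by
    rw [Finset.mul_sum]
    exact Finset.sum_congr rfl fun k _ => by ring
  rw [e, e2, e3]
  ring

/-- `R_v(v) = 0`. -/
theorem sum_curvCoeff_mul_velocity (h : IsLocalFinsler O F)
    (hyw : ∀ᶠ s in 𝓝 t, y s ∈ O ∧ w s ≠ 0 ∧ HasDerivAt y (w s) s ∧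
      HasDerivAt w (geodAcc F (y s) (w s)) s) (i : Fin n) :
    ∑ j, curvCoeff F i j (y t) (w t) * w t j = 0 := by
  obtain ⟨hx, hv, hy, hw⟩ := hyw.self_of_nhds
  have hZ : HasDerivAt (fun s => geodAcc F (y s) (w s))
      (jacobiAcc F (y t) (w t) (w t) (geodAcc F (y t) (w t))) t := by
    rw [hasDerivAt_vec]
    intro i
    exact ((h.smooth_spray i).hasDerivAt h.isOpen hx hv hy hw).const_mul (-2)
  have hzero : ∀ s, y s ∈ O → w s ≠ 0 → ∀ k, geodAcc F (y s) (w s) k +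
      ∑ j, nonlinConn F k j (y s) (w s) * w s j = 0 := fun s hx hv k => by
    rw [h.sum_nonlinConn_mul hx hv, geodAcc_apply]
    ring
  -- The velocity is itself a Jacobi field, from translation in time, and its covariant derivative
  -- vanishes identically; the Jacobi equation then reads R_v(v) = 0.
  have h1 := h.hasDerivAt_covDeriv hx hv hy hw (Y := w) hw hZ i
  have h2 : HasDerivAt (fun s => geodAcc F (y s) (w s) i +
      ∑ j, nonlinConn F i j (y s) (w s) * w s j) 0 t :=
    (hasDerivAt_const t (0 : ℝ)).congr_of_eventuallyEq (by
      filter_upwards [hyw] with s hs using hzero s hs.1 hs.2.1 i)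
  have h3 := h1.unique h2
  simp only [hzero t hx hv, mul_zero, Finset.sum_const_zero] at h3
  linarith

/-- The Riccati inequality for the Gram determinant of Jacobi fields. -/
theorem log_det_gram_deriv_le {m : ℕ} {O : Set (Vec (m + 1))} {F : Vec (m + 1) → Vec (m + 1) → ℝ}
    {y w : ℝ → Vec (m + 1)} {t : ℝ} (h : IsLocalFinsler O F)
    (hyw : ∀ᶠ s in 𝓝 t, y s ∈ O ∧ w s ≠ 0 ∧ HasDerivAt y (w s) s ∧
      HasDerivAt w (geodAcc F (y s) (w s)) s)
    (hunit : ∀ᶠ s in 𝓝 t, F (y s) (w s) = 1)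
    {Y Z : Fin m → ℝ → Vec (m + 1)}
    (hYZ : ∀ a, ∀ᶠ s in 𝓝 t, HasDerivAt (Y a) (Z a s) s ∧
      HasDerivAt (Z a) (jacobiAcc F (y s) (w s) (Y a s) (Z a s)) s)
    (hperp : ∀ a, ∀ᶠ s in 𝓝 t, ∑ i, ∑ j, gLow F i j (y s) (w s) * w s i * Y a s j = 0)
    (hsymm : ∀ a b, ∑ p, (∑ j, dX j (dV p (energy F)) (y t) (w t) * Y a t j +
        2 * ∑ j, gLow F p j (y t) (w t) * Z a t j) * Y b t p =
      ∑ p, (∑ j, dX j (dV p (energy F)) (y t) (w t) * Y b t j +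
        2 * ∑ j, gLow F p j (y t) (w t) * Z b t j) * Y a t p)
    {D : ℝ → ℝ} (hD : ∀ᶠ s in 𝓝 t, D s = (Matrix.of fun a b : Fin m =>
      ∑ i, ∑ j, gLow F i j (y s) (w s) * Y a s i * Y b s j).det) (hD0 : D t ≠ 0) :
    0 < D t ∧ ∃ u : ℝ → ℝ, (∀ᶠ s in 𝓝 t, HasDerivAt (fun s => Real.log (D s)) (2 * u s) s) ∧
      ∃ u', HasDerivAt u u' t ∧
        u' ≤ -(∑ i, curvCoeff F i i (y t) (w t)) - u t ^ 2 / m := by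
  -- Column 0 is the velocity and the others are the Jacobi fields. `J₁` collects the covariant
  -- derivatives, so its column 0 is zero by the geodesic equation.
  let J : ℝ → Matrix (Fin (m + 1)) (Fin (m + 1)) ℝ := fun s => Matrix.of fun i a =>
    Fin.cases (w s i) (fun a => Y a s i) a
  let N : ℝ → Matrix (Fin (m + 1)) (Fin (m + 1)) ℝ := fun s => Matrix.of fun i j =>
    nonlinConn F i j (y s) (w s)
  let R : ℝ → Matrix (Fin (m + 1)) (Fin (m + 1)) ℝ := fun s => Matrix.of fun i j =>
    curvCoeff F i j (y s) (w s)
  let J₁ : ℝ → Matrix (Fin (m + 1)) (Fin (m + 1)) ℝ := fun s => Matrix.of fun i a =>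
    Fin.cases 0 (fun a => Z a s i + ∑ j, nonlinConn F i j (y s) (w s) * Y a s j) a
  let g : ℝ → Matrix (Fin (m + 1)) (Fin (m + 1)) ℝ := fun s => gMatrix F (y s) (w s)
  have hYZ' : ∀ᶠ s in 𝓝 t, ∀ a, HasDerivAt (Y a) (Z a s) s ∧
      HasDerivAt (Z a) (jacobiAcc F (y s) (w s) (Y a s) (Z a s)) s := eventually_all.2 hYZ
  obtain ⟨hx, hv, hy, hw⟩ := hyw.self_of_nhds
  have hentry : ∀ s a b, ((J s).transpose * g s * J s) a b =
      ∑ i, ∑ j, gLow F i j (y s) (w s) * J s i a * J s j b := fun s a b => by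
    simp only [Matrix.mul_apply, Matrix.transpose_apply, Finset.sum_mul]
    rw [Finset.sum_comm]
    exact Finset.sum_congr rfl fun i _ => Finset.sum_congr rfl fun j _ => by
      simp only [g, gMatrix, Matrix.of_apply]; ring
  have hentry₁ : ∀ a b, ((J t).transpose * g t * J₁ t) a b =
      ∑ i, (∑ j, gLow F i j (y t) (w t) * J₁ t j b) * J t i a := fun a b => by
    rw [Matrix.mul_assoc]
    simp only [Matrix.mul_apply, Matrix.transpose_apply]
    exact Finset.sum_congr rfl fun i _ => by simp only [g, gMatrix, Matrix.of_apply]; ring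
  refine riccati_trace_le (J := J) (J₁ := J₁) (N := N) (R := R) (g := g) (C := 1) ?_ ?_ ?_ ?_
    (fun i => rfl) ?_ ?_ one_pos ?_ ?_ hD0
  · filter_upwards [hyw, hYZ'] with s hs hYs
    intro i a
    refine Fin.cases ?_ (fun a => ?_) a
    · refine (hasDerivAt_vec.1 hs.2.2.2 i).congr_deriv ?_
      have := h.sum_nonlinConn_mul hs.1 hs.2.1 i
      simp [J₁, N, J, Matrix.mul_apply, this]
    · refine (hasDerivAt_vec.1 (hYs a).1 i).congr_deriv ?_
      simp [J₁, N, J, Matrix.mul_apply]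
  · intro i a
    refine Fin.cases ?_ (fun a => ?_) a
    · have := h.sum_curvCoeff_mul_velocity hyw i
      refine (hasDerivAt_const t (0 : ℝ)).congr_deriv ?_
      simp [J₁, N, J, R, Matrix.mul_apply, this]
    · have hs := (hYZ a).self_of_nhds
      refine (h.hasDerivAt_covDeriv hx hv hy hw hs.1 hs.2 i).congr_deriv ?_
      simp [J₁, N, J, R, Matrix.mul_apply]
  · filter_upwards [hyw] with s hs using h.hasMatDerivAt_gMatrix hs.1 hs.2.1 hs.2.2.1 hs.2.2.2
  · filter_upwards [hyw] with s hs using h.posDef _ hs.1 _ hs.2.1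
  · filter_upwards [eventually_all.2 hperp] with s hs a
    rw [hentry]
    exact hs a
  · intro a b
    rw [hentry₁, hentry₁]
    -- The covariant Wronskian is half the pairing of the linearized momentum with the other field,
    -- plus a bilinear term in the fields alone. The first part is symmetric by hypothesis.
    have key : ∀ a b, ∑ i, (∑ j, gLow F i j (y t) (w t) *
          (Z b t j + ∑ k, nonlinConn F j k (y t) (w t) * Y b t k)) * Y a t i =
        (1 / 2) * ∑ p, (∑ j, dX j (dV p (energy F)) (y t) (w t) * Y b t j +
          2 * ∑ j, gLow F p j (y t) (w t) * Z b t j) * Y a t p +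
        ∑ p, ∑ k, (∑ j, gLow F p j (y t) (w t) * nonlinConn F j k (y t) (w t) -
          (1 / 2) * dX k (dV p (energy F)) (y t) (w t)) * Y b t k * Y a t p := fun a b => by
      rw [Finset.mul_sum, ← Finset.sum_add_distrib]
      refine Finset.sum_congr rfl fun p _ => ?_
      have e1 : ∑ j, gLow F p j (y t) (w t) * ∑ k, nonlinConn F j k (y t) (w t) * Y b t k =
          ∑ k, (∑ j, gLow F p j (y t) (w t) * nonlinConn F j k (y t) (w t)) * Y b t k := by
        simp only [Finset.mul_sum, Finset.sum_mul]
        rw [Finset.sum_comm]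
        exact Finset.sum_congr rfl fun i _ => Finset.sum_congr rfl fun j _ => by ring
      have e2 : ∑ k, (1 / 2) * dX k (dV p (energy F)) (y t) (w t) * Y b t k =
          (1 / 2) * ∑ k, dX k (dV p (energy F)) (y t) (w t) * Y b t k := by
        rw [Finset.mul_sum]
        exact Finset.sum_congr rfl fun i _ => by ring
      simp only [mul_add, Finset.sum_add_distrib, e1, sub_mul, Finset.sum_sub_distrib,
        ← Finset.sum_mul, e2]
      ring
    -- The coefficients of the bilinear term are symmetric: this is the antisymmetric part of gN
    -- computed in `sum_gLow_mul_nonlinConn_sub`.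
    have hK : ∀ p k, (∑ j, gLow F p j (y t) (w t) * nonlinConn F j k (y t) (w t) -
          (1 / 2) * dX k (dV p (energy F)) (y t) (w t)) =
        (∑ j, gLow F k j (y t) (w t) * nonlinConn F j p (y t) (w t) -
          (1 / 2) * dX p (dV k (energy F)) (y t) (w t)) := fun p k => by
      have := h.sum_gLow_mul_nonlinConn_sub hx hv p k
      linarith
    change ∑ i, (∑ j, gLow F i j (y t) (w t) *
          (Z b t j + ∑ k, nonlinConn F j k (y t) (w t) * Y b t k)) * Y a t i =
      ∑ i, (∑ j, gLow F i j (y t) (w t) *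
          (Z a t j + ∑ k, nonlinConn F j k (y t) (w t) * Y a t k)) * Y b t i
    rw [key, key, hsymm b a]
    congr 1
    rw [Finset.sum_comm]
    refine Finset.sum_congr rfl fun k _ => Finset.sum_congr rfl fun p _ => ?_
    rw [hK]
    ring
  · filter_upwards [hyw, hunit] with s hs hu
    rw [hentry]
    change ∑ i, ∑ j, gLow F i j (y s) (w s) * w s i * w s j = 1
    rw [h.sum_sum_gLow_mul hs.1 hs.2.1, energy, hu, one_pow]
  · filter_upwards [hD] with s hs
    rw [hs]
    congr 1
    ext a b
    rw [Matrix.submatrix_apply, hentry]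
    rfl

end IsLocalFinsler

end LocalGeodesics

/-! ### Charts of the tangent bundle -/

section Charts

variable {n : ℕ} {M : Type*} [TopologicalSpace M] [ChartedSpace (EuclideanSpace ℝ (Fin n)) M]
  [IsManifold (𝓡 n) ∞ M]

/-- The tangent vector with coordinates `(x, v)` in the preferred chart around `p`. -/
def tangentOfChart (p : M) (x v : Vec n) : TangentBundle (𝓡 n) M :=
  (extChartAt (𝓡 n).tangent (⟨p, 0⟩ : TangentBundle (𝓡 n) M)).symm (x, v)

/-- The change of coordinates between the preferred charts around `p` and `q`. -/
def coordChange (p q : M) : Vec n → Vec n := extChartAt (𝓡 n) q ∘ (extChartAt (𝓡 n) p).symm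

/-- The domain of the change of coordinates. -/
def overlap (p q : M) : Set (Vec n) :=
  (extChartAt (𝓡 n) p).target ∩ (extChartAt (𝓡 n) p).symm ⁻¹' (extChartAt (𝓡 n) q).source

theorem isOpen_target (p : M) : IsOpen (extChartAt (𝓡 n) p).target := isOpen_extChartAt_target p

theorem isOpen_overlap (p q : M) : IsOpen (overlap p q : Set (Vec n)) :=
  (continuousOn_extChartAt_symm p).isOpen_inter_preimage (isOpen_target p)
    (isOpen_extChartAt_source q)

theorem overlap_subset (p q : M) : (overlap p q : Set (Vec n)) ⊆ (extChartAt (𝓡 n) p).target :=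
  inter_subset_left

theorem chart_mem_overlap {p q r : M} (hp : r ∈ (extChartAt (𝓡 n) p).source)
    (hq : r ∈ (extChartAt (𝓡 n) q).source) : extChartAt (𝓡 n) p r ∈ overlap p q :=
  ⟨(extChartAt (𝓡 n) p).map_source hp, by
    rw [mem_preimage, (extChartAt (𝓡 n) p).left_inv hp]; exact hq⟩

theorem contDiffOn_coordChange (p q : M) :
    ContDiffOn ℝ ∞ (coordChange p q : Vec n → Vec n) (overlap p q) := by
  have := contDiffOn_ext_coord_change (I := 𝓡 n) (n := ∞) q p
  refine this.mono fun x hx => ?_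
  rw [PartialEquiv.trans_source]
  exact hx

theorem coordChange_mem (p q : M) {x : Vec n} (hx : x ∈ overlap p q) :
    coordChange p q x ∈ (extChartAt (𝓡 n) q).target :=
  (extChartAt (𝓡 n) q).map_source hx.2

theorem symm_coordChange (p q : M) {x : Vec n} (hx : x ∈ overlap p q) :
    (extChartAt (𝓡 n) q).symm (coordChange p q x) = (extChartAt (𝓡 n) p).symm x :=
  (extChartAt (𝓡 n) q).left_inv hx.2

theorem coordChange_mem_overlap (p q : M) {x : Vec n} (hx : x ∈ overlap p q) :
    coordChange p q x ∈ (overlap q p : Set (Vec n)) :=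
  ⟨coordChange_mem p q hx, by
    rw [mem_preimage, symm_coordChange p q hx]; exact (extChartAt (𝓡 n) p).map_target hx.1⟩

theorem coordChange_coordChange (p q : M) {x : Vec n} (hx : x ∈ overlap p q) :
    coordChange q p (coordChange p q x) = x := by
  change extChartAt (𝓡 n) p ((extChartAt (𝓡 n) q).symm (coordChange p q x)) = x
  rw [symm_coordChange p q hx, (extChartAt (𝓡 n) p).right_inv hx.1]

theorem coordChange_apply (p q : M) {r : M} (hr : r ∈ (extChartAt (𝓡 n) p).source) :
    coordChange p q (extChartAt (𝓡 n) p r) = extChartAt (𝓡 n) q r := by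
  change extChartAt (𝓡 n) q ((extChartAt (𝓡 n) p).symm (extChartAt (𝓡 n) p r)) = _
  rw [(extChartAt (𝓡 n) p).left_inv hr]

theorem hasFDerivAt_coordChange (p q : M) {x : Vec n} (hx : x ∈ overlap p q) :
    HasFDerivAt (coordChange p q : Vec n → Vec n) (fderiv ℝ (coordChange p q) x) x :=
  (((contDiffOn_coordChange p q).contDiffAt ((isOpen_overlap p q).mem_nhds hx)).differentiableAt
    (by simp)).hasFDerivAt

theorem fderiv_coordChange_comp (p q : M) {x : Vec n} (hx : x ∈ overlap p q) (v : Vec n) :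
    fderiv ℝ (coordChange q p) (coordChange p q x) (fderiv ℝ (coordChange p q) x v) = v := by
  have h1 := (hasFDerivAt_coordChange q p (coordChange_mem_overlap p q hx)).comp x
    (hasFDerivAt_coordChange p q hx)
  have h2 : HasFDerivAt (coordChange q p ∘ coordChange p q : Vec n → Vec n)
      (ContinuousLinearMap.id ℝ _) x :=
    (hasFDerivAt_id x).congr_of_eventuallyEq <| by
      filter_upwards [(isOpen_overlap p q).mem_nhds hx] with y hy
        using coordChange_coordChange p q hy
  exact congrArg (fun L : Vec n →L[ℝ] Vec n => L v) (h1.unique h2)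

theorem fderiv_coordChange_ne_zero (p q : M) {x : Vec n} (hx : x ∈ overlap p q) {v : Vec n}
    (hv : v ≠ 0) : fderiv ℝ (coordChange p q) x v ≠ 0 := fun h => hv <| by
  rw [← fderiv_coordChange_comp p q hx v, h, map_zero]

theorem tangentCoordChange_eq (p q : M) {x : Vec n} (hx : x ∈ overlap p q) :
    tangentCoordChange (𝓡 n) p q ((extChartAt (𝓡 n) p).symm x) =
      fderiv ℝ (coordChange p q) x := by
  rw [tangentCoordChange_def, (extChartAt (𝓡 n) p).right_inv hx.1,
    ModelWithCorners.range_eq_univ, fderivWithin_univ]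
  rfl

theorem tangentOfChart_def (p : M) (x v : Vec n) : tangentOfChart p x v =
    ⟨(extChartAt (𝓡 n) p).symm x, tangentCoordChange (𝓡 n) p ((extChartAt (𝓡 n) p).symm x)
      ((extChartAt (𝓡 n) p).symm x) v⟩ := rfl

theorem self_mem_overlap {p : M} {x : Vec n} (hx : x ∈ (extChartAt (𝓡 n) p).target) :
    x ∈ overlap p ((extChartAt (𝓡 n) p).symm x) :=
  ⟨hx, mem_extChartAt_source _⟩

theorem tangentOfChart_coordChange (p q : M) {x : Vec n} (hx : x ∈ overlap p q) (v : Vec n) :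
    tangentOfChart q (coordChange p q x) (fderiv ℝ (coordChange p q) x v) =
      tangentOfChart p x v := by
  rw [tangentOfChart_def, tangentOfChart_def, symm_coordChange p q hx, ← tangentCoordChange_eq p q hx]
  have := tangentCoordChange_comp (I := 𝓡 n) (v := v) (y := (extChartAt (𝓡 n) p).symm x)
    ⟨⟨(extChartAt (𝓡 n) p).map_target hx.1, hx.2⟩, mem_extChartAt_source _⟩
  exact congrArg (fun u : Vec n => (⟨_, u⟩ : TangentBundle (𝓡 n) M)) this

theorem tangentOfChart_self (p : M) (v : Vec n) :
    tangentOfChart p (extChartAt (𝓡 n) p p) v = ⟨p, v⟩ := by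
  rw [tangentOfChart_def]
  have : (extChartAt (𝓡 n) p).symm (extChartAt (𝓡 n) p p) = p := extChartAt_to_inv p
  rw [this]
  have := tangentCoordChange_self (I := 𝓡 n) (v := v) (mem_extChartAt_source p)
  exact congrArg (fun u : Vec n => (⟨_, u⟩ : TangentBundle (𝓡 n) M)) this

theorem mem_tangent_target {p : M} {x v : Vec n} (hx : x ∈ (extChartAt (𝓡 n) p).target) :
    ((x, v) : Vec n × Vec n) ∈
      (extChartAt (𝓡 n).tangent (⟨p, 0⟩ : TangentBundle (𝓡 n) M)).target := by
  have h := (TangentBundle.mem_chart_target_iff (I := 𝓡 n) ((x, v) : ModelProd (Vec n) (Vec n))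
    (⟨p, 0⟩ : TangentBundle (𝓡 n) M)).2 (by simpa [extChartAt, mfld_simps] using hx)
  rw [extChartAt_target]
  exact ⟨h, mem_range_self ((x, v) : ModelProd (Vec n) (Vec n))⟩

theorem tangentOfChart_injective (p : M) {x y v w : Vec n} (hx : x ∈ (extChartAt (𝓡 n) p).target)
    (hy : y ∈ (extChartAt (𝓡 n) p).target) (h : tangentOfChart p x v = tangentOfChart p y w) :
    x = y ∧ v = w := by
  have hinj := (extChartAt (𝓡 n).tangent (⟨p, 0⟩ : TangentBundle (𝓡 n) M)).symm.injOn
  have := hinj (mem_tangent_target hx) (mem_tangent_target hy) h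
  exact Prod.ext_iff.1 this

theorem contMDiffOn_tangentOfChart (p : M) :
    ContMDiffOn 𝓘(ℝ, Vec n × Vec n) (𝓡 n).tangent ∞
      (fun z : Vec n × Vec n => (tangentOfChart p z.1 z.2 : TangentBundle (𝓡 n) M))
      ((extChartAt (𝓡 n) p).target ×ˢ univ) := by
  have := contMDiffOn_extChartAt_symm (I := (𝓡 n).tangent) (n := ∞)
    (⟨p, 0⟩ : TangentBundle (𝓡 n) M)
  exact this.mono fun z hz => mem_tangent_target hz.1

theorem tangentOfChart_snd_ne_zero (p : M) {x : Vec n} (hx : x ∈ (extChartAt (𝓡 n) p).target)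
    {v : Vec n} (hv : v ≠ 0) : (tangentOfChart p x v).2 ≠ 0 := by
  have := fderiv_coordChange_ne_zero p _ (self_mem_overlap hx) hv
  rwa [← tangentCoordChange_eq _ _ (self_mem_overlap hx)] at this

theorem tangentOfChart_smul (p : M) (x v : Vec n) (a : ℝ) : tangentOfChart p x (a • v) =
    ⟨(extChartAt (𝓡 n) p).symm x, a • (tangentOfChart p x v).2⟩ := by
  rw [tangentOfChart_def, map_smul]
  rfl

theorem inChart_def (f : TangentBundle (𝓡 n) M → ℝ) (p : M) (x v : Vec n) :
    inChart f p x v = f (tangentOfChart p x v) := rfl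

theorem smoothOnSlit_inChart {f : TangentBundle (𝓡 n) M → ℝ}
    (hf : ContMDiffOn (𝓡 n).tangent 𝓘(ℝ, ℝ) ∞ f {v | v.2 ≠ 0}) (p : M) :
    SmoothOnSlit (extChartAt (𝓡 n) p).target (inChart f p) := by
  refine ContMDiffOn.contDiffOn ?_
  exact hf.comp ((contMDiffOn_tangentOfChart p).mono fun z hz => ⟨hz.1, mem_univ _⟩)
    fun z hz => tangentOfChart_snd_ne_zero p hz.1 hz.2

theorem inChart_coordChange (f : TangentBundle (𝓡 n) M → ℝ) (p q : M) {x : Vec n}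
    (hx : x ∈ overlap p q) (v : Vec n) :
    inChart f p x v = inChart f q (coordChange p q x) (fderiv ℝ (coordChange p q) x v) := by
  rw [inChart_def, inChart_def, tangentOfChart_coordChange p q hx]

theorem inChart_self (f : TangentBundle (𝓡 n) M → ℝ) (p : M) (v : Vec n) :
    inChart f p (extChartAt (𝓡 n) p p) v = f ⟨p, v⟩ := by
  rw [inChart_def, tangentOfChart_self]

/-- Velocities in charts. -/
theorem velocity_eq_tangentOfChart {γ : ℝ → M} {S : Set ℝ} {t : ℝ} {p : M} {w : Vec n}
    (hS : UniqueDiffWithinAt ℝ S t) (hp : γ t ∈ (extChartAt (𝓡 n) p).source)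
    (hc : ContinuousWithinAt γ S t)
    (hw : HasDerivWithinAt (fun s => extChartAt (𝓡 n) p (γ s)) w S t) :
    velocity γ S t = tangentOfChart p (extChartAt (𝓡 n) p (γ t)) w := by
  have hov : extChartAt (𝓡 n) p (γ t) ∈ overlap p (γ t) :=
    chart_mem_overlap hp (mem_extChartAt_source _)
  have h1 : HasDerivWithinAt (fun s => extChartAt (𝓡 n) (γ t) (γ s))
      (fderiv ℝ (coordChange p (γ t)) (extChartAt (𝓡 n) p (γ t)) w) S t := by
    have := (hasFDerivAt_coordChange p (γ t) hov).comp_hasDerivWithinAt t hw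
    refine this.congr_of_eventuallyEq ?_ (coordChange_apply p _ hp).symm
    filter_upwards [hc.preimage_mem_nhdsWithin ((isOpen_extChartAt_source p).mem_nhds hp)]
      with s hs using (coordChange_apply p _ hs).symm
  have h2 : MDifferentiableWithinAt 𝓘(ℝ, ℝ) (𝓡 n) γ S t := by
    refine mdifferentiableWithinAt_iff.2 ⟨hc, ?_⟩
    simp only [extChartAt_model_space_eq_id, ModelWithCorners.range_eq_univ, inter_univ]
    exact h1.differentiableWithinAt
  have h3 : mfderivWithin 𝓘(ℝ, ℝ) (𝓡 n) γ S t (1 : ℝ) =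
      fderiv ℝ (coordChange p (γ t)) (extChartAt (𝓡 n) p (γ t)) w := by
    rw [h2.mfderivWithin]
    have := h1.derivWithin hS
    simp only [extChartAt_model_space_eq_id, ModelWithCorners.range_eq_univ, inter_univ,
      writtenInExtChartAt]
    exact this
  rw [velocity, h3, ← tangentOfChart_self, ← tangentOfChart_coordChange p _ hov,
    coordChange_apply p _ hp]

end Charts

/-! ### Fibre-wise linear changes of coordinates -/

section LinearChange

variable {n : ℕ}

theorem clm_apply_eq_sum (L : Vec n →L[ℝ] Vec n) (a : Vec n) (k : Fin n) :
    L a k = ∑ j, a j * L (EuclideanSpace.single j 1) k := by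
  conv_lhs => rw [vec_eq_sum a, map_sum]
  simp

theorem fderiv_apply_eq_sum (f : Vec n → ℝ) (v a : Vec n) :
    fderiv ℝ f v a = ∑ k, a k * fderiv ℝ f v (EuclideanSpace.single k 1) := by
  conv_lhs => rw [vec_eq_sum a, map_sum]
  simp

theorem sum_sum_comm_sum_sum {ι κ : Type*} [Fintype ι] [Fintype κ] (f : ι → ι → κ → κ → ℝ) :
    ∑ i, ∑ j, ∑ k, ∑ l, f i j k l = ∑ k, ∑ l, ∑ i, ∑ j, f i j k l := by
  calc _ = ∑ p : ι × ι, ∑ q : κ × κ, f p.1 p.2 q.1 q.2 := by simp only [Fintype.sum_prod_type]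
    _ = ∑ q : κ × κ, ∑ p : ι × ι, f p.1 p.2 q.1 q.2 := Finset.sum_comm
    _ = _ := by simp only [Fintype.sum_prod_type]

/-- The bilinear form with matrix `(g_{ij}(v))`. -/
def gForm (F : Vec n → Vec n → ℝ) (x v a b : Vec n) : ℝ :=
  ∑ i, ∑ j, gLow F i j x v * a i * b j

variable {O : Set (Vec n)} {f g : Vec n → Vec n → ℝ} {x x' v : Vec n} {L : Vec n →L[ℝ] Vec n}

theorem dV_of_linear_change (hg : SmoothOnSlit O g) (hO : IsOpen O) (hx' : x' ∈ O) (hL : L v ≠ 0)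
    (h : ∀ w, f x w = g x' (L w)) (j : Fin n) :
    dV j f x v = ∑ k, L (EuclideanSpace.single j 1) k * dV k g x' (L v) := by
  have h1 : HasFDerivAt (fun w => f x w) ((fderiv ℝ (fun w => g x' w) (L v)).comp L) v := by
    simp only [h]
    exact (hg.differentiableAt_right hO hx' hL).hasFDerivAt.comp v L.hasFDerivAt
  rw [dV, h1.fderiv, ContinuousLinearMap.comp_apply, fderiv_apply_eq_sum]
  rfl

theorem dV_dV_of_linear_change (hg : SmoothOnSlit O g) (hO : IsOpen O) (hx' : x' ∈ O)
    (hL : ∀ w ≠ 0, L w ≠ 0) (hv : v ≠ 0) (h : ∀ w, f x w = g x' (L w)) (i j : Fin n) :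
    dV i (dV j f) x v = ∑ l, L (EuclideanSpace.single j 1) l *
      ∑ k, L (EuclideanSpace.single i 1) k * dV k (dV l g) x' (L v) := by
  have h1 : dV i (dV j f) x v = dV i (fun x w => ∑ l, L (EuclideanSpace.single j 1) l *
      dV l g x' (L w)) x v := by
    rw [dV, dV]
    congr 1
    refine Filter.EventuallyEq.fderiv_eq ?_
    filter_upwards [isOpen_compl_singleton.mem_nhds hv] with w hw
    exact dV_of_linear_change hg hO hx' (hL w hw) h j
  rw [h1]
  have h2 : ∀ l, HasFDerivAt (fun w => L (EuclideanSpace.single j 1) l * dV l g x' (L w))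
      (L (EuclideanSpace.single j 1) l • (fderiv ℝ (fun w => dV l g x' w) (L v)).comp L) v :=
    fun l => (((hg.dV hO l).differentiableAt_right hO hx' (hL v hv)).hasFDerivAt.comp v
      L.hasFDerivAt).const_mul _
  have h3 := HasFDerivAt.fun_sum fun l (_ : l ∈ Finset.univ) => h2 l
  rw [dV, h3.fderiv, _root_.sum_apply]
  refine Finset.sum_congr rfl fun l _ => ?_
  rw [_root_.smul_apply, ContinuousLinearMap.comp_apply, fderiv_apply_eq_sum]
  rfl

/-- On a single fibre a change of chart is linear, and second derivatives under a linear map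
transform as a bilinear form, without correction terms. -/
theorem gForm_of_linear_change {F G : Vec n → Vec n → ℝ} (hg : SmoothOnSlit O G) (hO : IsOpen O)
    (hx' : x' ∈ O) (hL : ∀ w ≠ 0, L w ≠ 0) (hv : v ≠ 0) (h : ∀ w, F x w = G x' (L w))
    (a b : Vec n) : gForm F x v a b = gForm G x' (L v) (L a) (L b) := by
  have hQ : SmoothOnSlit O (energy G) := ContDiffOn.pow hg 2
  have hh : ∀ w, energy F x w = energy G x' (L w) := fun w => by simp only [energy, h]
  have h1 : ∀ i j, gLow F i j x v = ∑ l, L (EuclideanSpace.single j 1) l *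
      ∑ k, L (EuclideanSpace.single i 1) k * gLow G k l x' (L v) := fun i j => by
    rw [gLow, dV_dV_of_linear_change hQ hO hx' hL hv hh, Finset.mul_sum]
    refine Finset.sum_congr rfl fun l _ => ?_
    rw [mul_left_comm, Finset.mul_sum]
    congr 1
    exact Finset.sum_congr rfl fun k _ => by rw [gLow]; ring
  have h2 : ∀ l k, gLow G k l x' (L v) * L a k * L b l =
      ∑ i, ∑ j, (L (EuclideanSpace.single j 1) l * (L (EuclideanSpace.single i 1) k *
        gLow G k l x' (L v))) * a i * b j := fun l k => by
    rw [clm_apply_eq_sum L a, clm_apply_eq_sum L b]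
    simp only [Finset.mul_sum, Finset.sum_mul]
    rw [Finset.sum_comm]
    exact Finset.sum_congr rfl fun i _ => Finset.sum_congr rfl fun j _ => by ring
  simp only [gForm, h1, h2, Finset.mul_sum, Finset.sum_mul]
  rw [sum_sum_comm_sum_sum, Finset.sum_comm]

/-- Symmetry of the matrix is automatic because fibre derivatives commute. What remains is a
condition on the quadratic form, which can be moved between charts. -/
theorem gMatrix_posDef_iff {F : Vec n → Vec n → ℝ} (hF : SmoothOnSlit O F) (hO : IsOpen O)
    (hx : x ∈ O) (hv : v ≠ 0) : (gMatrix F x v).PosDef ↔ ∀ a ≠ 0, 0 < gForm F x v a a := by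
  have key : ∀ a : Vec n, star (a : Fin n → ℝ) ⬝ᵥ (gMatrix F x v).mulVec a = gForm F x v a a :=
    fun a => by
      simp only [dotProduct, Matrix.mulVec, gForm, Finset.mul_sum, gMatrix, Matrix.of_apply,
        star_trivial, Pi.star_apply]
      exact Finset.sum_congr rfl fun i _ => Finset.sum_congr rfl fun j _ => by ring
  rw [Matrix.posDef_iff_dotProduct_mulVec]
  constructor
  · intro h a ha
    rw [← key]
    exact h.2 (by simpa using ha)
  · intro h
    refine ⟨?_, fun a ha => ?_⟩
    · ext i j
      have hQ : SmoothOnSlit O (energy F) := ContDiffOn.pow hF 2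
      simp only [Matrix.conjTranspose_apply, gMatrix, Matrix.of_apply, star_trivial, gLow]
      rw [hQ.dV_dV_comm hO hx hv]
    · have := key (WithLp.toLp 2 a)
      simp only at this
      rw [this]
      exact h _ (by simpa using ha)

end LinearChange

/-! ### Finsler structures under change of chart -/

section FinslerCharts

variable {n : ℕ} {M : Type*} [TopologicalSpace M] [ChartedSpace (EuclideanSpace ℝ (Fin n)) M]
  [IsManifold (𝓡 n) ∞ M] {F : TangentBundle (𝓡 n) M → ℝ}

theorem gForm_coordChange (hF : IsFinslerStructure F) (p q : M) {x v : Vec n}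
    (hx : x ∈ overlap p q) (hv : v ≠ 0) (a b : Vec n) :
    gForm (inChart F p) x v a b = gForm (inChart F q) (coordChange p q x)
      (fderiv ℝ (coordChange p q) x v) (fderiv ℝ (coordChange p q) x a)
      (fderiv ℝ (coordChange p q) x b) :=
  gForm_of_linear_change (smoothOnSlit_inChart hF.smooth q) (isOpen_target q)
    (coordChange_mem p q hx) (fun _ hw => fderiv_coordChange_ne_zero p q hx hw) hv
    (fun w => inChart_coordChange F p q hx w) a b

/-- Strong convexity is assumed at each point only in the chart centred there. Invariance of g_v
carries it to every point in the domain of the chart around p. -/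
theorem isLocalFinsler_inChart (hF : IsFinslerStructure F) (p : M) :
    IsLocalFinsler (extChartAt (𝓡 n) p).target (inChart F p) where
  isOpen := isOpen_target p
  smooth := smoothOnSlit_inChart hF.smooth p
  homog x hx v a ha := by
    rw [inChart_def, inChart_def, tangentOfChart_smul]
    exact hF.homog _ _ _ ha
  posDef x hx v hv := by
    rw [gMatrix_posDef_iff (smoothOnSlit_inChart hF.smooth p) (isOpen_target p) hx hv]
    intro a ha
    have hov := self_mem_overlap hx
    have hv' := fderiv_coordChange_ne_zero _ _ hov hv
    have ha' := fderiv_coordChange_ne_zero _ _ hov ha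
    have := hF.convex ((extChartAt (𝓡 n) p).symm x) _ hv'
    rw [gForm_coordChange hF p _ hov hv]
    exact (gMatrix_posDef_iff (smoothOnSlit_inChart hF.smooth _) (isOpen_target _)
      (mem_extChartAt_target _) hv').1 this _ ha'

/-- The coordinates of tangent vectors at `q` in the chart around `p`. -/
def toChart (p q : M) : Vec n →L[ℝ] Vec n :=
  fderiv ℝ (coordChange q p) (extChartAt (𝓡 n) q q)

theorem chart_self_mem_overlap {p q : M} (hq : q ∈ (extChartAt (𝓡 n) p).source) :
    extChartAt (𝓡 n) q q ∈ overlap q p := chart_mem_overlap (mem_extChartAt_source q) hq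

theorem tangentOfChart_toChart {p q : M} (hq : q ∈ (extChartAt (𝓡 n) p).source) (v : Vec n) :
    tangentOfChart p (extChartAt (𝓡 n) p q) (toChart p q v) = ⟨q, v⟩ := by
  rw [← tangentOfChart_self, ← tangentOfChart_coordChange q p (chart_self_mem_overlap hq),
    coordChange_apply q p (mem_extChartAt_source q)]
  rfl

theorem toChart_snd {p q : M} (hq : q ∈ (extChartAt (𝓡 n) p).source) {V : TangentBundle (𝓡 n) M}
    {x w : Vec n} (hx : x ∈ (extChartAt (𝓡 n) p).target) (hV : V = tangentOfChart p x w)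
    (hVq : V.1 = q) : toChart p q (show Vec n from V.2) = w := by
  subst hVq
  have := tangentOfChart_toChart hq (show Vec n from V.2)
  exact (tangentOfChart_injective p ((extChartAt (𝓡 n) p).map_source hq) hx (this.trans hV)).2

/-- The inner products `g_v` in a chart. -/
theorem gInner_eq_gForm_toChart (hF : IsFinslerStructure F) {p q : M}
    (hq : q ∈ (extChartAt (𝓡 n) p).source) {v : Vec n} (hv : v ≠ 0) (a b : Vec n) :
    gInner F q v a b = gForm (inChart F p) (extChartAt (𝓡 n) p q) (toChart p q v) (toChart p q a)
      (toChart p q b) := by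
  change gForm (inChart F q) (extChartAt (𝓡 n) q q) v a b = _
  rw [gForm_coordChange hF q p (chart_self_mem_overlap hq) hv,
    coordChange_apply q p (mem_extChartAt_source q)]
  rfl

/-- The derivative of the change of coordinates is smooth. -/
theorem hasDerivWithinAt_fderiv_coordChange (p q : M) {y w : ℝ → Vec n} {y' w' : Vec n} {S : Set ℝ}
    {t : ℝ} (hx : y t ∈ overlap p q) (hy : HasDerivWithinAt y y' S t)
    (hw : HasDerivWithinAt w w' S t) :
    HasDerivWithinAt (fun s => fderiv ℝ (coordChange p q) (y s) (w s))
      (fderiv ℝ (fderiv ℝ (coordChange p q)) (y t) y' (w t) +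
        fderiv ℝ (coordChange p q) (y t) w') S t := by
  have h1 : HasFDerivAt (fderiv ℝ (coordChange p q : Vec n → Vec n))
      (fderiv ℝ (fderiv ℝ (coordChange p q)) (y t)) (y t) := by
    have := (contDiffOn_coordChange p q).contDiffAt ((isOpen_overlap p q).mem_nhds hx)
    exact ((this.fderiv_right (m := ∞) (by simp)).differentiableAt (by simp)).hasFDerivAt
  exact (h1.comp_hasDerivWithinAt t hy).clm_apply hw

theorem fderiv_fderiv_coordChange_symm (p q : M) {x : Vec n} (hx : x ∈ overlap p q) (a b : Vec n) :
    fderiv ℝ (fderiv ℝ (coordChange p q)) x a b = fderiv ℝ (fderiv ℝ (coordChange p q)) x b a := by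
  have := (contDiffOn_coordChange p q).contDiffAt ((isOpen_overlap p q).mem_nhds hx)
  exact this.isSymmSndFDerivAt (by
    simp only [minSmoothness_of_isRCLikeNormedField]; exact WithTop.coe_le_coe.2 le_top) a b

theorem dV_energy_coordChange (hF : IsFinslerStructure F) (p q : M) {x v : Vec n}
    (hx : x ∈ overlap p q) (hv : v ≠ 0) (m : Fin n) :
    dV m (energy (inChart F p)) x v = ∑ k, fderiv ℝ (coordChange p q) x (EuclideanSpace.single m 1) k
      * dV k (energy (inChart F q)) (coordChange p q x) (fderiv ℝ (coordChange p q) x v) :=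
  dV_of_linear_change (isLocalFinsler_inChart hF q).smooth_energy (isOpen_target q)
    (coordChange_mem p q hx) (fderiv_coordChange_ne_zero p q hx hv)
    (fun w => by simp only [energy, inChart_coordChange F p q hx w]) m

/-- The fibre coordinate in the second chart depends on the base point through the Jacobian of the
transition map; the second sum is this dependence. -/
theorem dX_energy_coordChange (hF : IsFinslerStructure F) (p q : M) {x v : Vec n}
    (hx : x ∈ overlap p q) (hv : v ≠ 0) (m : Fin n) :
    dX m (energy (inChart F p)) x v =
      ∑ k, dX k (energy (inChart F q)) (coordChange p q x) (fderiv ℝ (coordChange p q) x v) *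
        fderiv ℝ (coordChange p q) x (EuclideanSpace.single m 1) k +
      ∑ k, dV k (energy (inChart F q)) (coordChange p q x) (fderiv ℝ (coordChange p q) x v) *
        fderiv ℝ (fderiv ℝ (coordChange p q)) x (EuclideanSpace.single m 1) v k := by
  have hQ := (isLocalFinsler_inChart hF q).smooth_energy
  have hxp := overlap_subset p q hx
  set e : Vec n := EuclideanSpace.single m 1
  have hline : HasDerivAt (fun s : ℝ => x + s • e) e 0 := by
    simpa using ((hasDerivAt_id (0 : ℝ)).smul_const e).const_add x
  have h0 : x + (0 : ℝ) • e = x := by simp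
  have h1 : HasDerivAt (fun s : ℝ => energy (inChart F p) (x + s • e) v)
      (dX m (energy (inChart F p)) x v) 0 := by
    have := (isLocalFinsler_inChart hF p).smooth_energy.differentiableAt_left (isOpen_target p)
      hxp hv
    rw [← h0] at this
    have := this.hasFDerivAt.comp_hasDerivAt (0 : ℝ) hline
    rwa [h0] at this
  have hov : ∀ᶠ s : ℝ in 𝓝 0, x + s • e ∈ overlap p q :=
    hline.continuousAt.eventually_mem ((isOpen_overlap p q).mem_nhds (by rwa [h0]))
  have hA : HasDerivAt (fun s : ℝ => coordChange p q (x + s • e)) (fderiv ℝ (coordChange p q) x e)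
      0 := by
    have := hasFDerivAt_coordChange p q hx
    rw [← h0] at this
    have := this.comp_hasDerivAt (0 : ℝ) hline
    rwa [h0] at this
  have hB : HasDerivAt (fun s : ℝ => fderiv ℝ (coordChange p q) (x + s • e) v)
      (fderiv ℝ (fderiv ℝ (coordChange p q)) x e v) 0 := by
    have := hasDerivWithinAt_fderiv_coordChange p q (S := univ) (y := fun s : ℝ => x + s • e)
      (w := fun _ => v) (t := 0) (by rwa [h0]) hline.hasDerivWithinAt
      (hasDerivWithinAt_const _ _ _)
    rw [hasDerivWithinAt_univ] at this
    simpa using this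
  have h2 := hQ.hasDerivAt (isOpen_target q) (y := fun s : ℝ => coordChange p q (x + s • e))
    (w := fun s : ℝ => fderiv ℝ (coordChange p q) (x + s • e) v) (t := 0)
    (by rw [h0]; exact coordChange_mem p q hx)
    (by rw [h0]; exact fderiv_coordChange_ne_zero p q hx hv) hA hB
  have h3 := h2.congr_of_eventuallyEq (f₁ := fun s : ℝ => energy (inChart F p) (x + s • e) v) (by
    filter_upwards [hov] with s hs
    simp only [energy, inChart_coordChange F p q hs])
  rw [h1.unique h3, h0]

/-- The geodesic equation does not depend on the chart. -/
theorem geodesic_coordChange (hF : IsFinslerStructure F) (p q : M) {y w : ℝ → Vec n} {S : Set ℝ}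
    {t : ℝ} (hS : UniqueDiffWithinAt ℝ S t) (ht : t ∈ S) (hov : ∀ᶠ s in 𝓝[S] t, y s ∈ overlap p q)
    (hv : w t ≠ 0)
    (hy : HasDerivWithinAt y (w t) S t)
    (hw : HasDerivWithinAt w (geodAcc (inChart F p) (y t) (w t)) S t) :
    HasDerivWithinAt (fun s => coordChange p q (y s)) (fderiv ℝ (coordChange p q) (y t) (w t)) S t ∧
    HasDerivWithinAt (fun s => fderiv ℝ (coordChange p q) (y s) (w s))
      (geodAcc (inChart F q) (coordChange p q (y t)) (fderiv ℝ (coordChange p q) (y t) (w t)))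
      S t := by
  have hx : y t ∈ overlap p q := hov.self_of_nhdsWithin ht
  have hy' : HasDerivWithinAt (fun s => coordChange p q (y s))
      (fderiv ℝ (coordChange p q) (y t) (w t)) S t :=
    (hasFDerivAt_coordChange p q hx).comp_hasDerivWithinAt t hy
  refine ⟨hy', ?_⟩
  have hw' := hasDerivWithinAt_fderiv_coordChange p q hx hy hw
  have hx' := coordChange_mem_overlap p q hx
  -- It suffices to verify the Euler–Lagrange equation in the new chart, so no transformation rule
  -- for the spray coefficients is needed.
  refine hw'.congr_deriv ((isLocalFinsler_inChart hF q).eq_geodAcc_of_hasDerivWithinAt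
    (y := fun s => coordChange p q (y s)) (w := fun s => fderiv ℝ (coordChange p q) (y s) (w s))
    (coordChange_mem p q hx) (fderiv_coordChange_ne_zero p q hx hv) hS hy' hw' fun m => ?_)
  have hEL := (isLocalFinsler_inChart hF p).hasDerivWithinAt_dV_energy (overlap_subset p q hx) hv hy
    hw
  have hc := hasDerivWithinAt_vec.1 (hasDerivWithinAt_fderiv_coordChange q p (S := S)
    (w := fun _ => EuclideanSpace.single m 1) hx' hy' (hasDerivWithinAt_const _ _ _))
  -- The momenta in the new chart are those in the old chart contracted with the inverse Jacobian.
  -- The product rule and the old Euler–Lagrange equation give their derivative.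
  have hsum := HasDerivWithinAt.fun_sum fun k (_ : k ∈ Finset.univ) => (hc k).mul (hEL k)
  have hne : ∀ᶠ s in 𝓝[S] t, w s ≠ 0 := hw.continuousWithinAt.eventually_ne hv
  have heq : ∀ s, y s ∈ overlap p q → w s ≠ 0 → dV m (energy (inChart F q)) (coordChange p q (y s))
      (fderiv ℝ (coordChange p q) (y s) (w s)) = ∑ k, fderiv ℝ (coordChange q p)
        (coordChange p q (y s)) (EuclideanSpace.single m 1) k *
          dV k (energy (inChart F p)) (y s) (w s) := fun s hs hws => by
    rw [dV_energy_coordChange hF q p (coordChange_mem_overlap p q hs)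
      (fderiv_coordChange_ne_zero p q hs hws), coordChange_coordChange p q hs,
      fderiv_coordChange_comp p q hs]
  refine (hsum.congr_of_eventuallyEq ?_ (heq t hx hv)).congr_deriv ?_
  · filter_upwards [hov, hne] with s hs hws using heq s hs hws
  · rw [dX_energy_coordChange hF q p hx' (fderiv_coordChange_ne_zero p q hx hv),
      coordChange_coordChange p q hx, fderiv_coordChange_comp p q hx, ← Finset.sum_add_distrib]
    refine Finset.sum_congr rfl fun k _ => ?_
    rw [fderiv_fderiv_coordChange_symm q p hx', map_zero, add_zero]
    ring

end FinslerCharts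

/-! ### Geodesics in charts -/

section Geodesics

variable {n : ℕ} {M : Type*} [TopologicalSpace M] [ChartedSpace (EuclideanSpace ℝ (Fin n)) M]
  [IsManifold (𝓡 n) ∞ M] {F : TangentBundle (𝓡 n) M → ℝ}

/-- Near the time `t ∈ S`, the curve `γ` is represented by `y` in the chart around `p`, with
velocity `w`, and it satisfies the geodesic equation at the time `t`, with nonzero velocity. -/
structure GeodRep (F : TangentBundle (𝓡 n) M → ℝ) (γ : ℝ → M) (S : Set ℝ) (t : ℝ) (p : M)
    (y w : ℝ → Vec n) : Prop where
  mem : t ∈ S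
  rep : ∀ᶠ s in 𝓝[S] t, y s ∈ (extChartAt (𝓡 n) p).target ∧ γ s = (extChartAt (𝓡 n) p).symm (y s)
  ne_zero : w t ≠ 0
  deriv : ∀ᶠ s in 𝓝[S] t, HasDerivWithinAt y (w s) S s
  acc : HasDerivWithinAt w (geodAcc (inChart F p) (y t) (w t)) S t

namespace GeodRep

variable {γ : ℝ → M} {S : Set ℝ} {t : ℝ} {p : M} {y w : ℝ → Vec n}

theorem mem_target (h : GeodRep F γ S t p y w) : y t ∈ (extChartAt (𝓡 n) p).target :=
  (h.rep.self_of_nhdsWithin h.mem).1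

theorem eq (h : GeodRep F γ S t p y w) : γ t = (extChartAt (𝓡 n) p).symm (y t) :=
  (h.rep.self_of_nhdsWithin h.mem).2

theorem hasDerivWithinAt (h : GeodRep F γ S t p y w) : HasDerivWithinAt y (w t) S t :=
  h.deriv.self_of_nhdsWithin h.mem

theorem mono (h : GeodRep F γ S t p y w) {T : Set ℝ} (hT : T ⊆ S) (ht : t ∈ T) :
    GeodRep F γ T t p y w where
  mem := ht
  rep := h.rep.filter_mono (nhdsWithin_mono _ hT)
  ne_zero := h.ne_zero
  deriv := (h.deriv.filter_mono (nhdsWithin_mono _ hT)).mono fun _ hs => hs.mono hT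
  acc := h.acc.mono hT

theorem congr (h : GeodRep F γ S t p y w) {γ' : ℝ → M} (hγ : γ' =ᶠ[𝓝[S] t] γ) :
    GeodRep F γ' S t p y w where
  mem := h.mem
  rep := by filter_upwards [h.rep, hγ] with s hs h' using ⟨hs.1, h'.trans hs.2⟩
  ne_zero := h.ne_zero
  deriv := h.deriv
  acc := h.acc

theorem coordChange (hF : IsFinslerStructure F) (h : GeodRep F γ S t p y w)
    (hS : UniqueDiffOn ℝ S) {q : M} (hq : γ t ∈ (extChartAt (𝓡 n) q).source) :
    GeodRep F γ S t q (fun s => coordChange p q (y s))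
      (fun s => fderiv ℝ (Finsler.coordChange p q) (y s) (w s)) := by
  have hx : y t ∈ overlap p q := ⟨h.mem_target, by rw [mem_preimage, ← h.eq]; exact hq⟩
  have hov : ∀ᶠ s in 𝓝[S] t, y s ∈ overlap p q :=
    h.hasDerivWithinAt.continuousWithinAt.eventually_mem ((isOpen_overlap p q).mem_nhds hx)
  obtain ⟨h1, h2⟩ := geodesic_coordChange hF p q (hS t h.mem) h.mem hov h.ne_zero
    h.hasDerivWithinAt h.acc
  refine ⟨h.mem, ?_, fderiv_coordChange_ne_zero p q hx h.ne_zero, ?_, h2⟩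
  · filter_upwards [hov, h.rep] with s hs hr
    exact ⟨coordChange_mem p q hs, by rw [symm_coordChange p q hs, hr.2]⟩
  · filter_upwards [hov, h.deriv] with s hs hd
    exact (hasFDerivAt_coordChange p q hs).comp_hasDerivWithinAt s hd

theorem velocity_eventually (h : GeodRep F γ S t p y w) (hS : UniqueDiffOn ℝ S) :
    ∀ᶠ s in 𝓝[S] t, velocity γ S s = tangentOfChart p (y s) (w s) := by
  filter_upwards [eventually_eventually_nhdsWithin.2 h.rep, h.rep, h.deriv, self_mem_nhdsWithin]
    with s hs' hs hd hsS
  have hγ : γ s ∈ (extChartAt (𝓡 n) p).source := by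
    rw [hs.2]
    exact (extChartAt (𝓡 n) p).map_target hs.1
  have hys : extChartAt (𝓡 n) p (γ s) = y s := by
    rw [hs.2, (extChartAt (𝓡 n) p).right_inv hs.1]
  have hc : ContinuousWithinAt γ S s := by
    have h1 : ContinuousWithinAt (fun r => (extChartAt (𝓡 n) p).symm (y r)) S s :=
      ((continuousOn_extChartAt_symm p).continuousAt
        ((isOpen_target p).mem_nhds hs.1)).comp_continuousWithinAt hd.continuousWithinAt
    exact h1.congr_of_eventuallyEq (hs'.mono fun r hr => hr.2) hs.2
  rw [velocity_eq_tangentOfChart (hS s hsS) hγ hc (w := w s) ?_, hys]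
  refine hd.congr_of_eventuallyEq ?_ hys
  filter_upwards [hs'] with r hr
  rw [hr.2, (extChartAt (𝓡 n) p).right_inv hr.1]

theorem velocity_eq (h : GeodRep F γ S t p y w) (hS : UniqueDiffOn ℝ S) :
    velocity γ S t = tangentOfChart p (y t) (w t) :=
  (h.velocity_eventually hS).self_of_nhdsWithin h.mem

/-- The spray has degree two, matching the factor a² of the second derivative. Only a > 0 is
allowed: homogeneity is positive and F need not be reversible. -/
theorem affine (hF : IsFinslerStructure F) (h : GeodRep F γ S t p y w) {a b r : ℝ} (ha : 0 < a)
    (hr : a * r + b = t) :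
    GeodRep F (fun s => γ (a * s + b)) ((fun s => a * s + b) ⁻¹' S) r p (fun s => y (a * s + b))
      (fun s => a • w (a * s + b)) := by
  subst hr
  have hd : ∀ r : ℝ, HasDerivAt (fun s : ℝ => a * s + b) a r := fun r => by
    simpa using ((hasDerivAt_id r).const_mul a).add_const b
  have htend : Tendsto (fun s : ℝ => a * s + b) (𝓝[(fun s => a * s + b) ⁻¹' S] r)
      (𝓝[S] (a * r + b)) :=
    (hd r).continuousAt.continuousWithinAt.tendsto_nhdsWithin (mapsTo_preimage _ _)
  refine ⟨h.mem, htend.eventually h.rep, smul_ne_zero ha.ne' h.ne_zero, ?_, ?_⟩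
  · filter_upwards [htend.eventually h.deriv] with s hs
    exact hs.scomp s (hd s).hasDerivWithinAt (mapsTo_preimage _ _)
  · have h1 := (h.acc.scomp r (hd r).hasDerivWithinAt (mapsTo_preimage _ _)).const_smul a
    refine h1.congr_deriv ?_
    ext i
    have := (isLocalFinsler_inChart hF p).homog_spray i _ h.mem_target _ h.ne_zero a ha
    rw [geodAcc_apply, this, PiLp.smul_apply, PiLp.smul_apply, geodAcc_apply]
    simp only [smul_eq_mul]
    norm_cast
    ring

/-- Geodesics have constant speed. -/
theorem hasDerivWithinAt_speed (hF : IsFinslerStructure F) (h : GeodRep F γ S t p y w)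
    (hS : UniqueDiffOn ℝ S) : HasDerivWithinAt (fun s => F (velocity γ S s) ^ 2) 0 S t := by
  refine ((isLocalFinsler_inChart hF p).hasDerivWithinAt_energy h.mem_target h.ne_zero
    h.hasDerivWithinAt h.acc).congr_of_eventuallyEq ?_ ?_
  · filter_upwards [h.velocity_eventually hS] with s hs
    rw [hs, energy, inChart_def]
  · rw [h.velocity_eq hS, energy, inChart_def]

end GeodRep

variable {γ : ℝ → M} {S : Set ℝ} {t : ℝ} {p : M}

theorem contDiffWithinAt_chart (hγ : ContMDiffOn 𝓘(ℝ, ℝ) (𝓡 n) ∞ γ S) (ht : t ∈ S)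
    (hp : γ t ∈ (extChartAt (𝓡 n) p).source) :
    ContDiffWithinAt ℝ ∞ (fun s => extChartAt (𝓡 n) p (γ s)) S t := by
  have h1 : ContMDiffAt (𝓡 n) 𝓘(ℝ, Vec n) ∞ (extChartAt (𝓡 n) p) (γ t) :=
    contMDiffAt_extChartAt' (by rwa [← extChartAt_source (𝓡 n)])
  exact (h1.comp_contMDiffWithinAt t (hγ t ht)).contDiffWithinAt

theorem eventually_mem_source (hγ : ContMDiffOn 𝓘(ℝ, ℝ) (𝓡 n) ∞ γ S) (ht : t ∈ S)
    (hp : γ t ∈ (extChartAt (𝓡 n) p).source) :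
    ∀ᶠ s in 𝓝[S] t, γ s ∈ (extChartAt (𝓡 n) p).source :=
  (hγ t ht).continuousWithinAt.eventually_mem ((isOpen_extChartAt_source p).mem_nhds hp)

theorem hasDerivWithinAt_chart (hγ : ContMDiffOn 𝓘(ℝ, ℝ) (𝓡 n) ∞ γ S) (ht : t ∈ S)
    (hp : γ t ∈ (extChartAt (𝓡 n) p).source) :
    ∀ᶠ s in 𝓝[S] t, HasDerivWithinAt (fun s => extChartAt (𝓡 n) p (γ s))
      (derivWithin (fun s => extChartAt (𝓡 n) p (γ s)) S s) S s := by
  filter_upwards [eventually_mem_source hγ ht hp, self_mem_nhdsWithin] with s hs hsS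
  exact ((contDiffWithinAt_chart hγ hsS hs).differentiableWithinAt (by simp)).hasDerivWithinAt

theorem velocity_chart (hS : UniqueDiffOn ℝ S) (hγ : ContMDiffOn 𝓘(ℝ, ℝ) (𝓡 n) ∞ γ S) (ht : t ∈ S)
    (hp : γ t ∈ (extChartAt (𝓡 n) p).source) :
    velocity γ S t = tangentOfChart p (extChartAt (𝓡 n) p (γ t))
      (derivWithin (fun s => extChartAt (𝓡 n) p (γ s)) S t) :=
  velocity_eq_tangentOfChart (hS t ht) hp (hγ t ht).continuousWithinAt
    ((hasDerivWithinAt_chart hγ ht hp).self_of_nhdsWithin ht)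

theorem differentiableWithinAt_derivWithin_chart (hS : UniqueDiffOn ℝ S)
    (hγ : ContMDiffOn 𝓘(ℝ, ℝ) (𝓡 n) ∞ γ S) (ht : t ∈ S)
    (hp : γ t ∈ (extChartAt (𝓡 n) p).source) :
    DifferentiableWithinAt ℝ (derivWithin (fun s => extChartAt (𝓡 n) p (γ s)) S) S t := by
  have h1 := ((contDiffWithinAt_chart hγ ht hp).fderivWithin_right (m := ∞) hS (by simp)
    ht).differentiableWithinAt (by simp)
  exact h1.clm_apply (differentiableWithinAt_const (1 : ℝ))

theorem geodRep_of_eq (hS : UniqueDiffOn ℝ S) (hγ : ContMDiffOn 𝓘(ℝ, ℝ) (𝓡 n) ∞ γ S) (ht : t ∈ S)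
    (hp : γ t ∈ (extChartAt (𝓡 n) p).source)
    (h0 : derivWithin (fun s => extChartAt (𝓡 n) p (γ s)) S t ≠ 0)
    (hacc : derivWithin (derivWithin (fun s => extChartAt (𝓡 n) p (γ s)) S) S t =
      geodAcc (inChart F p) (extChartAt (𝓡 n) p (γ t))
        (derivWithin (fun s => extChartAt (𝓡 n) p (γ s)) S t)) :
    GeodRep F γ S t p (fun s => extChartAt (𝓡 n) p (γ s))
      (derivWithin (fun s => extChartAt (𝓡 n) p (γ s)) S) where
  mem := ht
  rep := by
    filter_upwards [eventually_mem_source hγ ht hp] with s hs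
    exact ⟨(extChartAt (𝓡 n) p).map_source hs, ((extChartAt (𝓡 n) p).left_inv hs).symm⟩
  ne_zero := h0
  deriv := hasDerivWithinAt_chart hγ ht hp
  acc := (differentiableWithinAt_derivWithin_chart hS hγ ht hp).hasDerivWithinAt.congr_deriv hacc

/-- Normalizes a local representation to the canonical one, given by the chart expression of the
curve and its derivative. -/
theorem GeodRep.toChart (hS : UniqueDiffOn ℝ S) {y w : ℝ → Vec n} (h : GeodRep F γ S t p y w) :
    GeodRep F γ S t p (fun s => extChartAt (𝓡 n) p (γ s))
      (derivWithin (fun s => extChartAt (𝓡 n) p (γ s)) S) := by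
  have hy : ∀ᶠ s in 𝓝[S] t, extChartAt (𝓡 n) p (γ s) = y s := by
    filter_upwards [h.rep] with s hs
    rw [hs.2, (extChartAt (𝓡 n) p).right_inv hs.1]
  have hy' : ∀ᶠ s in 𝓝[S] t, HasDerivWithinAt (fun s => extChartAt (𝓡 n) p (γ s)) (w s) S s := by
    filter_upwards [eventually_eventually_nhdsWithin.2 hy, hy, h.deriv] with s h1 h2 h3
      using h3.congr_of_eventuallyEq h1 h2
  have hw : ∀ᶠ s in 𝓝[S] t, derivWithin (fun s => extChartAt (𝓡 n) p (γ s)) S s = w s := by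
    filter_upwards [hy', self_mem_nhdsWithin] with s hs hsS using hs.derivWithin (hS s hsS)
  have hwt := hw.self_of_nhdsWithin h.mem
  refine ⟨h.mem, ?_, by rw [hwt]; exact h.ne_zero, ?_, ?_⟩
  · filter_upwards [hy, h.rep] with s hs hr
    rw [hs]
    exact hr
  · filter_upwards [hy', hw] with s h1 h2
    rwa [h2]
  · rw [hy.self_of_nhdsWithin h.mem, hwt]
    exact h.acc.congr_of_eventuallyEq hw hwt

theorem GeodRep.velocity_ne_zero {y w : ℝ → Vec n} (h : GeodRep F γ S t p y w)
    (hS : UniqueDiffOn ℝ S) : (velocity (n := n) γ S t).2 ≠ 0 := by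
  rw [h.velocity_eq hS]
  exact tangentOfChart_snd_ne_zero p h.mem_target h.ne_zero

theorem tangentOfChart_zero_snd (p : M) (x : Vec n) : (tangentOfChart p x 0).2 = 0 := by
  rw [tangentOfChart_def]
  exact map_zero (tangentCoordChange (𝓡 n) p ((extChartAt (𝓡 n) p).symm x)
    ((extChartAt (𝓡 n) p).symm x))

/-- The definition imposes the equation at time t only in the chart around γ(t); covariance of the
Euler–Lagrange equation transfers it to any chart containing γ(t). -/
theorem IsGeodesicOn.geodRep (hF : IsFinslerStructure F) (hS : UniqueDiffOn ℝ S)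
    (h : IsGeodesicOn F γ S) (ht : t ∈ S) (h0 : (velocity (n := n) γ S t).2 ≠ 0)
    (hp : γ t ∈ (extChartAt (𝓡 n) p).source) :
    GeodRep F γ S t p (fun s => extChartAt (𝓡 n) p (γ s))
      (derivWithin (fun s => extChartAt (𝓡 n) p (γ s)) S) := by
  have hq := mem_extChartAt_source (I := 𝓡 n) (γ t)
  have hne : derivWithin (fun s => extChartAt (𝓡 n) (γ t) (γ s)) S t ≠ 0 := fun h1 => h0 <| by
    rw [velocity_chart hS h.1 ht hq, h1]
    exact tangentOfChart_zero_snd _ _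
  have h1 := geodRep_of_eq (F := F) hS h.1 ht hq hne (by
    ext i
    have := h.2 t ht i
    rw [geodAcc_apply]
    linarith)
  exact (h1.coordChange hF hS hp).toChart hS

theorem isGeodesicOn_of_geodRep (hF : IsFinslerStructure F) (hS : UniqueDiffOn ℝ S)
    (hγ : ContMDiffOn 𝓘(ℝ, ℝ) (𝓡 n) ∞ γ S) (h : ∀ t ∈ S, ∃ p y w, GeodRep F γ S t p y w) :
    IsGeodesicOn F γ S := by
  refine ⟨hγ, fun t ht i => ?_⟩
  obtain ⟨p, y, w, hr⟩ := h t ht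
  have h1 := ((hr.coordChange hF hS (mem_extChartAt_source (γ t))).toChart hS).acc.derivWithin
    (hS t ht)
  rw [h1, geodAcc_apply]
  ring

theorem tangentOfChart_smul_eq {V : TangentBundle (𝓡 n) M} {x w : Vec n} (a : ℝ)
    (h : tangentOfChart p x w = V) : tangentOfChart p x (a • w) = ⟨V.1, a • V.2⟩ := by
  subst h
  rw [tangentOfChart_smul]
  rfl

/-- Geodesics with nonvanishing velocity. -/
structure IsRegularGeodesic (F : TangentBundle (𝓡 n) M → ℝ) (γ : ℝ → M) (S : Set ℝ) : Prop where
  isGeodesicOn : IsGeodesicOn F γ S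
  velocity_ne_zero : ∀ t ∈ S, (velocity (n := n) γ S t).2 ≠ 0

namespace IsRegularGeodesic

theorem geodRep (hF : IsFinslerStructure F) (hS : UniqueDiffOn ℝ S)
    (h : IsRegularGeodesic F γ S) (ht : t ∈ S) (hp : γ t ∈ (extChartAt (𝓡 n) p).source) :
    GeodRep F γ S t p (fun s => extChartAt (𝓡 n) p (γ s))
      (derivWithin (fun s => extChartAt (𝓡 n) p (γ s)) S) :=
  h.isGeodesicOn.geodRep hF hS ht (h.velocity_ne_zero t ht) hp

theorem of_geodRep (hF : IsFinslerStructure F) (hS : UniqueDiffOn ℝ S)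
    (hγ : ContMDiffOn 𝓘(ℝ, ℝ) (𝓡 n) ∞ γ S) (h : ∀ t ∈ S, ∃ p y w, GeodRep F γ S t p y w) :
    IsRegularGeodesic F γ S := by
  refine ⟨isGeodesicOn_of_geodRep hF hS hγ h, fun t ht => ?_⟩
  obtain ⟨p, y, w, hr⟩ := h t ht
  exact hr.velocity_ne_zero hS

theorem mono (hF : IsFinslerStructure F) (hS : UniqueDiffOn ℝ S) (h : IsRegularGeodesic F γ S)
    {T : Set ℝ} (hT : UniqueDiffOn ℝ T) (hTS : T ⊆ S) : IsRegularGeodesic F γ T :=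
  of_geodRep hF hT (h.isGeodesicOn.1.mono hTS) fun t ht =>
    ⟨γ t, _, _, (h.geodRep hF hS (hTS ht) (mem_extChartAt_source _)).mono hTS ht⟩

theorem velocity_mono (hF : IsFinslerStructure F) (hS : UniqueDiffOn ℝ S)
    (h : IsRegularGeodesic F γ S) {T : Set ℝ} (hT : UniqueDiffOn ℝ T) (hTS : T ⊆ S) (ht : t ∈ T) :
    velocity (n := n) γ T t = velocity γ S t := by
  have hr := h.geodRep hF hS (hTS ht) (mem_extChartAt_source (γ t))
  rw [(hr.mono hTS ht).velocity_eq hT, hr.velocity_eq hS]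

theorem affine (hF : IsFinslerStructure F) (hS : UniqueDiffOn ℝ S) (h : IsRegularGeodesic F γ S)
    {a : ℝ} (ha : 0 < a) (b : ℝ) (hS' : UniqueDiffOn ℝ ((fun s => a * s + b) ⁻¹' S)) :
    IsRegularGeodesic F (fun s => γ (a * s + b)) ((fun s => a * s + b) ⁻¹' S) := by
  have hsm : ContMDiff 𝓘(ℝ, ℝ) 𝓘(ℝ, ℝ) ∞ fun s : ℝ => a * s + b := by
    rw [contMDiff_iff_contDiff]
    fun_prop
  exact of_geodRep hF hS' (h.isGeodesicOn.1.comp hsm.contMDiffOn (mapsTo_preimage _ _))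
    fun t ht => ⟨γ (a * t + b), _, _, (h.geodRep hF hS (t := a * t + b) ht
      (mem_extChartAt_source _)).affine hF ha rfl⟩

theorem velocity_affine (hF : IsFinslerStructure F) (hS : UniqueDiffOn ℝ S)
    (h : IsRegularGeodesic F γ S) {a : ℝ} (ha : 0 < a) (b : ℝ)
    (hS' : UniqueDiffOn ℝ ((fun s => a * s + b) ⁻¹' S)) (ht : a * t + b ∈ S) :
    velocity (n := n) (fun s => γ (a * s + b)) ((fun s => a * s + b) ⁻¹' S) t =
      ⟨γ (a * t + b), a • (velocity (n := n) γ S (a * t + b)).2⟩ := by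
  have hr := h.geodRep hF hS ht (mem_extChartAt_source (γ (a * t + b)))
  rw [(hr.affine hF ha rfl).velocity_eq hS', tangentOfChart_smul_eq _ (hr.velocity_eq hS).symm]
  rfl

end IsRegularGeodesic

end Geodesics

/-! ### Uniqueness of geodesics -/

section LocalUniqueness

variable {E : Type*} [NormedAddCommGroup E] [NormedSpace ℝ E] {X : E → E} {f g : ℝ → E} {t : ℝ}

/-- A one-sided version of local uniqueness, so that continuation can also start at the left end
point of a closed interval. -/
theorem eventuallyEq_of_solutions_right (hX : ContDiffAt ℝ 1 X (f t))
    (hf : ∀ᶠ s in 𝓝[≥] t, HasDerivWithinAt f (X (f s)) (Ici s) s)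
    (hg : ∀ᶠ s in 𝓝[≥] t, HasDerivWithinAt g (X (g s)) (Ici s) s)
    (hf' : ∀ᶠ s in 𝓝[≥] t, ContinuousWithinAt f (Ici t) s)
    (hg' : ∀ᶠ s in 𝓝[≥] t, ContinuousWithinAt g (Ici t) s)
    (h0 : f t = g t) : f =ᶠ[𝓝[≥] t] g := by
  obtain ⟨K, V, hV, hK⟩ := hX.exists_lipschitzOnWith
  have hfV : ∀ᶠ s in 𝓝[≥] t, f s ∈ V :=
    (hf'.self_of_nhdsWithin (mem_Ici.2 le_rfl)).eventually_mem hV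
  have hgV : ∀ᶠ s in 𝓝[≥] t, g s ∈ V :=
    (hg'.self_of_nhdsWithin (mem_Ici.2 le_rfl)).eventually_mem (h0 ▸ hV)
  have hall := hf.and (hg.and (hf'.and (hg'.and (hfV.and hgV))))
  obtain ⟨u, hu, hsub⟩ := (mem_nhdsGE_iff_exists_Icc_subset (a := t)).1 hall
  have hu' : Icc t u ∈ 𝓝[≥] t := Icc_mem_nhdsGE hu
  filter_upwards [hu'] with s hs
  refine ODE_solution_unique_of_mem_Icc_right (v := fun _ => X) (s := fun _ => V) (fun _ _ => hK)
    (fun s hs => ((hsub hs).2.2.1).mono Icc_subset_Ici_self) (fun s hs => (hsub ⟨hs.1, hs.2.le⟩).1)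
    (fun s hs => (hsub ⟨hs.1, hs.2.le⟩).2.2.2.2.1)
    (fun s hs => ((hsub hs).2.2.2.1).mono Icc_subset_Ici_self)
    (fun s hs => (hsub ⟨hs.1, hs.2.le⟩).2.1)
    (fun s hs => (hsub ⟨hs.1, hs.2.le⟩).2.2.2.2.2) h0 hs

theorem eventuallyEq_of_solutions (hX : ContDiffAt ℝ 1 X (f t))
    (hf : ∀ᶠ s in 𝓝 t, HasDerivAt f (X (f s)) s) (hg : ∀ᶠ s in 𝓝 t, HasDerivAt g (X (g s)) s)
    (h0 : f t = g t) : f =ᶠ[𝓝 t] g := by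
  obtain ⟨K, V, hV, hK⟩ := hX.exists_lipschitzOnWith
  refine ODE_solution_unique_of_eventually (v := fun _ => X) (s := fun _ => V)
    (Eventually.of_forall fun _ => hK) (hf.and ?_) (hg.and ?_) h0
  · exact hf.self_of_nhds.continuousAt.eventually_mem hV
  · exact hg.self_of_nhds.continuousAt.eventually_mem (h0 ▸ hV)

end LocalUniqueness

/-! ### The geodesic field and the zero section -/

section GeodField

variable {n : ℕ}

/-- The geodesic vector field in coordinates. -/
def geodField (F : Vec n → Vec n → ℝ) (z : Vec n × Vec n) : Vec n × Vec n :=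
  (z.2, geodAcc F z.1 z.2)

variable {O : Set (Vec n)} {F : Vec n → Vec n → ℝ}

theorem IsLocalFinsler.contDiffOn_geodField (h : IsLocalFinsler O F) :
    ContDiffOn ℝ ∞ (geodField F) (slit O) := by
  refine contDiff_snd.contDiffOn.prodMk ?_
  rw [contDiffOn_euclidean]
  exact fun i => ContDiffOn.mul contDiffOn_const (h.smooth_spray i)

theorem IsLocalFinsler.apply_zero (h : IsLocalFinsler O F) {x : Vec n} (hx : x ∈ O) : F x 0 = 0 := by
  have := h.homog x hx 0 2 two_pos
  rw [smul_zero] at this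
  linarith

theorem IsLocalFinsler.apply_ne_zero (h : IsLocalFinsler O F) {x v : Vec n} (hx : x ∈ O)
    (hv : v ≠ 0) : F x v ≠ 0 := fun h0 => by
  have h1 := (gMatrix_posDef_iff h.smooth h.isOpen hx hv).1 (h.posDef x hx v hv) v hv
  rw [gForm, h.sum_sum_gLow_mul hx hv, energy, h0] at h1
  norm_num at h1

/-- F is not assumed smooth at the zero section. Homogeneity and compactness of the unit sphere
bundle over a small ball give |F(x, v)| ≤ C‖v‖, which suffices for continuity there. -/
theorem IsLocalFinsler.continuousAt (h : IsLocalFinsler O F) {x : Vec n} (hx : x ∈ O) (v : Vec n) :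
    ContinuousAt (fun z : Vec n × Vec n => F z.1 z.2) (x, v) := by
  by_cases hv : v = 0
  · subst hv
    obtain ⟨r, hr, hball⟩ := Metric.nhds_basis_closedBall.mem_iff.1 (h.isOpen.mem_nhds hx)
    have hK : IsCompact (Metric.closedBall x r ×ˢ Metric.sphere (0 : Vec n) 1) :=
      (isCompact_closedBall x r).prod (isCompact_sphere 0 1)
    obtain ⟨C, hC⟩ := hK.exists_bound_of_continuousOn (f := fun z : Vec n × Vec n => F z.1 z.2)
      (h.smooth.continuousOn.mono fun z hz => ⟨hball hz.1, fun h0 => by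
        have := hz.2
        rw [mem_singleton_iff.1 h0] at this
        simp at this⟩)
    have hbound : ∀ z : Vec n × Vec n, z.1 ∈ Metric.closedBall x r →
        ‖F z.1 z.2‖ ≤ C * ‖z.2‖ := fun z hz => by
      by_cases h0 : z.2 = 0
      · rw [h0, h.apply_zero (hball hz)]
        simp
      · have hpos : 0 < ‖z.2‖ := norm_pos_iff.2 h0
        have h1 := h.homog z.1 (hball hz) (‖z.2‖⁻¹ • z.2) ‖z.2‖ hpos
        rw [smul_inv_smul₀ hpos.ne'] at h1
        rw [h1, norm_mul, norm_norm, mul_comm]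
        refine mul_le_mul_of_nonneg_right (hC (z.1, ‖z.2‖⁻¹ • z.2) ⟨hz, ?_⟩) hpos.le
        rw [mem_sphere_zero_iff_norm, norm_smul, norm_inv, norm_norm, inv_mul_cancel₀ hpos.ne']
    rw [ContinuousAt, h.apply_zero hx]
    refine squeeze_zero_norm' (a := fun z => C * ‖z.2‖) ?_ ?_
    · have : ∀ᶠ z : Vec n × Vec n in 𝓝 (x, 0), z.1 ∈ Metric.closedBall x r :=
        continuousAt_fst.eventually_mem (Metric.closedBall_mem_nhds x hr)
      filter_upwards [this] with z hz using hbound z hz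
    · have : Continuous fun z : Vec n × Vec n => C * ‖z.2‖ := by fun_prop
      simpa using this.tendsto (x, 0)
  · exact (h.smooth.contDiffAt h.isOpen hx hv).continuousAt

end GeodField

/-! ### Constant speed and uniqueness on manifolds -/

section Uniqueness

variable {n : ℕ} {M : Type*} [TopologicalSpace M] [ChartedSpace (EuclideanSpace ℝ (Fin n)) M]
  [IsManifold (𝓡 n) ∞ M] {F : TangentBundle (𝓡 n) M → ℝ} {γ : ℝ → M} {S : Set ℝ} {t : ℝ} {p : M}

theorem IsFinslerStructure.apply_eq_zero_iff (hF : IsFinslerStructure F) {V : TangentBundle (𝓡 n) M} :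
    F V = 0 ↔ V.2 = 0 := by
  have h := isLocalFinsler_inChart hF V.1
  have hV : ∀ v : Vec n, F ⟨V.1, v⟩ = inChart F V.1 (extChartAt (𝓡 n) V.1 V.1) v :=
    fun v => (inChart_self F V.1 v).symm
  constructor
  · intro h0
    by_contra hne
    refine h.apply_ne_zero (mem_extChartAt_target V.1) hne ?_
    exact (hV _).symm.trans h0
  · intro h0
    have : F V = inChart F V.1 (extChartAt (𝓡 n) V.1 V.1) V.2 := hV _
    rw [this, h0]
    exact h.apply_zero (mem_extChartAt_target V.1)

theorem continuousWithinAt_speed (hF : IsFinslerStructure F) (hS : UniqueDiffOn ℝ S)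
    (hγ : ContMDiffOn 𝓘(ℝ, ℝ) (𝓡 n) ∞ γ S) (ht : t ∈ S) :
    ContinuousWithinAt (fun s => F (velocity γ S s)) S t := by
  have hp := mem_extChartAt_source (I := 𝓡 n) (γ t)
  have h1 : ContinuousWithinAt (fun s => inChart F (γ t) (extChartAt (𝓡 n) (γ t) (γ s))
      (derivWithin (fun s => extChartAt (𝓡 n) (γ t) (γ s)) S s)) S t :=
    ContinuousAt.comp_continuousWithinAt
      (f := fun s => (extChartAt (𝓡 n) (γ t) (γ s),
        derivWithin (fun s => extChartAt (𝓡 n) (γ t) (γ s)) S s))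
      ((isLocalFinsler_inChart hF (γ t)).continuousAt (mem_extChartAt_target (γ t)) _)
      ((contDiffWithinAt_chart hγ ht hp).continuousWithinAt.prodMk
        (differentiableWithinAt_derivWithin_chart hS hγ ht hp).continuousWithinAt)
  have h2 : ∀ s ∈ S, γ s ∈ (extChartAt (𝓡 n) (γ t)).source → F (velocity γ S s) =
      inChart F (γ t) (extChartAt (𝓡 n) (γ t) (γ s))
        (derivWithin (fun s => extChartAt (𝓡 n) (γ t) (γ s)) S s) := fun s hs hsp => by
    rw [velocity_chart hS hγ hs hsp, inChart_def]
  refine h1.congr_of_eventuallyEq ?_ (h2 t ht hp)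
  filter_upwards [eventually_mem_source hγ ht hp, self_mem_nhdsWithin] with s h1 h3
    using h2 s h3 h1

/-- Geodesics have constant speed. -/
theorem IsGeodesicOn.speed_eq (hF : IsFinslerStructure F) (hS : UniqueDiffOn ℝ S)
    (h : IsGeodesicOn F γ S) {a b : ℝ} (hab : Icc a b ⊆ S) (ha : (velocity (n := n) γ S a).2 ≠ 0) :
    ∀ t ∈ Icc a b, F (velocity γ S t) = F (velocity γ S a) := by
  have hcont : ContinuousOn (fun s => F (velocity γ S s)) (Icc a b) := fun s hs =>
    (continuousWithinAt_speed hF hS h.1 (hab hs)).mono hab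
  have hpos : F (velocity γ S a) ≠ 0 := fun h0 => ha (hF.apply_eq_zero_iff.1 h0)
  -- Conservation of energy is available only where the velocity is nonzero. The set of times with
  -- the initial speed is closed by continuity; near such a time the velocity does not vanish, so
  -- the set extends to the right.
  refine IsClosed.Icc_subset_of_forall_exists_gt
    (s := {t | F (velocity γ S t) = F (velocity γ S a)}) ?_ rfl ?_
  · have := hcont.preimage_isClosed_of_isClosed isClosed_Icc (isClosed_singleton
      (x := F (velocity γ S a)))
    rwa [inter_comm]
  · rintro x ⟨hx, hxab⟩ y hy
    have hne : ∀ᶠ s in 𝓝[Icc a b] x, F (velocity γ S s) ≠ 0 :=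
      (hcont x ⟨hxab.1, hxab.2.le⟩).eventually_ne (ne_of_eq_of_ne hx hpos)
    have hle : 𝓝[≥] x ≤ 𝓝[Icc a b] x := by
      rw [← nhdsWithin_Icc_eq_nhdsGE hxab.2]
      exact nhdsWithin_mono _ (Icc_subset_Icc_left hxab.1)
    have hne' := hne.filter_mono hle
    have hy' : ∀ᶠ s in 𝓝[≥] x, s < min y b :=
      eventually_nhdsWithin_of_eventually_nhds (eventually_lt_nhds (lt_min hy hxab.2))
    obtain ⟨u, hu, hsub⟩ := (mem_nhdsGE_iff_exists_Icc_subset (a := x)).1 (hne'.and hy')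
    have hsubS : Icc x u ⊆ S := fun s hs =>
      hab ⟨hxab.1.trans hs.1, ((hsub hs).2.trans_le (min_le_right _ _)).le⟩
    have hd : ∀ s ∈ Icc x u, HasDerivWithinAt (fun s => F (velocity γ S s) ^ 2) 0 (Icc x u) s :=
      fun s hs => ((h.geodRep hF hS (hsubS hs)
        (fun h0 => (hsub hs).1 (hF.apply_eq_zero_iff.2 h0))
        (mem_extChartAt_source _)).hasDerivWithinAt_speed hF hS).mono hsubS
    have hconst := constant_of_derivWithin_zero (fun s hs => (hd s hs).differentiableWithinAt)
      (fun s hs => (hd s ⟨hs.1, hs.2.le⟩).derivWithin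
        (uniqueDiffOn_Icc hu s ⟨hs.1, hs.2.le⟩)) u ⟨hu.le, le_rfl⟩
    refine ⟨u, ?_, hu, ((hsub ⟨hu.le, le_rfl⟩).2.trans_le (min_le_left _ _)).le⟩
    have h2 := (sq_eq_sq₀ (hF.nonneg _) (hF.nonneg _)).1 hconst
    exact h2.trans hx

/-- Constancy of speed propagates a nonzero initial velocity, keeping the curve away from the zero
section, where the geodesic field lacks regularity. -/
theorem IsGeodesicOn.isRegularGeodesic (hF : IsFinslerStructure F) (hS : UniqueDiffOn ℝ S)
    (h : IsGeodesicOn F γ S) (hS' : S.OrdConnected) {a : ℝ} (ha : a ∈ S) (haS : S ⊆ Ici a)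
    (h0 : (velocity (n := n) γ S a).2 ≠ 0) : IsRegularGeodesic F γ S := by
  refine ⟨h, fun t ht h1 => h0 ?_⟩
  have := h.speed_eq hF hS (hS'.out ha ht) h0 t ⟨haS ht, le_rfl⟩
  rw [← hF.apply_eq_zero_iff, ← this, hF.apply_eq_zero_iff]
  exact h1

namespace IsRegularGeodesic

theorem hasDerivWithinAt_geodField (hF : IsFinslerStructure F) (hS : UniqueDiffOn ℝ S)
    (h : IsRegularGeodesic F γ S) (ht : t ∈ S) (hp : γ t ∈ (extChartAt (𝓡 n) p).source) :
    HasDerivWithinAt (fun s => (extChartAt (𝓡 n) p (γ s),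
        derivWithin (fun s => extChartAt (𝓡 n) p (γ s)) S s))
      (geodField (inChart F p) (extChartAt (𝓡 n) p (γ t),
        derivWithin (fun s => extChartAt (𝓡 n) p (γ s)) S t)) S t :=
  (h.geodRep hF hS ht hp).hasDerivWithinAt.prodMk (h.geodRep hF hS ht hp).acc

theorem mem_slit (hF : IsFinslerStructure F) (hS : UniqueDiffOn ℝ S)
    (h : IsRegularGeodesic F γ S) (ht : t ∈ S) (hp : γ t ∈ (extChartAt (𝓡 n) p).source) :
    (extChartAt (𝓡 n) p (γ t), derivWithin (fun s => extChartAt (𝓡 n) p (γ s)) S t) ∈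
      slit (extChartAt (𝓡 n) p).target :=
  ⟨(h.geodRep hF hS ht hp).mem_target, (h.geodRep hF hS ht hp).ne_zero⟩

theorem contDiffAt_geodField (hF : IsFinslerStructure F) {z : Vec n × Vec n}
    (hz : z ∈ slit (extChartAt (𝓡 n) p).target) : ContDiffAt ℝ 1 (geodField (inChart F p)) z :=
  (((isLocalFinsler_inChart hF p).contDiffOn_geodField).contDiffAt
    ((isOpen_slit (isOpen_target p)).mem_nhds hz)).of_le (by simp)

/-- Geodesics are determined by their initial velocity. -/
theorem eqOn [T2Space M] (hF : IsFinslerStructure F) {a b : ℝ} (hab : a < b) {γ₁ γ₂ : ℝ → M}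
    (h₁ : IsRegularGeodesic F γ₁ (Icc a b)) (h₂ : IsRegularGeodesic F γ₂ (Icc a b))
    (h0 : velocity (n := n) γ₁ (Icc a b) a = velocity γ₂ (Icc a b) a) :
    ∀ t ∈ Icc a b, velocity (n := n) γ₁ (Icc a b) t = velocity γ₂ (Icc a b) t := by
  have hS := uniqueDiffOn_Icc hab
  -- Times at which the velocities agree form a closed set, the limit points on M being identified
  -- by the Hausdorff property. Local uniqueness in a chart extends the set to the right.
  refine IsClosed.Icc_subset_of_forall_exists_gt
    (s := {t | velocity (n := n) γ₁ (Icc a b) t = velocity γ₂ (Icc a b) t}) ?_ h0 ?_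
  · rw [isClosed_iff_frequently]
    intro t ht
    have htab : t ∈ Icc a b := isClosed_iff_frequently.1 isClosed_Icc t
      (ht.mono fun s hs => hs.2)
    have ht' : ∃ᶠ s in 𝓝[Icc a b] t, velocity (n := n) γ₁ (Icc a b) s =
        velocity γ₂ (Icc a b) s := by
      rw [frequently_nhdsWithin_iff]
      exact ht
    have heq : γ₁ t = γ₂ t := tendsto_nhds_unique_of_frequently_eq
      (h₁.isGeodesicOn.1 t htab).continuousWithinAt (h₂.isGeodesicOn.1 t htab).continuousWithinAt
      (ht'.mono fun s hs => congrArg Bundle.TotalSpace.proj hs)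
    have hp₁ := mem_extChartAt_source (I := 𝓡 n) (γ₁ t)
    have hp₂ := hp₁
    nth_rewrite 2 [heq] at hp₂
    have hc₁ := (h₁.hasDerivWithinAt_geodField hF hS htab hp₁).continuousWithinAt
    have hc₂ := (h₂.hasDerivWithinAt_geodField hF hS htab hp₂).continuousWithinAt
    have h3 := tendsto_nhds_unique_of_frequently_eq hc₁ hc₂ (by
      refine (ht'.and_eventually ((eventually_mem_source h₁.isGeodesicOn.1 htab hp₁).and
        ((eventually_mem_source h₂.isGeodesicOn.1 htab hp₂).and self_mem_nhdsWithin))).mono ?_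
      rintro s ⟨hs, hs₁, hs₂, hsS⟩
      rw [velocity_chart hS h₁.isGeodesicOn.1 hsS hs₁,
        velocity_chart hS h₂.isGeodesicOn.1 hsS hs₂] at hs
      have := tangentOfChart_injective _ ((extChartAt (𝓡 n) _).map_source hs₁)
        ((extChartAt (𝓡 n) _).map_source hs₂) hs
      exact Prod.ext this.1 this.2)
    refine ⟨?_, htab⟩
    rw [Set.mem_ofPred_eq, velocity_chart hS h₁.isGeodesicOn.1 htab hp₁,
      velocity_chart hS h₂.isGeodesicOn.1 htab hp₂]
    have h4 := Prod.ext_iff.1 h3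
    simp only at h4
    rw [h4.1, h4.2]
  · rintro x ⟨hx, hxab⟩ y hy
    have hxI : x ∈ Icc a b := ⟨hxab.1, hxab.2.le⟩
    have heq : γ₁ x = γ₂ x := congrArg Bundle.TotalSpace.proj hx
    have hp₁ := mem_extChartAt_source (I := 𝓡 n) (γ₁ x)
    have hp₂ := hp₁
    nth_rewrite 2 [heq] at hp₂
    have hle : 𝓝[≥] x ≤ 𝓝[Icc a b] x := by
      rw [← nhdsWithin_Icc_eq_nhdsGE hxab.2]
      exact nhdsWithin_mono _ (Icc_subset_Icc_left hxab.1)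
    have hxb : ∀ᶠ s in 𝓝[≥] x, x ≤ s ∧ s < b := by
      filter_upwards [self_mem_nhdsWithin,
        eventually_nhdsWithin_of_eventually_nhds (eventually_lt_nhds hxab.2)] with s h1 h2
        using ⟨h1, h2⟩
    have hsol : ∀ {γ : ℝ → M}, IsRegularGeodesic F γ (Icc a b) →
        γ x ∈ (extChartAt (𝓡 n) (γ₁ x)).source →
        ∀ᶠ s in 𝓝[≥] x, HasDerivWithinAt (fun s => (extChartAt (𝓡 n) (γ₁ x) (γ s),
          derivWithin (fun s => extChartAt (𝓡 n) (γ₁ x) (γ s)) (Icc a b) s))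
          (geodField (inChart F (γ₁ x)) (extChartAt (𝓡 n) (γ₁ x) (γ s),
          derivWithin (fun s => extChartAt (𝓡 n) (γ₁ x) (γ s)) (Icc a b) s)) (Ici s) s ∧
          ContinuousWithinAt (fun s => (extChartAt (𝓡 n) (γ₁ x) (γ s),
          derivWithin (fun s => extChartAt (𝓡 n) (γ₁ x) (γ s)) (Icc a b) s)) (Ici x) s := by
      intro γ hγ hp
      filter_upwards [(eventually_mem_source hγ.isGeodesicOn.1 hxI hp).filter_mono hle, hxb]
        with s hs hsb
      have h4 := hγ.hasDerivWithinAt_geodField hF hS ⟨hxab.1.trans hsb.1, hsb.2.le⟩ hs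
      constructor
      · refine h4.mono_of_mem_nhdsWithin ?_
        exact mem_of_superset (Icc_mem_nhdsGE hsb.2)
          (Icc_subset_Icc_left (hxab.1.trans hsb.1))
      · refine h4.continuousWithinAt.mono_of_mem_nhdsWithin ?_
        rw [mem_nhdsWithin_iff_eventually]
        filter_upwards [eventually_lt_nhds hsb.2] with r hr hxr
        exact ⟨hxab.1.trans hxr, hr.le⟩
    have hz : (extChartAt (𝓡 n) (γ₁ x) (γ₁ x),
        derivWithin (fun s => extChartAt (𝓡 n) (γ₁ x) (γ₁ s)) (Icc a b) x) =
        (extChartAt (𝓡 n) (γ₁ x) (γ₂ x),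
        derivWithin (fun s => extChartAt (𝓡 n) (γ₁ x) (γ₂ s)) (Icc a b) x) := by
      have h5 : velocity (n := n) γ₁ (Icc a b) x = velocity γ₂ (Icc a b) x := hx
      rw [velocity_chart hS h₁.isGeodesicOn.1 hxI hp₁,
        velocity_chart hS h₂.isGeodesicOn.1 hxI hp₂] at h5
      have := tangentOfChart_injective _ ((extChartAt (𝓡 n) _).map_source hp₁)
        ((extChartAt (𝓡 n) _).map_source hp₂) h5
      exact Prod.ext this.1 this.2
    have huniq := eventuallyEq_of_solutions_right (X := geodField (inChart F (γ₁ x)))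
      (contDiffAt_geodField hF (h₁.mem_slit hF hS hxI hp₁))
      ((hsol h₁ hp₁).mono fun s hs => hs.1) ((hsol h₂ hp₂).mono fun s hs => hs.1)
      ((hsol h₁ hp₁).mono fun s hs => hs.2) ((hsol h₂ hp₂).mono fun s hs => hs.2) hz
    have hfin := huniq.and (((eventually_mem_source h₁.isGeodesicOn.1 hxI hp₁).filter_mono hle).and
      (((eventually_mem_source h₂.isGeodesicOn.1 hxI hp₂).filter_mono hle).and
        (eventually_nhdsWithin_of_eventually_nhds (eventually_lt_nhds (lt_min hy hxab.2)))))
    obtain ⟨u, hu, hsub⟩ := (mem_nhdsGE_iff_exists_Icc_subset (a := x)).1 hfin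
    obtain ⟨h6, h7, h8, h9⟩ := hsub ⟨hu.le, le_rfl⟩
    have huI : u ∈ Icc a b := ⟨hxab.1.trans hu.le, (h9.trans_le (min_le_right _ _)).le⟩
    refine ⟨u, ?_, hu, (h9.trans_le (min_le_left _ _)).le⟩
    rw [Set.mem_ofPred_eq, velocity_chart hS h₁.isGeodesicOn.1 huI h7,
      velocity_chart hS h₂.isGeodesicOn.1 huI h8]
    have h10 := Prod.ext_iff.1 h6
    simp only at h10
    rw [h10.1, h10.2]

/-- Local two-sided uniqueness of geodesics. -/
theorem eventuallyEq (hF : IsFinslerStructure F) {S₁ S₂ : Set ℝ} (hS₁ : IsOpen S₁)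
    (hS₂ : IsOpen S₂) {γ₁ γ₂ : ℝ → M} (h₁ : IsRegularGeodesic F γ₁ S₁)
    (h₂ : IsRegularGeodesic F γ₂ S₂) (ht₁ : t ∈ S₁) (ht₂ : t ∈ S₂)
    (h0 : velocity (n := n) γ₁ S₁ t = velocity γ₂ S₂ t) : γ₁ =ᶠ[𝓝 t] γ₂ := by
  have heq : γ₁ t = γ₂ t := congrArg Bundle.TotalSpace.proj h0
  have hp₁ := mem_extChartAt_source (I := 𝓡 n) (γ₁ t)
  have hp₂ := hp₁
  nth_rewrite 2 [heq] at hp₂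
  have he₁ := eventually_mem_source h₁.isGeodesicOn.1 ht₁ hp₁
  have he₂ := eventually_mem_source h₂.isGeodesicOn.1 ht₂ hp₂
  rw [hS₁.nhdsWithin_eq ht₁] at he₁
  rw [hS₂.nhdsWithin_eq ht₂] at he₂
  have h5 := h0
  rw [velocity_chart hS₁.uniqueDiffOn h₁.isGeodesicOn.1 ht₁ hp₁,
    velocity_chart hS₂.uniqueDiffOn h₂.isGeodesicOn.1 ht₂ hp₂] at h5
  have h6 := tangentOfChart_injective _ ((extChartAt (𝓡 n) _).map_source hp₁)
    ((extChartAt (𝓡 n) _).map_source hp₂) h5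
  have := eventuallyEq_of_solutions (X := geodField (inChart F (γ₁ t)))
    (f := fun s => (extChartAt (𝓡 n) (γ₁ t) (γ₁ s),
      derivWithin (fun s => extChartAt (𝓡 n) (γ₁ t) (γ₁ s)) S₁ s))
    (g := fun s => (extChartAt (𝓡 n) (γ₁ t) (γ₂ s),
      derivWithin (fun s => extChartAt (𝓡 n) (γ₁ t) (γ₂ s)) S₂ s))
    (contDiffAt_geodField hF (h₁.mem_slit hF hS₁.uniqueDiffOn ht₁ hp₁))
    (by
      filter_upwards [he₁, hS₁.mem_nhds ht₁] with s hs hsS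
      exact (h₁.hasDerivWithinAt_geodField hF hS₁.uniqueDiffOn hsS hs).hasDerivAt
        (hS₁.mem_nhds hsS))
    (by
      filter_upwards [he₂, hS₂.mem_nhds ht₂] with s hs hsS
      exact (h₂.hasDerivWithinAt_geodField hF hS₂.uniqueDiffOn hsS hs).hasDerivAt
        (hS₂.mem_nhds hsS))
    (Prod.ext h6.1 h6.2)
  filter_upwards [this, he₁, he₂] with s hs h1 h2
  exact (extChartAt (𝓡 n) (γ₁ t)).injOn h1 h2 (Prod.ext_iff.1 hs).1

end IsRegularGeodesic

end Uniqueness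

/-! ### Smooth families of geodesics -/

section FlowBox

/-- The geodesic field is smooth only over a chart and off the zero section. Multiplying by a bump
function yields a complete field without changing it near the chosen point. -/
theorem exists_cutoff {E : Type*} [NormedAddCommGroup E] [NormedSpace ℝ E]
    [FiniteDimensional ℝ E] {X : E → E} {U : Set E} (hU : IsOpen U) (hX : ContDiffOn ℝ ∞ X U)
    {z₀ : E} (hz₀ : z₀ ∈ U) : ∃ Y : E → E, ContDiff ℝ ∞ Y ∧ HasCompactSupport Y ∧
      ∃ V : Set E, IsOpen V ∧ z₀ ∈ V ∧ V ⊆ U ∧ EqOn Y X V := by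
  obtain ⟨r, hr, hball⟩ := Metric.nhds_basis_closedBall.mem_iff.1 (hU.mem_nhds hz₀)
  let χ : ContDiffBump z₀ := ⟨r / 2, r, by positivity, by linarith⟩
  refine ⟨fun z => χ z • X z, ?_, χ.hasCompactSupport.smul_right, Metric.ball z₀ (r / 2),
    Metric.isOpen_ball, Metric.mem_ball_self (by positivity), fun z hz => hball
      (Metric.ball_subset_closedBall (Metric.ball_subset_ball (by linarith) hz)), fun z hz => ?_⟩
  · rw [contDiff_iff_contDiffAt]
    intro z
    by_cases hz : z ∈ U
    · exact χ.contDiff.contDiffAt.smul (hX.contDiffAt (hU.mem_nhds hz))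
    · have : z ∉ tsupport χ := fun h => hz (hball (by rwa [χ.tsupport_eq] at h))
      have h0 := notMem_tsupport_iff_eventuallyEq.1 this
      refine (contDiffAt_const (c := (0 : E))).congr_of_eventuallyEq ?_
      filter_upwards [h0] with y hy
      rw [hy, Pi.zero_apply, zero_smul]
  · simp only
    rw [χ.one_of_mem_closedBall (Metric.ball_subset_closedBall hz), one_smul]

variable {n : ℕ} {M : Type*} [TopologicalSpace M] [ChartedSpace (EuclideanSpace ℝ (Fin n)) M]
  [IsManifold (𝓡 n) ∞ M] {F : TangentBundle (𝓡 n) M → ℝ}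

/-- Continuity of the cut-off flow gives one time r for which all orbits starting in W stay where
the field is unmodified, so their projections are geodesics. Smoothness in both variables is that of
the flow. -/
theorem exists_flowBox (hF : IsFinslerStructure F) {p : M} {z₀ : Vec n × Vec n}
    (hz₀ : z₀ ∈ slit (extChartAt (𝓡 n) p).target) :
    ∃ W : Set (Vec n × Vec n), IsOpen W ∧ z₀ ∈ W ∧ W ⊆ slit (extChartAt (𝓡 n) p).target ∧
      ∃ r > 0, ∃ Ψ : Vec n × Vec n → ℝ → M,
        ContMDiffOn 𝓘(ℝ, (Vec n × Vec n) × ℝ) (𝓡 n) ∞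
          (fun q : (Vec n × Vec n) × ℝ => Ψ q.1 q.2) (W ×ˢ Ioo (-r) r) ∧
        ∀ z ∈ W, IsRegularGeodesic F (Ψ z) (Ioo (-r) r) ∧
          velocity (Ψ z) (Ioo (-r) r) 0 = tangentOfChart p z.1 z.2 := by
  obtain ⟨Y, hY, hYc, V, hV, hz₀V, hVU, hYX⟩ := exists_cutoff (isOpen_slit (isOpen_target p))
    (isLocalFinsler_inChart hF p).contDiffOn_geodField hz₀
  obtain ⟨Φ, hΦ⟩ := exists_isFlowOf hY hYc
  have hΦs := hΦ.contDiff hY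
  have hG : (fun q : ℝ × (Vec n × Vec n) => Φ q.1 q.2) ⁻¹' V ∈ 𝓝 ((0 : ℝ), z₀) :=
    hΦs.continuous.continuousAt.preimage_mem_nhds (hV.mem_nhds (by rw [hΦ.zero]; exact hz₀V))
  obtain ⟨A, hA, B, hB, hAB⟩ := mem_nhds_prod_iff.1 hG
  obtain ⟨r, hr, hrA⟩ := Metric.mem_nhds_iff.1 hA
  obtain ⟨W, hWB, hW, hzW⟩ := mem_nhds_iff.1 (inter_mem hB (hV.mem_nhds hz₀V))
  rw [Real.ball_eq_Ioo, zero_sub, zero_add] at hrA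
  have hmem : ∀ z ∈ W, ∀ t ∈ Ioo (-r) r, Φ t z ∈ V := fun z hz t ht =>
    hAB (mk_mem_prod (hrA ht) (hWB hz).1)
  have h0r : (0 : ℝ) ∈ Ioo (-r) r := ⟨by linarith, hr⟩
  have hsm : ContMDiffOn 𝓘(ℝ, (Vec n × Vec n) × ℝ) (𝓡 n) ∞
      (fun q : (Vec n × Vec n) × ℝ => (extChartAt (𝓡 n) p).symm (Φ q.2 q.1).1)
      (W ×ˢ Ioo (-r) r) := by
    have h1 : ContDiff ℝ ∞ fun q : (Vec n × Vec n) × ℝ => (Φ q.2 q.1).1 :=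
      contDiff_fst.comp (hΦs.comp (contDiff_snd.prodMk contDiff_fst))
    exact (contMDiffOn_extChartAt_symm p).comp h1.contMDiff.contMDiffOn fun q hq =>
      (hVU (hmem q.1 hq.1 q.2 hq.2)).1
  have hrep : ∀ z ∈ W, ∀ t ∈ Ioo (-r) r, GeodRep F
      (fun t => (extChartAt (𝓡 n) p).symm (Φ t z).1) (Ioo (-r) r) t p
      (fun t => (Φ t z).1) (fun t => (Φ t z).2) := fun z hz t ht => by
    have hd : ∀ s ∈ Ioo (-r) r, HasDerivAt (fun s => Φ s z)
        (geodField (inChart F p) (Φ s z)) s := fun s hs => by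
      rw [← hYX (hmem z hz s hs)]
      exact hΦ.deriv z s
    refine ⟨ht, ?_, (hVU (hmem z hz t ht)).2, ?_, ?_⟩
    · filter_upwards [self_mem_nhdsWithin] with s hs using ⟨(hVU (hmem z hz s hs)).1, rfl⟩
    · filter_upwards [self_mem_nhdsWithin] with s hs
      exact (hasFDerivAt_fst.comp_hasDerivAt s (hd s hs)).hasDerivWithinAt
    · exact (hasFDerivAt_snd.comp_hasDerivAt t (hd t ht)).hasDerivWithinAt
  have hopen : IsOpen (Ioo (-r) r) := isOpen_Ioo
  refine ⟨W, hW, hzW, fun z hz => hVU (hWB hz).2, r, hr,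
    fun z t => (extChartAt (𝓡 n) p).symm (Φ t z).1, hsm, fun z hz => ⟨?_, ?_⟩⟩
  · refine IsRegularGeodesic.of_geodRep hF hopen.uniqueDiffOn ?_
      fun t ht => ⟨p, _, _, hrep z hz t ht⟩
    have hin : ContMDiff 𝓘(ℝ, ℝ) 𝓘(ℝ, (Vec n × Vec n) × ℝ) ∞ fun t : ℝ => (z, t) := by
      rw [contMDiff_iff_contDiff]
      fun_prop
    exact hsm.comp hin.contMDiffOn fun t ht => mk_mem_prod hz ht
  · rw [(hrep z hz 0 h0r).velocity_eq hopen.uniqueDiffOn]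
    simp only [hΦ.zero]

end FlowBox

/-! ### Chaining flow boxes along a geodesic -/

section Families

variable {n : ℕ} {M : Type*} [TopologicalSpace M] [ChartedSpace (EuclideanSpace ℝ (Fin n)) M]
  [IsManifold (𝓡 n) ∞ M] {F : TangentBundle (𝓡 n) M → ℝ}

theorem GeodRep.of_nhds {γ : ℝ → M} {S S' : Set ℝ} {t : ℝ} {p : M} {y w : ℝ → Vec n}
    (h : GeodRep F γ S t p y w) (hS : S ∈ 𝓝 t) (hS' : S' ∈ 𝓝 t) : GeodRep F γ S' t p y w := by
  have e1 : 𝓝[S] t = 𝓝 t := nhdsWithin_eq_nhds.2 hS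
  have e2 : 𝓝[S'] t = 𝓝 t := nhdsWithin_eq_nhds.2 hS'
  refine ⟨mem_of_mem_nhds hS', ?_, h.ne_zero, ?_, (h.acc.hasDerivAt hS).hasDerivWithinAt⟩
  · rw [e2, ← e1]
    exact h.rep
  · have := h.deriv
    rw [e1] at this
    rw [e2]
    filter_upwards [this, eventually_mem_nhds_iff.2 hS] with s h1 h2
      using (h1.hasDerivAt h2).hasDerivWithinAt

/-- A smooth family of curves in a chart. -/
theorem contDiffOn_chart_family {Γ : Vec n → ℝ → M} {D : Set (Vec n × ℝ)} (hD : IsOpen D)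
    (hΓ : ContMDiffOn 𝓘(ℝ, Vec n × ℝ) (𝓡 n) ∞ (fun q : Vec n × ℝ => Γ q.1 q.2) D) (p : M) :
    IsOpen (D ∩ (fun q : Vec n × ℝ => Γ q.1 q.2) ⁻¹' (extChartAt (𝓡 n) p).source) ∧
    ContDiffOn ℝ ∞ (fun q : Vec n × ℝ => extChartAt (𝓡 n) p (Γ q.1 q.2))
      (D ∩ (fun q : Vec n × ℝ => Γ q.1 q.2) ⁻¹' (extChartAt (𝓡 n) p).source) := by
  refine ⟨hΓ.continuousOn.isOpen_inter_preimage hD (isOpen_extChartAt_source p), ?_⟩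
  have h1 : ContMDiffOn (𝓡 n) 𝓘(ℝ, Vec n) ∞ (extChartAt (𝓡 n) p) (extChartAt (𝓡 n) p).source := by
    rw [extChartAt_source]
    exact contMDiffOn_extChartAt
  exact (h1.comp (hΓ.mono inter_subset_left) fun q hq => hq.2).contDiffOn

theorem hasDerivAt_family_right {C : Vec n × ℝ → Vec n} {N : Set (Vec n × ℝ)} (hN : IsOpen N)
    (hC : ContDiffOn ℝ ∞ C N) {w : Vec n} {s : ℝ} (h : (w, s) ∈ N) :
    HasDerivAt (fun s => C (w, s)) (fderiv ℝ C (w, s) (0, 1)) s := by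
  have h1 := ((hC.contDiffAt (hN.mem_nhds h)).differentiableAt (by simp)).hasFDerivAt
  exact h1.comp_hasDerivAt s ((hasDerivAt_const s w).prodMk (hasDerivAt_id s))

/-- There is a smooth family of geodesics starting at `x` with velocities close to `v`, defined
on a neighbourhood of `[0, T]`. -/
def HasGeodFamily (F : TangentBundle (𝓡 n) M → ℝ) (x : M) (v : Vec n) (T : ℝ) : Prop :=
  ∃ U : Set (Vec n), IsOpen U ∧ v ∈ U ∧ ∃ δ > 0, ∃ Γ : Vec n → ℝ → M,
    ContMDiffOn 𝓘(ℝ, Vec n × ℝ) (𝓡 n) ∞ (fun q : Vec n × ℝ => Γ q.1 q.2)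
      (U ×ˢ Ioo (-δ) (T + δ)) ∧
    ∀ w ∈ U, IsRegularGeodesic F (Γ w) (Ioo (-δ) (T + δ)) ∧
      velocity (Γ w) (Ioo (-δ) (T + δ)) 0 = ⟨x, w⟩

theorem HasGeodFamily.mono (hF : IsFinslerStructure F) {x : M} {v : Vec n} {T T' : ℝ}
    (h : HasGeodFamily F x v T) (hT' : 0 ≤ T') (hTT' : T' ≤ T) : HasGeodFamily F x v T' := by
  obtain ⟨U, hU, hv, δ, hδ, Γ, hΓ, hgeo⟩ := h
  have hsub : Ioo (-δ) (T' + δ) ⊆ Ioo (-δ) (T + δ) := Ioo_subset_Ioo_right (by linarith)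
  refine ⟨U, hU, hv, δ, hδ, Γ, hΓ.mono (prod_mono_right hsub), fun w hw => ?_⟩
  obtain ⟨h1, h2⟩ := hgeo w hw
  refine ⟨h1.mono hF isOpen_Ioo.uniqueDiffOn isOpen_Ioo.uniqueDiffOn hsub, ?_⟩
  rw [h1.velocity_mono hF isOpen_Ioo.uniqueDiffOn isOpen_Ioo.uniqueDiffOn hsub
    ⟨by linarith, by linarith⟩, h2]

theorem hasGeodFamily_zero (hF : IsFinslerStructure F) (x : M) {v : Vec n} (hv : v ≠ 0) :
    HasGeodFamily F x v 0 := by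
  obtain ⟨W, hW, hzW, -, r, hr, Ψ, hΨ, hgeo⟩ := exists_flowBox hF (p := x)
    (z₀ := (extChartAt (𝓡 n) x x, v)) ⟨mem_extChartAt_target x, hv⟩
  have hc : Continuous fun w : Vec n => (extChartAt (𝓡 n) x x, w) := by fun_prop
  refine ⟨(fun w => (extChartAt (𝓡 n) x x, w)) ⁻¹' W, hW.preimage hc, hzW, r, hr,
    fun w => Ψ (extChartAt (𝓡 n) x x, w), ?_, fun w hw => ?_⟩
  · have hin : ContMDiff 𝓘(ℝ, Vec n × ℝ) 𝓘(ℝ, (Vec n × Vec n) × ℝ) ∞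
        fun q : Vec n × ℝ => ((extChartAt (𝓡 n) x x, q.1), q.2) := by
      rw [contMDiff_iff_contDiff]
      fun_prop
    rw [zero_add]
    exact hΨ.comp hin.contMDiffOn fun q hq => mk_mem_prod hq.1 hq.2
  · rw [zero_add]
    obtain ⟨h1, h2⟩ := hgeo _ hw
    exact ⟨h1, by rw [h2, tangentOfChart_self]⟩

theorem velocity_family_eq [T2Space M] (hF : IsFinslerStructure F) {γ γ' : ℝ → M} {b t : ℝ}
    {S : Set ℝ} (hS : IsOpen S)
    (hγ : IsRegularGeodesic F γ (Icc 0 b)) (hb : 0 < b) (hγ' : IsRegularGeodesic F γ' S)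
    (h0 : velocity (n := n) γ (Icc 0 b) 0 = velocity γ' S 0) (ht : t ∈ Icc 0 b)
    (htS : Icc 0 t ⊆ S) : velocity (n := n) γ (Icc 0 b) t = velocity γ' S t := by
  rcases ht.1.eq_or_lt with h | h
  · rw [← h]
    exact h0
  · have hsub : Icc 0 t ⊆ Icc 0 b := Icc_subset_Icc_right ht.2
    have hu := uniqueDiffOn_Icc h
    have hub := uniqueDiffOn_Icc hb
    have h0t : (0 : ℝ) ∈ Icc 0 t := ⟨le_rfl, h.le⟩
    have htt : t ∈ Icc 0 t := ⟨h.le, le_rfl⟩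
    have := (hγ.mono hF hub hu hsub).eqOn hF h (hγ'.mono hF hS.uniqueDiffOn hu htS) (by
      rw [hγ.velocity_mono hF hub hu hsub h0t, hγ'.velocity_mono hF hS.uniqueDiffOn hu htS h0t, h0])
      t htt
    rwa [hγ.velocity_mono hF hub hu hsub htt, hγ'.velocity_mono hF hS.uniqueDiffOn hu htS htt]
      at this

/-- Follow the given family up to time t, then restart in the flow box from the position and
velocity reached. Uniqueness makes both descriptions agree just after t, so they glue smoothly. -/
theorem HasGeodFamily.extend [T2Space M] (hF : IsFinslerStructure F) {x p : M} {v : Vec n}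
    {γ : ℝ → M} {b : ℝ} (hγ : IsRegularGeodesic F γ (Icc 0 b)) (hb : 0 < b)
    (h0 : velocity (n := n) γ (Icc 0 b) 0 = ⟨x, v⟩)
    {W : Set (Vec n × Vec n)} (hW : IsOpen W)
    {r : ℝ} (hr : 0 < r) {Ψ : Vec n × Vec n → ℝ → M}
    (hΨ : ContMDiffOn 𝓘(ℝ, (Vec n × Vec n) × ℝ) (𝓡 n) ∞
          (fun q : (Vec n × Vec n) × ℝ => Ψ q.1 q.2) (W ×ˢ Ioo (-r) r))
    (hΨgeo : ∀ z ∈ W, IsRegularGeodesic F (Ψ z) (Ioo (-r) r) ∧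
          velocity (Ψ z) (Ioo (-r) r) 0 = tangentOfChart p z.1 z.2)
    {t t' : ℝ} (ht : t ∈ Icc 0 b) (hpt : γ t ∈ (extChartAt (𝓡 n) p).source)
    (hzW : (extChartAt (𝓡 n) p (γ t),
      derivWithin (fun s => extChartAt (𝓡 n) p (γ s)) (Icc 0 b) t) ∈ W)
    (htt' : t ≤ t') (hrt : t' < t + r) (h : HasGeodFamily F x v t) : HasGeodFamily F x v t' := by
  obtain ⟨U, hU, hvU, δ, hδ, Γ, hΓ, hgeo⟩ := h
  have hJ : IsOpen (Ioo (-δ) (t + δ)) := isOpen_Ioo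
  have htJ : t ∈ Ioo (-δ) (t + δ) := ⟨by linarith [ht.1], by linarith⟩
  obtain ⟨hN, hC⟩ := contDiffOn_chart_family (hU.prod hJ) hΓ p
  set N := (U ×ˢ Ioo (-δ) (t + δ)) ∩
    (fun q : Vec n × ℝ => Γ q.1 q.2) ⁻¹' (extChartAt (𝓡 n) p).source with hNdef
  set C : Vec n × ℝ → Vec n := fun q => extChartAt (𝓡 n) p (Γ q.1 q.2) with hCdef
  let ζ : Vec n → Vec n × Vec n := fun w => (C (w, t), fderiv ℝ C (w, t) (0, 1))
  have hvel : velocity (n := n) γ (Icc 0 b) t = velocity (Γ v) (Ioo (-δ) (t + δ)) t :=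
    velocity_family_eq hF hJ hγ hb (hgeo v hvU).1 (h0.trans (hgeo v hvU).2.symm) ht
      fun s hs => ⟨by linarith [hs.1], by linarith [hs.2]⟩
  have hΓvel : ∀ w, (w, t) ∈ N → velocity (Γ w) (Ioo (-δ) (t + δ)) t =
      tangentOfChart p (ζ w).1 (ζ w).2 := fun w hw => by
    rw [velocity_chart hJ.uniqueDiffOn (hgeo w hw.1.1).1.isGeodesicOn.1 htJ hw.2,
      (hasDerivAt_family_right hN hC hw).hasDerivWithinAt.derivWithin (hJ.uniqueDiffOn t htJ)]
  have hvN : (v, t) ∈ N := by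
    refine ⟨⟨hvU, htJ⟩, ?_⟩
    have : γ t = Γ v t := congrArg Bundle.TotalSpace.proj hvel
    rw [mem_preimage, ← this]
    exact hpt
  have hζv : ζ v ∈ W := by
    have h1 := hΓvel v hvN
    rw [← hvel, velocity_chart (uniqueDiffOn_Icc hb) hγ.isGeodesicOn.1 ht hpt] at h1
    have h2 := tangentOfChart_injective p ((extChartAt (𝓡 n) p).map_source hpt)
      ((extChartAt (𝓡 n) p).map_source hvN.2) h1
    have h3 : ζ v = (extChartAt (𝓡 n) p (γ t),
        derivWithin (fun s => extChartAt (𝓡 n) p (γ s)) (Icc 0 b) t) :=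
      Prod.ext h2.1.symm h2.2.symm
    rw [h3]
    exact hzW
  have hin : Continuous fun w : Vec n => (w, t) := by fun_prop
  have hζ : ContDiffOn ℝ ∞ ζ ((fun w : Vec n => (w, t)) ⁻¹' N) := by
    have hinc : ContDiff ℝ ∞ fun w : Vec n => (w, t) := by fun_prop
    exact (hC.comp hinc.contDiffOn fun w hw => hw).prodMk
      (((hC.fderiv_of_isOpen hN (m := ∞) (by simp)).comp hinc.contDiffOn fun w hw => hw).clm_apply
        contDiffOn_const)
  set U' := (fun w : Vec n => (w, t)) ⁻¹' N ∩ ζ ⁻¹' W with hU'def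
  have hU' : IsOpen U' := hζ.continuousOn.isOpen_inter_preimage (hN.preimage hin) hW
  set δ' := min δ r with hδ'def
  have hδ' : 0 < δ' := lt_min hδ hr
  -- The restarted family, shifted by t; the shift is written as 1 * s + -t to match the form of the
  -- affine reparametrization results.
  let Θ : Vec n → ℝ → M := fun w s => Ψ (ζ w) (1 * s + -t)
  have hΘgeo : ∀ w ∈ U', IsRegularGeodesic F (Θ w) ((fun s => 1 * s + -t) ⁻¹' Ioo (-r) r) ∧
      velocity (Θ w) ((fun s => 1 * s + -t) ⁻¹' Ioo (-r) r) t =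
        tangentOfChart p (ζ w).1 (ζ w).2 := fun w hw => by
    have hop : IsOpen ((fun s : ℝ => 1 * s + -t) ⁻¹' Ioo (-r) r) :=
      isOpen_Ioo.preimage (by fun_prop)
    obtain ⟨h1, h2⟩ := hΨgeo (ζ w) hw.2
    refine ⟨h1.affine hF isOpen_Ioo.uniqueDiffOn one_pos _ hop.uniqueDiffOn, ?_⟩
    have h3 := h1.velocity_affine hF isOpen_Ioo.uniqueDiffOn one_pos (-t) hop.uniqueDiffOn (t := t)
      (by constructor <;> linarith)
    have e : 1 * t + -t = 0 := by ring
    rw [e] at h3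
    refine h3.trans ?_
    rw [← h2, one_smul]
    rfl
  have hagree : ∀ w ∈ U', ∀ s ∈ Ioo t (t + δ'), Γ w s = Θ w s := fun w hw s hs => by
    have hwU : w ∈ U := hw.1.1.1
    have hts := hs.1
    have h1 : Icc t s ⊆ Ioo (-δ) (t + δ) := fun u hu =>
      ⟨by linarith [hu.1, ht.1], by linarith [hu.2, hs.2, min_le_left δ r]⟩
    have h2 : Icc t s ⊆ (fun s => 1 * s + -t) ⁻¹' Ioo (-r) r := fun u hu =>
      ⟨by linarith [hu.1, ht.1], by linarith [hu.2, hs.2, min_le_right δ r]⟩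
    have hop : IsOpen ((fun s : ℝ => 1 * s + -t) ⁻¹' Ioo (-r) r) :=
      isOpen_Ioo.preimage (by fun_prop)
    have hu := uniqueDiffOn_Icc hts
    have htI : t ∈ Icc t s := ⟨le_rfl, hts.le⟩
    have := ((hgeo w hwU).1.mono hF hJ.uniqueDiffOn hu h1).eqOn hF hts
      ((hΘgeo w hw).1.mono hF hop.uniqueDiffOn hu h2) (by
        rw [(hgeo w hwU).1.velocity_mono hF hJ.uniqueDiffOn hu h1 htI,
          (hΘgeo w hw).1.velocity_mono hF hop.uniqueDiffOn hu h2 htI, hΓvel w hw.1,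
          (hΘgeo w hw).2]) s ⟨hts.le, le_rfl⟩
    exact congrArg Bundle.TotalSpace.proj this
  have hgap : 0 < t + r - t' := by linarith
  set δ₂ := min δ (t + r - t') with hδ₂def
  have hδ₂ : 0 < δ₂ := lt_min hδ hgap
  -- The switch takes place at t + δ'/2, inside the open interval (t, t + δ') where the two families
  -- coincide. Thus near every point a single formula describes the glued family.
  let Γ' : Vec n → ℝ → M := fun w s => if s < t + δ' / 2 then Γ w s else Θ w s
  have hΓ'l : ∀ w s, s < t + δ' / 2 → Γ' w s = Γ w s := fun w s hs => if_pos hs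
  have hΓ'r : ∀ w ∈ U', ∀ s, t < s → Γ' w s = Θ w s := fun w hw s hs => by
    by_cases h : s < t + δ' / 2
    · rw [hΓ'l w s h]
      exact hagree w hw s ⟨hs, by linarith⟩
    · exact if_neg h
  have hΘs : ContMDiffOn 𝓘(ℝ, Vec n × ℝ) (𝓡 n) ∞ (fun q : Vec n × ℝ => Θ q.1 q.2)
      (U' ×ˢ ((fun s => 1 * s + -t) ⁻¹' Ioo (-r) r)) := by
    have hin : ContDiffOn ℝ ∞ (fun q : Vec n × ℝ => (ζ q.1, 1 * q.2 + -t))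
        (U' ×ˢ ((fun s => 1 * s + -t) ⁻¹' Ioo (-r) r)) := by
      refine (hζ.comp contDiff_fst.contDiffOn fun q hq => hq.1.1).prodMk ?_
      have : ContDiff ℝ ∞ fun q : Vec n × ℝ => 1 * q.2 + -t := by fun_prop
      exact this.contDiffOn
    exact hΨ.comp hin.contMDiffOn fun q hq => mk_mem_prod hq.1.2 hq.2
  have hcase : ∀ s ∈ Ioo (-δ₂) (t' + δ₂), (s < t + δ' / 2 ∧ s ∈ Ioo (-δ) (t + δ)) ∨
      (t < s ∧ s ∈ (fun s => 1 * s + -t) ⁻¹' Ioo (-r) r) := fun s hs => by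
    have h1 := min_le_left δ (t + r - t')
    have h2 := min_le_right δ (t + r - t')
    have h3 := min_le_left δ r
    rcases lt_or_ge s (t + δ' / 2) with h | h
    · exact Or.inl ⟨h, by linarith [hs.1], by linarith⟩
    · exact Or.inr ⟨by linarith, by linarith, by linarith [hs.2]⟩
  have hpre : IsOpen ((fun s : ℝ => 1 * s + -t) ⁻¹' Ioo (-r) r) :=
    isOpen_Ioo.preimage (by fun_prop)
  have hΓ's : ContMDiffOn 𝓘(ℝ, Vec n × ℝ) (𝓡 n) ∞ (fun q : Vec n × ℝ => Γ' q.1 q.2)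
      (U' ×ˢ Ioo (-δ₂) (t' + δ₂)) := by
    rintro ⟨w, s⟩ ⟨hw, hs⟩
    refine ContMDiffAt.contMDiffWithinAt ?_
    rcases hcase s hs with ⟨h1, h2⟩ | ⟨h1, h2⟩
    · have hnhds : (U ×ˢ Ioo (-δ) (t + δ)) ∈ 𝓝 (w, s) := (hU.prod hJ).mem_nhds ⟨hw.1.1.1, h2⟩
      refine (hΓ.contMDiffAt hnhds).congr_of_eventuallyEq ?_
      have : ∀ᶠ q : Vec n × ℝ in 𝓝 (w, s), q.2 < t + δ' / 2 :=
        continuousAt_snd.eventually_lt continuousAt_const h1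
      filter_upwards [this] with q hq using hΓ'l _ _ hq
    · have hnhds : (U' ×ˢ ((fun s : ℝ => 1 * s + -t) ⁻¹' Ioo (-r) r)) ∈ 𝓝 (w, s) :=
        (hU'.prod hpre).mem_nhds ⟨hw, h2⟩
      refine (hΘs.contMDiffAt hnhds).congr_of_eventuallyEq ?_
      have : ∀ᶠ q : Vec n × ℝ in 𝓝 (w, s), t < q.2 :=
        continuousAt_const.eventually_lt continuousAt_snd h1
      filter_upwards [this, hnhds] with q hq hq' using hΓ'r _ hq'.1 _ hq
  have hJ' : IsOpen (Ioo (-δ₂) (t' + δ₂)) := isOpen_Ioo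
  have h0J' : (0 : ℝ) ∈ Ioo (-δ₂) (t' + δ₂) := ⟨by linarith, by linarith [ht.1]⟩
  have hrep : ∀ w ∈ U', ∀ s ∈ Ioo (-δ₂) (t' + δ₂),
      (s < t + δ' / 2 → s ∈ Ioo (-δ) (t + δ) → GeodRep F (Γ' w) (Ioo (-δ₂) (t' + δ₂)) s (Γ w s)
        (fun u => extChartAt (𝓡 n) (Γ w s) (Γ w u))
        (derivWithin (fun u => extChartAt (𝓡 n) (Γ w s) (Γ w u)) (Ioo (-δ) (t + δ)))) ∧
      ∃ p y w', GeodRep F (Γ' w) (Ioo (-δ₂) (t' + δ₂)) s p y w' := fun w hw s hs => by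
    have hl : s < t + δ' / 2 → s ∈ Ioo (-δ) (t + δ) → GeodRep F (Γ' w) (Ioo (-δ₂) (t' + δ₂)) s
        (Γ w s) (fun u => extChartAt (𝓡 n) (Γ w s) (Γ w u))
        (derivWithin (fun u => extChartAt (𝓡 n) (Γ w s) (Γ w u)) (Ioo (-δ) (t + δ))) :=
      fun h1 h2 => by
        refine (((hgeo w hw.1.1.1).1.geodRep hF hJ.uniqueDiffOn h2
          (mem_extChartAt_source _)).of_nhds (hJ.mem_nhds h2) (hJ'.mem_nhds hs)).congr ?_
        refine eventually_nhdsWithin_of_eventually_nhds ?_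
        filter_upwards [eventually_lt_nhds h1] with u hu using hΓ'l _ _ hu
    refine ⟨hl, ?_⟩
    rcases hcase s hs with ⟨h1, h2⟩ | ⟨h1, h2⟩
    · exact ⟨_, _, _, hl h1 h2⟩
    · refine ⟨_, _, _, (((hΘgeo w hw).1.geodRep hF hpre.uniqueDiffOn h2
        (mem_extChartAt_source _)).of_nhds (hpre.mem_nhds h2) (hJ'.mem_nhds hs)).congr ?_⟩
      refine eventually_nhdsWithin_of_eventually_nhds ?_
      filter_upwards [eventually_gt_nhds h1] with u hu using hΓ'r _ hw _ hu
  refine ⟨U', hU', ⟨hvN, hζv⟩, δ₂, hδ₂, Γ', hΓ's, fun w hw => ⟨?_, ?_⟩⟩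
  · refine IsRegularGeodesic.of_geodRep hF hJ'.uniqueDiffOn ?_ fun s hs => (hrep w hw s hs).2
    have hin : ContMDiff 𝓘(ℝ, ℝ) 𝓘(ℝ, Vec n × ℝ) ∞ fun s : ℝ => (w, s) := by
      rw [contMDiff_iff_contDiff]
      fun_prop
    exact hΓ's.comp hin.contMDiffOn fun s hs => mk_mem_prod hw hs
  · have h0J : (0 : ℝ) ∈ Ioo (-δ) (t + δ) := ⟨by linarith, by linarith [ht.1]⟩
    rw [((hrep w hw 0 h0J').1 (by linarith [ht.1]) h0J).velocity_eq hJ'.uniqueDiffOn,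
      ← ((hgeo w hw.1.1.1).1.geodRep hF hJ.uniqueDiffOn h0J
        (mem_extChartAt_source _)).velocity_eq hJ.uniqueDiffOn, (hgeo w hw.1.1.1).2]

/-- Geodesics are contained in smooth families. -/
theorem hasGeodFamily [T2Space M] (hF : IsFinslerStructure F) {x : M} {v : Vec n} (hv : v ≠ 0)
    {γ : ℝ → M} {b : ℝ} (hγ : IsRegularGeodesic F γ (Icc 0 b)) (hb : 0 < b)
    (h0 : velocity (n := n) γ (Icc 0 b) 0 = ⟨x, v⟩) : HasGeodFamily F x v b := by
  have hS := uniqueDiffOn_Icc hb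
  -- One flow box around γ(s) serves all nearby starting times, so the property is locally constant
  -- near s; this gives closedness and extension at once. The bound r / 2 ensures t' < t + r.
  have hstep : ∀ s ∈ Icc 0 b, ∃ ρ > 0, ∀ t ∈ Icc 0 b, ∀ t' ∈ Icc 0 b, |t - s| < ρ → |t' - s| < ρ →
      HasGeodFamily F x v t → HasGeodFamily F x v t' := fun s hs => by
    have hp := mem_extChartAt_source (I := 𝓡 n) (γ s)
    obtain ⟨W, hW, hzW, -, r, hr, Ψ, hΨ, hΨgeo⟩ := exists_flowBox hF (hγ.mem_slit hF hS hs hp)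
    have hc := (hγ.hasDerivWithinAt_geodField hF hS hs hp).continuousWithinAt.eventually_mem
      (hW.mem_nhds hzW)
    have hev := hc.and (eventually_mem_source hγ.isGeodesicOn.1 hs hp)
    obtain ⟨ρ, hρ, hsub⟩ := Metric.mem_nhdsWithin_iff.1 hev
    refine ⟨min ρ (r / 2), by positivity, fun t ht t' ht' h1 h2 h => ?_⟩
    rcases le_total t' t with htt' | htt'
    · exact h.mono hF ht'.1 htt'
    · obtain ⟨h3, h4⟩ := hsub ⟨Metric.mem_ball.2 ((Real.dist_eq t s).trans_lt
        (h1.trans_le (min_le_left _ _))), ht⟩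
      refine HasGeodFamily.extend hF hγ hb h0 hW hr hΨ hΨgeo ht h4 h3 htt' ?_ h
      have h5 := (abs_lt.1 (h1.trans_le (min_le_right _ _))).1
      have h6 := (abs_lt.1 (h2.trans_le (min_le_right _ _))).2
      linarith
  refine (IsClosed.Icc_subset_of_forall_exists_gt (a := 0) (b := b)
    (s := {t | HasGeodFamily F x v t}) ?_ (hasGeodFamily_zero hF x hv) ?_) ⟨hb.le, le_rfl⟩
  · rw [isClosed_iff_frequently]
    intro s hs
    have hsI : s ∈ Icc 0 b := isClosed_iff_frequently.1 isClosed_Icc s (hs.mono fun s hs => hs.2)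
    obtain ⟨ρ, hρ, h⟩ := hstep s hsI
    obtain ⟨t, ⟨ht, htI⟩, htρ⟩ := (hs.and_eventually (Metric.ball_mem_nhds s hρ)).exists
    exact ⟨h t htI s hsI (by rwa [← Real.dist_eq]) (by simpa using hρ) ht, hsI⟩
  · rintro s ⟨hs, hsI⟩ y hy
    obtain ⟨ρ, hρ, h⟩ := hstep s ⟨hsI.1, hsI.2.le⟩
    obtain ⟨u, hu1, hu2⟩ := exists_between (lt_min (lt_min (mem_Ioi.1 hy) hsI.2)
      (lt_add_of_pos_right s hρ))
    have h1 := hu2.trans_le (min_le_left _ _)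
    refine ⟨u, h s ⟨hsI.1, hsI.2.le⟩ u ⟨hsI.1.trans hu1.le, (h1.trans_le (min_le_right _ _)).le⟩
      (by simpa using hρ) ?_ hs, hu1, (h1.trans_le (min_le_left _ _)).le⟩
    rw [abs_lt]
    constructor <;> linarith [hu2.trans_le (min_le_right _ _)]

end Families

/-! ### The exponential map, Jacobi fields and the Gauss lemma -/

section JacobiFields

variable {n : ℕ} {M : Type*} [TopologicalSpace M] [ChartedSpace (EuclideanSpace ℝ (Fin n)) M]
  [IsManifold (𝓡 n) ∞ M] {F : TangentBundle (𝓡 n) M → ℝ}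

/-- A smooth family of geodesics starting at `x`, parametrized by their initial velocities. -/
structure IsGeodFamily (F : TangentBundle (𝓡 n) M → ℝ) (x : M) (U : Set (Vec n)) (J : Set ℝ)
    (Γ : Vec n → ℝ → M) : Prop where
  isOpen_left : IsOpen U
  isOpen_right : IsOpen J
  ordConnected : J.OrdConnected
  zero_mem : (0 : ℝ) ∈ J
  smooth : ContMDiffOn 𝓘(ℝ, Vec n × ℝ) (𝓡 n) ∞ (fun q : Vec n × ℝ => Γ q.1 q.2) (U ×ˢ J)
  regular : ∀ w ∈ U, IsRegularGeodesic F (Γ w) J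
  velocity_zero : ∀ w ∈ U, velocity (Γ w) J 0 = ⟨x, w⟩

/-- A family of curves in the chart around `p`. -/
def famChart (Γ : Vec n → ℝ → M) (p : M) (q : Vec n × ℝ) : Vec n := extChartAt (𝓡 n) p (Γ q.1 q.2)

/-- The velocities of a family of curves in the chart around `p`. -/
def famVel (Γ : Vec n → ℝ → M) (p : M) (q : Vec n × ℝ) : Vec n := fderiv ℝ (famChart Γ p) q (0, 1)

/-- The domain of `famChart`. -/
def famDomain (U : Set (Vec n)) (J : Set ℝ) (Γ : Vec n → ℝ → M) (p : M) : Set (Vec n × ℝ) :=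
  (U ×ˢ J) ∩ (fun q : Vec n × ℝ => Γ q.1 q.2) ⁻¹' (extChartAt (𝓡 n) p).source

/-- The variation field of a family of curves in the direction `e`, in the chart around `p`. -/
def famJacobi (Γ : Vec n → ℝ → M) (p : M) (e : Vec n) (q : Vec n × ℝ) : Vec n :=
  fderiv ℝ (famChart Γ p) q (e, 0)

/-- The derivative of the velocities of a family of curves in the direction `e`. -/
def famJacobiDeriv (Γ : Vec n → ℝ → M) (p : M) (e : Vec n) (q : Vec n × ℝ) : Vec n :=
  fderiv ℝ (famVel Γ p) q (e, 0)

namespace IsGeodFamily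

variable {x p : M} {U : Set (Vec n)} {J : Set ℝ} {Γ : Vec n → ℝ → M} {w e : Vec n} {s : ℝ}

theorem isOpen_famDomain (h : IsGeodFamily F x U J Γ) (p : M) : IsOpen (famDomain U J Γ p) :=
  (contDiffOn_chart_family (h.isOpen_left.prod h.isOpen_right) h.smooth p).1

theorem contDiffOn_famChart (h : IsGeodFamily F x U J Γ) (p : M) :
    ContDiffOn ℝ ∞ (famChart Γ p) (famDomain U J Γ p) :=
  (contDiffOn_chart_family (h.isOpen_left.prod h.isOpen_right) h.smooth p).2

theorem contDiffOn_famVel (h : IsGeodFamily F x U J Γ) (p : M) :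
    ContDiffOn ℝ ∞ (famVel Γ p) (famDomain U J Γ p) :=
  ((h.contDiffOn_famChart p).fderiv_of_isOpen (h.isOpen_famDomain p) (by simp)).clm_apply
    contDiffOn_const

theorem contDiffOn_famJacobi (h : IsGeodFamily F x U J Γ) (p : M) (e : Vec n) :
    ContDiffOn ℝ ∞ (famJacobi Γ p e) (famDomain U J Γ p) :=
  ((h.contDiffOn_famChart p).fderiv_of_isOpen (h.isOpen_famDomain p) (by simp)).clm_apply
    contDiffOn_const

theorem eventually_mem (h : IsGeodFamily F x U J Γ) (hq : (w, s) ∈ famDomain U J Γ p) :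
    ∀ᶠ r in 𝓝 s, (w, r) ∈ famDomain U J Γ p := by
  have : Continuous fun r : ℝ => (w, r) := by fun_prop
  exact this.continuousAt.eventually_mem ((h.isOpen_famDomain p).mem_nhds hq)

theorem hasFDerivAt_famChart (h : IsGeodFamily F x U J Γ) {q : Vec n × ℝ}
    (hq : q ∈ famDomain U J Γ p) : HasFDerivAt (famChart Γ p) (fderiv ℝ (famChart Γ p) q) q :=
  (((h.contDiffOn_famChart p).contDiffAt
    ((h.isOpen_famDomain p).mem_nhds hq)).differentiableAt (by simp)).hasFDerivAt

theorem hasFDerivAt_famVel (h : IsGeodFamily F x U J Γ) {q : Vec n × ℝ}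
    (hq : q ∈ famDomain U J Γ p) : HasFDerivAt (famVel Γ p) (fderiv ℝ (famVel Γ p) q) q :=
  (((h.contDiffOn_famVel p).contDiffAt
    ((h.isOpen_famDomain p).mem_nhds hq)).differentiableAt (by simp)).hasFDerivAt

theorem hasDerivAt_famChart (h : IsGeodFamily F x U J Γ) (hq : (w, s) ∈ famDomain U J Γ p) :
    HasDerivAt (fun r => famChart Γ p (w, r)) (famVel Γ p (w, s)) s :=
  hasDerivAt_family_right (h.isOpen_famDomain p) (h.contDiffOn_famChart p) hq

theorem velocity_eq (h : IsGeodFamily F x U J Γ) (hq : (w, s) ∈ famDomain U J Γ p) :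
    velocity (Γ w) J s = tangentOfChart p (famChart Γ p (w, s)) (famVel Γ p (w, s)) := by
  have hJ : UniqueDiffOn ℝ J := h.isOpen_right.uniqueDiffOn
  rw [velocity_chart hJ (h.regular w hq.1.1).isGeodesicOn.1 hq.1.2 hq.2,
    ← (h.hasDerivAt_famChart hq).hasDerivWithinAt.derivWithin (hJ s hq.1.2)]
  rfl

theorem mem_target (hq : (w, s) ∈ famDomain U J Γ p) :
    famChart Γ p (w, s) ∈ (extChartAt (𝓡 n) p).target := (extChartAt (𝓡 n) p).map_source hq.2

theorem famVel_ne_zero (h : IsGeodFamily F x U J Γ) (hq : (w, s) ∈ famDomain U J Γ p) :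
    famVel Γ p (w, s) ≠ 0 := fun h0 => (h.regular w hq.1.1).velocity_ne_zero s hq.1.2 <| by
  rw [h.velocity_eq hq, h0]
  exact tangentOfChart_zero_snd _ _

theorem hasDerivAt_famVel (hF : IsFinslerStructure F) (h : IsGeodFamily F x U J Γ)
    (hq : (w, s) ∈ famDomain U J Γ p) : HasDerivAt (fun r => famVel Γ p (w, r))
      (geodAcc (inChart F p) (famChart Γ p (w, s)) (famVel Γ p (w, s))) s := by
  have hJ : UniqueDiffOn ℝ J := h.isOpen_right.uniqueDiffOn
  have hr := (h.regular w hq.1.1).geodRep hF hJ hq.1.2 hq.2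
  have hev : ∀ᶠ r in 𝓝 s, derivWithin (fun r => extChartAt (𝓡 n) p (Γ w r)) J r =
      famVel Γ p (w, r) := by
    filter_upwards [h.eventually_mem hq] with r hr
      using (h.hasDerivAt_famChart hr).hasDerivWithinAt.derivWithin (hJ r hr.1.2)
  have h1 := hr.acc.hasDerivAt (h.isOpen_right.mem_nhds hq.1.2)
  rw [hev.self_of_nhds] at h1
  exact h1.congr_of_eventuallyEq (hev.mono fun r hr => hr.symm)

theorem geodesic_nhds (hF : IsFinslerStructure F) (h : IsGeodFamily F x U J Γ)
    (hq : (w, s) ∈ famDomain U J Γ p) : ∀ᶠ r in 𝓝 s,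
      famChart Γ p (w, r) ∈ (extChartAt (𝓡 n) p).target ∧ famVel Γ p (w, r) ≠ 0 ∧
      HasDerivAt (fun r => famChart Γ p (w, r)) (famVel Γ p (w, r)) r ∧
      HasDerivAt (fun r => famVel Γ p (w, r))
        (geodAcc (inChart F p) (famChart Γ p (w, r)) (famVel Γ p (w, r))) r := by
  filter_upwards [h.eventually_mem hq] with r hr
  exact ⟨mem_target hr, h.famVel_ne_zero hr, h.hasDerivAt_famChart hr, h.hasDerivAt_famVel hF hr⟩

theorem hasDerivAt_apply_right {E' : Type*} [NormedAddCommGroup E'] [NormedSpace ℝ E']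
    {G : Vec n × ℝ → E'} {L : Vec n × ℝ →L[ℝ] E'} (hG : HasFDerivAt G L (w, s)) :
    HasDerivAt (fun r => G (w, r)) (L (0, 1)) s :=
  hG.comp_hasDerivAt s ((hasDerivAt_const s w).prodMk (hasDerivAt_id s))

theorem hasDerivAt_apply_left {E' : Type*} [NormedAddCommGroup E'] [NormedSpace ℝ E']
    {G : Vec n × ℝ → E'} {L : Vec n × ℝ →L[ℝ] E'} (hG : HasFDerivAt G L (w, s)) (e : Vec n) :
    HasDerivAt (fun r : ℝ => G (w + r • e, s)) (L (e, 0)) 0 := by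
  have h1 : HasDerivAt (fun r : ℝ => (w + r • e, s)) (e, (0 : ℝ)) 0 := by
    have := ((hasDerivAt_id (0 : ℝ)).smul_const e).const_add w
    simp only [id, one_smul] at this
    exact this.prodMk (hasDerivAt_const _ _)
  have h2 : HasFDerivAt G L (w + (0 : ℝ) • e, s) := by simpa using hG
  exact h2.comp_hasDerivAt (0 : ℝ) h1

theorem fderiv_fderiv_symm {E E' : Type*} [NormedAddCommGroup E] [NormedSpace ℝ E]
    [NormedAddCommGroup E'] [NormedSpace ℝ E'] {G : E → E'} {N : Set E} (hN : IsOpen N)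
    (hG : ContDiffOn ℝ ∞ G N) {q : E} (hq : q ∈ N) (a b : E) :
    fderiv ℝ (fun q => fderiv ℝ G q a) q b = fderiv ℝ (fun q => fderiv ℝ G q b) q a := by
  have hc := hG.contDiffAt (hN.mem_nhds hq)
  have hd : DifferentiableAt ℝ (fderiv ℝ G) q :=
    (hc.fderiv_right (m := ∞) (by simp)).differentiableAt (by simp)
  rw [fderiv_clm_apply hd (differentiableAt_const _), fderiv_clm_apply hd (differentiableAt_const _)]
  have := (hc.isSymmSndFDerivAt (by
    simp only [minSmoothness_of_isRCLikeNormedField]; exact WithTop.coe_le_coe.2 le_top)) a b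
  simpa using this.symm

/-- Mixed partials commute: the time derivative of the variation is the variation of the velocity.
-/
theorem hasDerivAt_famJacobi (h : IsGeodFamily F x U J Γ) (hq : (w, s) ∈ famDomain U J Γ p)
    (e : Vec n) : HasDerivAt (fun r => famJacobi Γ p e (w, r)) (famJacobiDeriv Γ p e (w, s)) s := by
  have h1 := (((h.contDiffOn_famJacobi p e).contDiffAt
    ((h.isOpen_famDomain p).mem_nhds hq)).differentiableAt (by simp)).hasFDerivAt
  refine (hasDerivAt_apply_right h1).congr_deriv ?_
  exact fderiv_fderiv_symm (h.isOpen_famDomain p) (h.contDiffOn_famChart p) hq (e, 0) (0, 1)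

/-- The Jacobi equation. -/
theorem hasDerivAt_famJacobiDeriv (hF : IsFinslerStructure F) (h : IsGeodFamily F x U J Γ)
    (hq : (w, s) ∈ famDomain U J Γ p) (e : Vec n) :
    HasDerivAt (fun r => famJacobiDeriv Γ p e (w, r))
      (jacobiAcc (inChart F p) (famChart Γ p (w, s)) (famVel Γ p (w, s)) (famJacobi Γ p e (w, s))
        (famJacobiDeriv Γ p e (w, s))) s := by
  have hN := h.isOpen_famDomain p
  have hL := isLocalFinsler_inChart hF p
  have h0 : ContDiffOn ℝ ∞ (famJacobiDeriv Γ p e) (famDomain U J Γ p) :=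
    ((h.contDiffOn_famVel p).fderiv_of_isOpen hN (by simp)).clm_apply contDiffOn_const
  have h1 := ((h0.contDiffAt (hN.mem_nhds hq)).differentiableAt (by simp)).hasFDerivAt
  refine (hasDerivAt_apply_right h1).congr_deriv ?_
  -- After interchanging time and variation, the geodesic equation may be differentiated in the
  -- direction e; its linearization is the Jacobi equation.
  have h2 : fderiv ℝ (famJacobiDeriv Γ p e) (w, s) (0, 1) =
      fderiv ℝ (fun q => fderiv ℝ (famVel Γ p) q (0, 1)) (w, s) (e, 0) :=
    fderiv_fderiv_symm hN (h.contDiffOn_famVel p) hq (e, 0) (0, 1)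
  rw [h2]
  have h3 : (fun q => fderiv ℝ (famVel Γ p) q (0, 1)) =ᶠ[𝓝 (w, s)]
      fun q => geodAcc (inChart F p) (famChart Γ p q) (famVel Γ p q) := by
    filter_upwards [hN.mem_nhds hq] with q hq
    exact (hasDerivAt_apply_right (h.hasFDerivAt_famVel hq)).unique (h.hasDerivAt_famVel hF hq)
  rw [h3.fderiv_eq]
  have hz : (famChart Γ p (w, s), famVel Γ p (w, s)) ∈ slit (extChartAt (𝓡 n) p).target :=
    ⟨mem_target hq, h.famVel_ne_zero hq⟩
  have h4 : DifferentiableAt ℝ (fun q => geodAcc (inChart F p) (famChart Γ p q) (famVel Γ p q))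
      (w, s) := by
    have h5 := (contDiff_snd.comp_contDiffOn hL.contDiffOn_geodField).contDiffAt
      ((isOpen_slit hL.isOpen).mem_nhds hz)
    exact DifferentiableAt.comp (w, s) (g := Prod.snd ∘ geodField (inChart F p))
      (f := fun q => (famChart Γ p q, famVel Γ p q)) (h5.differentiableAt (by simp))
      ((h.hasFDerivAt_famChart hq).differentiableAt.prodMk
        (h.hasFDerivAt_famVel hq).differentiableAt)
  ext i
  have h5 := hasDerivAt_vec.1 (hasDerivAt_apply_left h4.hasFDerivAt e) i
  have h6 := hasDerivAt_apply_left (h.hasFDerivAt_famChart hq) e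
  have h7 := hasDerivAt_apply_left (h.hasFDerivAt_famVel hq) e
  have e0 : w + (0 : ℝ) • e = w := by simp
  have h8 := ((hL.smooth_spray i).hasDerivAt hL.isOpen
    (y := fun r : ℝ => famChart Γ p (w + r • e, s)) (w := fun r : ℝ => famVel Γ p (w + r • e, s))
    (t := 0) (by rw [e0]; exact hz.1) (by rw [e0]; exact hz.2) h6 h7).const_mul (-2)
  rw [e0] at h8
  exact h5.unique h8

theorem speed_eq (hF : IsFinslerStructure F) (h : IsGeodFamily F x U J Γ) (hw : w ∈ U)
    (hs : s ∈ J) : F (velocity (Γ w) J s) = F ⟨x, w⟩ := by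
  have hr := h.regular w hw
  have hJ : UniqueDiffOn ℝ J := h.isOpen_right.uniqueDiffOn
  rw [← h.velocity_zero w hw]
  rcases le_total 0 s with h0 | h0
  · exact hr.isGeodesicOn.speed_eq hF hJ (h.ordConnected.out h.zero_mem hs)
      (hr.velocity_ne_zero 0 h.zero_mem) s ⟨h0, le_rfl⟩
  · exact (hr.isGeodesicOn.speed_eq hF hJ (h.ordConnected.out hs h.zero_mem)
      (hr.velocity_ne_zero s hs) 0 ⟨h0, le_rfl⟩).symm

theorem energy_eq (hF : IsFinslerStructure F) (h : IsGeodFamily F x U J Γ) {q : Vec n × ℝ}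
    (hq : q ∈ famDomain U J Γ p) :
    energy (inChart F p) (famChart Γ p q) (famVel Γ p q) = F ⟨x, q.1⟩ ^ 2 := by
  rw [← h.speed_eq hF hq.1.1 hq.1.2, h.velocity_eq (p := p) hq]
  rfl

theorem fst_ne_zero (h : IsGeodFamily F x U J Γ) (hw : w ∈ U) : w ≠ 0 := fun h0 =>
  (h.regular w hw).velocity_ne_zero 0 h.zero_mem <| by
    rw [h.velocity_zero w hw]
    exact h0

theorem contDiffAt_energy_fst (hF : IsFinslerStructure F) (h : IsGeodFamily F x U J Γ)
    (hw : w ∈ U) : ContDiffAt ℝ ∞ (fun w : Vec n => F ⟨x, w⟩ ^ 2) w := by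
  have h1 := (isLocalFinsler_inChart hF x).smooth_energy.contDiffAt (isOpen_target x)
    (mem_extChartAt_target x) (h.fst_ne_zero hw)
  have h2 : ContDiffAt ℝ ∞ (fun w : Vec n => energy (inChart F x) (extChartAt (𝓡 n) x x) w) w :=
    h1.comp w (contDiffAt_const.prodMk contDiffAt_id)
  simpa only [energy, inChart_self] using h2

/-- The variation field at its own base point. -/
def jacobi (Γ : Vec n → ℝ → M) (e : Vec n) (w : Vec n) (s : ℝ) : Vec n :=
  famJacobi Γ (Γ w s) e (w, s)

/-- Variation fields transform by the Jacobian of the transition map, so one fixed chart can compute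
a field that is defined in a moving chart. -/
theorem toChart_jacobi (h : IsGeodFamily F x U J Γ) (hq : (w, s) ∈ famDomain U J Γ p)
    (e : Vec n) : toChart p (Γ w s) (jacobi Γ e w s) = famJacobi Γ p e (w, s) := by
  have hq' : (w, s) ∈ famDomain U J Γ (Γ w s) := ⟨hq.1, mem_extChartAt_source _⟩
  have h1 := (hasFDerivAt_coordChange (Γ w s) p (chart_self_mem_overlap hq.2)).comp (w, s)
    (h.hasFDerivAt_famChart hq')
  have h2 : famChart Γ p =ᶠ[𝓝 (w, s)] coordChange (Γ w s) p ∘ famChart Γ (Γ w s) := by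
    filter_upwards [(h.isOpen_famDomain (Γ w s)).mem_nhds hq'] with q hq
      using (coordChange_apply (Γ w s) p hq.2).symm
  rw [famJacobi, (h1.congr_of_eventuallyEq h2).fderiv]
  rfl

theorem toChart_velocity (h : IsGeodFamily F x U J Γ) (hq : (w, s) ∈ famDomain U J Γ p) :
    toChart p (Γ w s) (show Vec n from (velocity (Γ w) J s).2) = famVel Γ p (w, s) :=
  toChart_snd hq.2 (mem_target hq) (h.velocity_eq hq) rfl

theorem gInner_eq (hF : IsFinslerStructure F) (h : IsGeodFamily F x U J Γ)
    (hq : (w, s) ∈ famDomain U J Γ p) (a b : Vec n) :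
    gInner F (Γ w s) (velocity (Γ w) J s).2 a b = gForm (inChart F p) (famChart Γ p (w, s))
      (famVel Γ p (w, s)) (toChart p (Γ w s) a) (toChart p (Γ w s) b) := by
  rw [← h.toChart_velocity hq]
  exact gInner_eq_gForm_toChart hF hq.2
    (v := show Vec n from (velocity (n := n) (Γ w) J s).2)
    ((h.regular w hq.1.1).velocity_ne_zero s hq.1.2) a b

theorem _root_.Finsler.IsLocalFinsler.gForm_left {O : Set (Vec n)} {F : Vec n → Vec n → ℝ}
    (h : IsLocalFinsler O F) {x v : Vec n} (hx : x ∈ O) (hv : v ≠ 0) (a : Vec n) :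
    gForm F x v v a = (1 / 2) * ∑ m, dV m (energy F) x v * a m := by
  rw [gForm, Finset.sum_comm, Finset.mul_sum]
  refine Finset.sum_congr rfl fun m _ => ?_
  have := h.sum_gLow_mul hx hv m
  calc ∑ i, gLow F i m x v * v i * a m = (∑ i, gLow F m i x v * v i) * a m := by
        rw [Finset.sum_mul]
        exact Finset.sum_congr rfl fun i _ => by rw [h.gLow_symm hx hv]
    _ = _ := by rw [this]; ring

/-- The Gauss lemma. -/
theorem two_mul_gInner_velocity_jacobi (hF : IsFinslerStructure F) (h : IsGeodFamily F x U J Γ)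
    (hw : w ∈ U) (e : Vec n) (hs : s ∈ J) :
    2 * gInner F (Γ w s) (velocity (Γ w) J s).2 (velocity (Γ w) J s).2 (jacobi Γ e w s) =
      s * fderiv ℝ (fun w : Vec n => F ⟨x, w⟩ ^ 2) w e := by
  set D := fderiv ℝ (fun w : Vec n => F ⟨x, w⟩ ^ 2) w e with hD
  let K : ℝ → ℝ := fun s => 2 * gInner F (Γ w s) (velocity (Γ w) J s).2 (velocity (Γ w) J s).2
    (jacobi Γ e w s)
  have hK : ∀ p : M, ∀ s, (w, s) ∈ famDomain U J Γ p → K s =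
      ∑ m, dV m (energy (inChart F p)) (famChart Γ p (w, s)) (famVel Γ p (w, s)) *
        famJacobi Γ p e (w, s) m := fun p s hq => by
    have h1 := h.gInner_eq hF hq (show Vec n from (velocity (n := n) (Γ w) J s).2)
      (jacobi Γ e w s)
    have h2 := (isLocalFinsler_inChart hF p).gForm_left (mem_target hq) (h.famVel_ne_zero hq)
      (famJacobi Γ p e (w, s))
    rw [h.toChart_velocity hq, h.toChart_jacobi hq, h2] at h1
    change 2 * gInner F (Γ w s) (velocity (Γ w) J s).2 (velocity (Γ w) J s).2
      (jacobi Γ e w s) = _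
    rw [show gInner F (Γ w s) (velocity (Γ w) J s).2 (velocity (Γ w) J s).2
      (jacobi Γ e w s) = _ from h1]
    ring
  -- K is the momentum paired with the variation field. By the Euler–Lagrange equation its
  -- derivative is the variation of the energy, which is constant in time because each curve keeps
  -- its initial speed.
  have hder : ∀ s ∈ J, HasDerivAt K D s := fun s hs => by
    have hq : (w, s) ∈ famDomain U J Γ (Γ w s) := ⟨⟨hw, hs⟩, mem_extChartAt_source _⟩
    set p := Γ w s
    have hL := isLocalFinsler_inChart hF p
    have h1 := HasDerivAt.fun_sum fun m (_ : m ∈ Finset.univ) =>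
      (((hL.hasDerivWithinAt_dV_energy (S := univ) (y := fun r => famChart Γ p (w, r))
        (w := fun r => famVel Γ p (w, r)) (t := s)
        (mem_target hq) (h.famVel_ne_zero hq) (h.hasDerivAt_famChart hq).hasDerivWithinAt
        (h.hasDerivAt_famVel hF hq).hasDerivWithinAt m).hasDerivAt univ_mem).mul
        (hasDerivAt_vec.1 (h.hasDerivAt_famJacobi hq e) m))
    refine (h1.congr_of_eventuallyEq ((h.eventually_mem hq).mono fun r hr => hK p r hr)).congr_deriv
      ?_
    have e0 : w + (0 : ℝ) • e = w := by simp
    have h3 := hL.smooth_energy.hasDerivAt hL.isOpen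
      (y := fun r : ℝ => famChart Γ p (w + r • e, s)) (w := fun r : ℝ => famVel Γ p (w + r • e, s))
      (t := 0) (by rw [e0]; exact mem_target hq) (by rw [e0]; exact h.famVel_ne_zero hq)
      (hasDerivAt_apply_left (h.hasFDerivAt_famChart hq) e)
      (hasDerivAt_apply_left (h.hasFDerivAt_famVel hq) e)
    rw [e0] at h3
    have h4 := hasDerivAt_apply_left (w := w) (s := s) (G := fun q : Vec n × ℝ => F ⟨x, q.1⟩ ^ 2)
      (HasFDerivAt.comp (w, s) (g := fun w : Vec n => F ⟨x, w⟩ ^ 2) (f := Prod.fst)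
        ((h.contDiffAt_energy_fst hF hw).differentiableAt (by simp)).hasFDerivAt hasFDerivAt_fst) e
    have h5 : (fun r : ℝ => energy (inChart F p) (famChart Γ p (w + r • e, s))
        (famVel Γ p (w + r • e, s))) =ᶠ[𝓝 0] fun r => F ⟨x, w + r • e⟩ ^ 2 := by
      have hc : Continuous fun r : ℝ => (w + r • e, s) := by fun_prop
      filter_upwards [hc.continuousAt.eventually_mem ((h.isOpen_famDomain p).mem_nhds
        (show (w + (0 : ℝ) • e, s) ∈ famDomain U J Γ p by rw [e0]; exact hq))] with r hr
      exact h.energy_eq hF hr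
    have h6 := (h4.congr_of_eventuallyEq h5).unique h3
    rw [Finset.sum_add_distrib]
    exact h6.symm
  have hconst := h.isOpen_right.is_const_of_deriv_eq_zero h.ordConnected.isPreconnected
    (f := fun s => K s - s * D)
    (fun s hs => ((hder s hs).sub ((hasDerivAt_id s).mul_const D)).differentiableAt.differentiableWithinAt)
    (fun s hs => by
      refine ((hder s hs).sub ((hasDerivAt_id s).mul_const D)).deriv.trans ?_
      simp) hs h.zero_mem
  -- All curves of the family start at x, so the variation vanishes at time 0.
  have hK0 : K 0 = 0 := by
    have hq : (w, (0 : ℝ)) ∈ famDomain U J Γ (Γ w 0) :=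
      ⟨⟨hw, h.zero_mem⟩, mem_extChartAt_source _⟩
    have : famJacobi Γ (Γ w 0) e (w, 0) = 0 := by
      have h1 := hasDerivAt_apply_left (h.hasFDerivAt_famChart hq) e
      have h2 : (fun r : ℝ => famChart Γ (Γ w 0) (w + r • e, 0)) =ᶠ[𝓝 0]
          fun _ => extChartAt (𝓡 n) (Γ w 0) x := by
        have hc : Continuous fun r : ℝ => w + r • e := by fun_prop
        filter_upwards [hc.continuousAt.eventually_mem (h.isOpen_left.mem_nhds
          (show w + (0 : ℝ) • e ∈ U by simpa using hw))] with r hr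
        have : Γ (w + r • e) 0 = x := congrArg Bundle.TotalSpace.proj (h.velocity_zero _ hr)
        simp only [famChart, this]
      exact h1.unique ((hasDerivAt_const _ _).congr_of_eventuallyEq h2)
    rw [hK _ 0 hq, this]
    simp
  have : K s - s * D = K 0 - 0 * D := hconst
  rw [hK0] at this
  change K s = _
  linarith

end IsGeodFamily

end JacobiFields

/-! ### The exponential map through geodesic families -/

section ExponentialMap

variable {n : ℕ} {M : Type*} [TopologicalSpace M] [ChartedSpace (EuclideanSpace ℝ (Fin n)) M]
  [IsManifold (𝓡 n) ∞ M] {F : TangentBundle (𝓡 n) M → ℝ}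

theorem exists_isGeodFamily [T2Space M] (hF : IsFinslerStructure F) {x : M} {v : Vec n}
    (hv : v ≠ 0) {γ : ℝ → M} {b : ℝ} (hγ : IsRegularGeodesic F γ (Icc 0 b)) (hb : 0 < b)
    (h0 : velocity (n := n) γ (Icc 0 b) 0 = ⟨x, v⟩) :
    ∃ U J Γ, IsGeodFamily F x U J Γ ∧ v ∈ U ∧ Icc 0 b ⊆ J := by
  obtain ⟨U, hU, hvU, δ, hδ, Γ, hΓ, hgeo⟩ := hasGeodFamily hF hv hγ hb h0
  exact ⟨U, Ioo (-δ) (b + δ), Γ, ⟨hU, isOpen_Ioo, ordConnected_Ioo, ⟨by linarith, by linarith⟩, hΓ,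
    fun w hw => (hgeo w hw).1, fun w hw => (hgeo w hw).2⟩, hvU,
    fun s hs => ⟨by linarith [hs.1], by linarith [hs.2]⟩⟩

namespace IsGeodFamily

variable {x p : M} {U : Set (Vec n)} {J : Set ℝ} {Γ : Vec n → ℝ → M} {v w e : Vec n} {s t : ℝ}

/-- `expMap` evaluates some chosen geodesic on [0, 1]. The curve s ↦ Γ_w(ts) has initial velocity t
• w, so uniqueness identifies the two. -/
theorem expMap_smul [T2Space M] (hF : IsFinslerStructure F) (h : IsGeodFamily F x U J Γ)
    (hw : w ∈ U) (ht : 0 < t) (htJ : t ∈ J) : expMap F x (t • w) = Γ w t := by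
  have hJ : UniqueDiffOn ℝ J := h.isOpen_right.uniqueDiffOn
  have hop : IsOpen ((fun s : ℝ => t * s + 0) ⁻¹' J) := h.isOpen_right.preimage (by fun_prop)
  have hsub : Icc (0 : ℝ) 1 ⊆ (fun s : ℝ => t * s + 0) ⁻¹' J := fun s hs => by
    refine h.ordConnected.out h.zero_mem htJ ⟨?_, ?_⟩ <;> nlinarith [hs.1, hs.2]
  have hu := uniqueDiffOn_Icc (zero_lt_one (α := ℝ))
  have h0 : (0 : ℝ) ∈ Icc (0 : ℝ) 1 := ⟨le_rfl, zero_le_one⟩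
  have h1 := (h.regular w hw).affine hF hJ ht 0 hop.uniqueDiffOn
  have h2 := h1.mono hF hop.uniqueDiffOn hu hsub
  have h3 : velocity (n := n) (fun s => Γ w (t * s + 0)) (Icc 0 1) 0 = ⟨x, t • w⟩ := by
    rw [h1.velocity_mono hF hop.uniqueDiffOn hu hsub h0,
      (h.regular w hw).velocity_affine hF hJ ht 0 hop.uniqueDiffOn (hsub h0)]
    have e : t * 0 + 0 = 0 := by ring
    have h4 := h.velocity_zero w hw
    rw [e]
    have h5 : Γ w 0 = x := congrArg Bundle.TotalSpace.proj h4
    exact congrArg (fun V : TangentBundle (𝓡 n) M => (⟨V.1, t • V.2⟩ : TangentBundle (𝓡 n) M)) h4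
  have hex : ∃ γ : ℝ → M, IsGeodesicOn F γ (Icc 0 1) ∧
      velocity γ (Icc 0 1) 0 = (⟨x, t • w⟩ : TangentBundle (𝓡 n) M) :=
    ⟨_, h2.isGeodesicOn, h3⟩
  have h9 : expMap F x (show TangentSpace (𝓡 n) x from t • w) = hex.choose 1 := dif_pos hex
  obtain ⟨h4, h5⟩ := hex.choose_spec
  have h6 : IsRegularGeodesic F hex.choose (Icc 0 1) :=
    h4.isRegularGeodesic hF hu ordConnected_Icc h0 (fun s hs => hs.1) (by
      rw [h5]
      exact smul_ne_zero ht.ne' (h.fst_ne_zero hw))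
  have h7 := h6.eqOn hF zero_lt_one h2 (h5.trans h3.symm) 1 ⟨zero_le_one, le_rfl⟩
  have h8 : hex.choose 1 = Γ w (t * 1 + 0) := congrArg Bundle.TotalSpace.proj h7
  rw [mul_one, add_zero] at h8
  exact h9.trans h8

/-- Near tv the exponential map is u ↦ Γ(t⁻¹u)(t). Evaluated on te, its derivative loses the factor
t⁻¹ against t and becomes the variation of Γ in the direction e. -/
theorem jacobiField_eq [T2Space M] (hF : IsFinslerStructure F) (h : IsGeodFamily F x U J Γ)
    (hv : v ∈ U) (ht : 0 < t) (htJ : t ∈ J) (e : Vec n) :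
    (show Vec n from jacobiField F x v e t) = jacobi Γ e v t := by
  set f : Vec n → M := fun u => expMap F x u with hf
  have hz : f (t • v) = Γ v t := h.expMap_smul hF hv ht htJ
  have hq : (v, t) ∈ famDomain U J Γ (Γ v t) := ⟨⟨hv, htJ⟩, mem_extChartAt_source _⟩
  have hev : f =ᶠ[𝓝 (t • v)] fun u => Γ (t⁻¹ • u) t := by
    have hc : Continuous fun u : Vec n => t⁻¹ • u := by fun_prop
    filter_upwards [hc.continuousAt.eventually_mem (h.isOpen_left.mem_nhds
      (show t⁻¹ • t • v ∈ U by rwa [inv_smul_smul₀ ht.ne']))] with u hu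
    have := h.expMap_smul hF hu ht htJ
    rwa [smul_inv_smul₀ ht.ne'] at this
  have hlin : HasFDerivAt (fun u : Vec n => (t⁻¹ • u, t))
      ((t⁻¹ • ContinuousLinearMap.id ℝ (Vec n)).prod 0) (t • v) :=
    ((hasFDerivAt_id _).const_smul t⁻¹).prodMk (hasFDerivAt_const _ _)
  have e0 : (t⁻¹ • t • v, t) = (v, t) := by rw [inv_smul_smul₀ ht.ne']
  have hmem : (U ×ˢ J) ∈ 𝓝 (t⁻¹ • t • v, t) := by
    rw [e0]
    exact (h.isOpen_left.prod h.isOpen_right).mem_nhds ⟨hv, htJ⟩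
  have hd : HasFDerivAt (fun u => extChartAt (𝓡 n) (Γ v t) (f u))
      ((fderiv ℝ (famChart Γ (Γ v t)) (v, t)).comp
        ((t⁻¹ • ContinuousLinearMap.id ℝ (Vec n)).prod 0)) (t • v) := by
    have h1 : HasFDerivAt (famChart Γ (Γ v t)) (fderiv ℝ (famChart Γ (Γ v t)) (v, t))
        (t⁻¹ • t • v, t) := by
      rw [e0]
      exact h.hasFDerivAt_famChart hq
    refine (h1.comp (t • v) hlin).congr_of_eventuallyEq ?_
    filter_upwards [hev] with u hu
    simp only [hu]
    rfl
  have hcont : ContinuousAt f (t • v) := by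
    have h1 : ContinuousAt (fun q : Vec n × ℝ => Γ q.1 q.2) (t⁻¹ • t • v, t) :=
      (h.smooth.contMDiffAt hmem).continuousAt
    exact (ContinuousAt.comp (f := fun u : Vec n => (t⁻¹ • u, t)) h1
      hlin.continuousAt).congr_of_eventuallyEq hev
  have hm : HasMFDerivAt 𝓘(ℝ, Vec n) (𝓡 n) f (t • v)
      ((fderiv ℝ (famChart Γ (Γ v t)) (v, t)).comp
        ((t⁻¹ • ContinuousLinearMap.id ℝ (Vec n)).prod 0)) := by
    refine ⟨hcont, ?_⟩
    simp only [extChartAt_model_space_eq_id, ModelWithCorners.range_eq_univ,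
      writtenInExtChartAt, hz]
    exact hd.hasFDerivWithinAt
  change mfderiv 𝓘(ℝ, Vec n) (𝓡 n) f (t • v) (t • e) = _
  rw [hm.mfderiv]
  change fderiv ℝ (famChart Γ (Γ v t)) (v, t) (t⁻¹ • t • e, 0) = _
  rw [inv_smul_smul₀ ht.ne']
  rfl

theorem fderiv_energy_fst (hF : IsFinslerStructure F) (h : IsGeodFamily F x U J Γ) (hv : v ∈ U)
    (e : Vec n) : fderiv ℝ (fun w : Vec n => F ⟨x, w⟩ ^ 2) v e = 2 * gInner F x v v e := by
  have h1 := (isLocalFinsler_inChart hF x).gForm_left (mem_extChartAt_target x) (h.fst_ne_zero hv) e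
  have h2 : gInner F x v v e = gForm (inChart F x) (extChartAt (𝓡 n) x x) v v e := rfl
  rw [h2, h1, fderiv_apply_eq_sum]
  have h3 : (fun w : Vec n => F ⟨x, w⟩ ^ 2) =
      fun w => energy (inChart F x) (extChartAt (𝓡 n) x x) w := by
    funext w
    rw [energy, inChart_self]
  rw [h3]
  have : ∀ m, dV m (energy (inChart F x)) (extChartAt (𝓡 n) x x) v =
    fderiv ℝ (fun w => energy (inChart F x) (extChartAt (𝓡 n) x x) w) v
      (EuclideanSpace.single m 1) := fun m => rfl
  simp only [this]
  rw [← mul_assoc]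
  norm_num
  exact Finset.sum_congr rfl fun m _ => mul_comm _ _

theorem two_mul_gForm_famVel_famJacobi (hF : IsFinslerStructure F) (h : IsGeodFamily F x U J Γ)
    (hq : (w, s) ∈ famDomain U J Γ p) (e : Vec n) :
    2 * gForm (inChart F p) (famChart Γ p (w, s)) (famVel Γ p (w, s)) (famVel Γ p (w, s))
      (famJacobi Γ p e (w, s)) = s * fderiv ℝ (fun w : Vec n => F ⟨x, w⟩ ^ 2) w e := by
  rw [← h.two_mul_gInner_velocity_jacobi hF hq.1.1 e hq.1.2]
  have h1 := h.gInner_eq hF hq (show Vec n from (velocity (n := n) (Γ w) J s).2) (jacobi Γ e w s)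
  rw [h.toChart_velocity hq, h.toChart_jacobi hq] at h1
  rw [← h1]

theorem gForm_famVel_famJacobi_eq_zero (hF : IsFinslerStructure F) (h : IsGeodFamily F x U J Γ)
    (hq : (v, s) ∈ famDomain U J Γ p) (he : gInner F x v v e = 0) :
    gForm (inChart F p) (famChart Γ p (v, s)) (famVel Γ p (v, s)) (famVel Γ p (v, s))
      (famJacobi Γ p e (v, s)) = 0 := by
  have := h.two_mul_gForm_famVel_famJacobi hF hq e
  rw [h.fderiv_energy_fst hF hq.1.1, he] at this
  linarith

/-- Jacobi fields vanishing at the initial time are conjugate to each other. -/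
theorem wronskian_symm (hF : IsFinslerStructure F) (h : IsGeodFamily F x U J Γ)
    (hq : (w, s) ∈ famDomain U J Γ p) (a b : Vec n) :
    ∑ i, (∑ j, dX j (dV i (energy (inChart F p))) (famChart Γ p (w, s)) (famVel Γ p (w, s)) *
        famJacobi Γ p a (w, s) j +
      2 * ∑ j, gLow (inChart F p) i j (famChart Γ p (w, s)) (famVel Γ p (w, s)) *
        famJacobiDeriv Γ p a (w, s) j) * famJacobi Γ p b (w, s) i =
    ∑ i, (∑ j, dX j (dV i (energy (inChart F p))) (famChart Γ p (w, s)) (famVel Γ p (w, s)) *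
        famJacobi Γ p b (w, s) j +
      2 * ∑ j, gLow (inChart F p) i j (famChart Γ p (w, s)) (famVel Γ p (w, s)) *
        famJacobiDeriv Γ p b (w, s) j) * famJacobi Γ p a (w, s) i := by
  have hL := isLocalFinsler_inChart hF p
  have hN := h.isOpen_famDomain p
  have e0 : ∀ a : Vec n, w + (0 : ℝ) • a = w := fun a => by simp
  -- Differentiate the Gauss identity for the direction b along a. The Wronskian becomes a Hessian
  -- of F² minus the momentum paired with a second derivative of the family, both symmetric in a and
  -- b.
  have key : ∀ a b : Vec n,
      ∑ i, (∑ j, dX j (dV i (energy (inChart F p))) (famChart Γ p (w, s)) (famVel Γ p (w, s)) *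
          famJacobi Γ p a (w, s) j +
        2 * ∑ j, gLow (inChart F p) i j (famChart Γ p (w, s)) (famVel Γ p (w, s)) *
          famJacobiDeriv Γ p a (w, s) j) * famJacobi Γ p b (w, s) i =
      s * fderiv ℝ (fun w => fderiv ℝ (fun w : Vec n => F ⟨x, w⟩ ^ 2) w b) w a -
      ∑ i, dV i (energy (inChart F p)) (famChart Γ p (w, s)) (famVel Γ p (w, s)) *
        fderiv ℝ (fun q => fderiv ℝ (famChart Γ p) q (b, 0)) (w, s) (a, 0) i := fun a b => by
    have hJd : HasFDerivAt (famJacobi Γ p b) (fderiv ℝ (famJacobi Γ p b) (w, s)) (w, s) :=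
      (((h.contDiffOn_famJacobi p b).contDiffAt (hN.mem_nhds hq)).differentiableAt
        (by simp)).hasFDerivAt
    have h1 := fun i : Fin n => (hL.smooth_energy.dV hL.isOpen i).hasDerivAt hL.isOpen
      (y := fun r : ℝ => famChart Γ p (w + r • a, s)) (w := fun r : ℝ => famVel Γ p (w + r • a, s))
      (t := 0) (by rw [e0]; exact mem_target hq) (by rw [e0]; exact h.famVel_ne_zero hq)
      (hasDerivAt_apply_left (h.hasFDerivAt_famChart hq) a)
      (hasDerivAt_apply_left (h.hasFDerivAt_famVel hq) a)
    have h2 := hasDerivAt_vec.1 (hasDerivAt_apply_left hJd a)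
    have h3 := HasDerivAt.fun_sum fun i (_ : i ∈ Finset.univ) => (h1 i).mul (h2 i)
    rw [e0] at h3
    have hE : HasFDerivAt (fun w : Vec n => fderiv ℝ (fun w : Vec n => F ⟨x, w⟩ ^ 2) w b)
        (fderiv ℝ (fun w => fderiv ℝ (fun w : Vec n => F ⟨x, w⟩ ^ 2) w b) w) w := by
      have := ((h.contDiffAt_energy_fst hF hq.1.1).fderiv_right (m := ∞) (by simp)).differentiableAt
        (by simp)
      exact (this.clm_apply (differentiableAt_const _)).hasFDerivAt
    have h4 := hasDerivAt_apply_left (w := w) (s := s) (G := fun q : Vec n × ℝ =>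
      s * fderiv ℝ (fun w : Vec n => F ⟨x, w⟩ ^ 2) q.1 b)
      ((HasFDerivAt.comp (w, s) (f := Prod.fst)
        (g := fun w : Vec n => fderiv ℝ (fun w : Vec n => F ⟨x, w⟩ ^ 2) w b)
        hE hasFDerivAt_fst).const_mul s) a
    have h5 : (fun r : ℝ => ∑ i, dV i (energy (inChart F p)) (famChart Γ p (w + r • a, s))
          (famVel Γ p (w + r • a, s)) * famJacobi Γ p b (w + r • a, s) i) =ᶠ[𝓝 0]
        fun r => s * fderiv ℝ (fun w : Vec n => F ⟨x, w⟩ ^ 2) (w + r • a) b := by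
      have hc : Continuous fun r : ℝ => (w + r • a, s) := by fun_prop
      filter_upwards [hc.continuousAt.eventually_mem (hN.mem_nhds
        (show (w + (0 : ℝ) • a, s) ∈ famDomain U J Γ p by rw [e0]; exact hq))] with r hr
      rw [← h.two_mul_gForm_famVel_famJacobi hF hr, hL.gForm_left (mem_target hr)
        (h.famVel_ne_zero hr)]
      ring
    have h6 := (h4.congr_of_eventuallyEq h5).unique h3
    have h7 : ∀ i, ∑ j, dV j (dV i (energy (inChart F p))) (famChart Γ p (w, s))
        (famVel Γ p (w, s)) * fderiv ℝ (famVel Γ p) (w, s) (a, 0) j =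
        2 * ∑ j, gLow (inChart F p) i j (famChart Γ p (w, s)) (famVel Γ p (w, s)) *
          famJacobiDeriv Γ p a (w, s) j := fun i => by
      rw [Finset.mul_sum]
      refine Finset.sum_congr rfl fun j _ => ?_
      rw [hL.gLow_symm (mem_target hq) (h.famVel_ne_zero hq) i j, gLow, famJacobiDeriv]
      ring
    simp only [h7] at h6
    rw [Finset.sum_add_distrib] at h6
    have h8 : s * fderiv ℝ (fun w => fderiv ℝ (fun w : Vec n => F ⟨x, w⟩ ^ 2) w b) w a = _ := h6
    rw [h8]
    exact (add_sub_cancel_right _ _).symm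
  rw [key a b, key b a]
  have hcE := h.contDiffAt_energy_fst hF hq.1.1
  obtain ⟨V, hV, hVo⟩ : ∃ V, IsOpen V ∧ w ∈ V ∧
      ContDiffOn ℝ ∞ (fun w : Vec n => F ⟨x, w⟩ ^ 2) V :=
    ⟨U, h.isOpen_left, hq.1.1, fun w hw => (h.contDiffAt_energy_fst hF hw).contDiffWithinAt⟩
  rw [fderiv_fderiv_symm hV hVo.2 hVo.1 b a]
  congr 1
  refine Finset.sum_congr rfl fun i _ => ?_
  rw [fderiv_fderiv_symm hN (h.contDiffOn_famChart p) hq (b, 0) (a, 0)]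

end IsGeodFamily

end ExponentialMap

/-! ### The Ricci curvature as a trace -/

section Frames

open Matrix

/-- Through G = LᵀL the form G becomes Euclidean; complete Lu to an orthonormal basis and pull back.
Existence matters since `ricci` takes the value 0 when no adapted frame exists. -/
theorem exists_frame {m : ℕ} {G : Matrix (Fin (m + 1)) (Fin (m + 1)) ℝ} (hG : G.PosDef)
    {u : Fin (m + 1) → ℝ} (hu : u ⬝ᵥ G *ᵥ u = 1) :
    ∃ e : Fin m → Fin (m + 1) → ℝ,
      (∀ i j, e i ⬝ᵥ G *ᵥ e j = if i = j then 1 else 0) ∧ ∀ i, e i ⬝ᵥ G *ᵥ u = 0 := by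
  obtain ⟨L, rfl, hL⟩ := PosDef.exists_eq_transpose_mul_self hG
  have key : ∀ a b : Fin (m + 1) → ℝ, a ⬝ᵥ (Lᵀ * L) *ᵥ b = (L *ᵥ a) ⬝ᵥ (L *ᵥ b) := fun a b => by
    rw [← mulVec_mulVec, dotProduct_mulVec, vecMul_transpose]
  have hin : ∀ a b : Vec (m + 1), inner ℝ a b = b.ofLp ⬝ᵥ a.ofLp := fun a b => by
    rw [EuclideanSpace.inner_eq_star_dotProduct]; simp
  have ho : Orthonormal ℝ (({0} : Set (Fin (m + 1))).domRestrict
      fun _ => (WithLp.toLp 2 (L *ᵥ u) : Vec (m + 1))) := by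
    rw [orthonormal_iff_ite]
    intro i j
    have : i = j := Subsingleton.elim _ _
    rw [if_pos this]
    simp only [Set.domRestrict_apply]
    rw [hin, ← key, hu]
  obtain ⟨b, hb⟩ := ho.exists_orthonormalBasis_extension_of_card_eq (by simp)
  have hb0 := hb 0 rfl
  have hinv : ∀ a, L *ᵥ (L⁻¹ *ᵥ a) = a := fun a => by
    rw [mulVec_mulVec, mul_nonsing_inv _ hL, one_mulVec]
  have hbo := orthonormal_iff_ite.1 b.orthonormal
  refine ⟨fun i => L⁻¹ *ᵥ (b i.succ).ofLp, fun i j => ?_, fun i => ?_⟩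
  · rw [key, hinv, hinv, ← hin, hbo]
    simp [eq_comm]
  · rw [key, hinv]
    have := hbo 0 i.succ
    rw [hin, hb0, if_neg (Fin.succ_ne_zero i).symm] at this
    exact this

/-- The trace may be computed in the orthonormal basis consisting of u and the e_i, and the
direction u contributes nothing because Ru = 0. -/
theorem sum_frame_eq_trace {m : ℕ} {G R : Matrix (Fin (m + 1)) (Fin (m + 1)) ℝ} (hG : Gᵀ = G)
    {u : Fin (m + 1) → ℝ} (hu : u ⬝ᵥ G *ᵥ u = 1) (hR : R *ᵥ u = 0)
    {e : Fin m → Fin (m + 1) → ℝ} (he : ∀ i j, e i ⬝ᵥ G *ᵥ e j = if i = j then 1 else 0)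
    (heu : ∀ i, e i ⬝ᵥ G *ᵥ u = 0) : ∑ i, (R *ᵥ e i) ⬝ᵥ G *ᵥ e i = R.trace := by
  let P : Matrix (Fin (m + 1)) (Fin (m + 1)) ℝ := Matrix.of (Fin.cons u e)
  have hent : ∀ (B : Matrix (Fin (m + 1)) (Fin (m + 1)) ℝ) a b,
      (P * (B * Pᵀ)) a b = P a ⬝ᵥ B *ᵥ P b := fun B a b => rfl
  have hP0 : P 0 = u := rfl
  have hPs : ∀ i : Fin m, P i.succ = e i := fun _ => rfl
  have hP : P * (G * Pᵀ) = 1 := by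
    ext a b
    rw [hent, Matrix.one_apply]
    refine Fin.cases ?_ (fun i => ?_) a <;> refine Fin.cases ?_ (fun j => ?_) b
    · rw [hP0, hu, if_pos rfl]
    · have := heu j
      rw [dotProduct_mulVec, ← mulVec_transpose, hG, dotProduct_comm] at this
      rw [hP0, hPs, this, if_neg (Fin.succ_ne_zero j).symm]
    · rw [hP0, hPs, heu, if_neg (Fin.succ_ne_zero i)]
    · rw [hPs, hPs, he]
      simp
  have h1 : (G * Pᵀ) * P = 1 := mul_eq_one_comm.1 hP
  have h2 : (P * ((Rᵀ * G) * Pᵀ)).trace = R.trace := by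
    rw [Matrix.trace_mul_comm, Matrix.mul_assoc, Matrix.mul_assoc, ← Matrix.mul_assoc G, h1,
      Matrix.mul_one, trace_transpose]
  rw [← h2, Matrix.trace, Fin.sum_univ_succ]
  have h3 : ∀ a, a ⬝ᵥ (Rᵀ * G) *ᵥ a = (R *ᵥ a) ⬝ᵥ G *ᵥ a := fun a => by
    rw [← mulVec_mulVec, dotProduct_mulVec, vecMul_transpose]
  simp only [diag_apply, hent, h3]
  rw [hP0, hR, zero_dotProduct, zero_add]
  rfl

end Frames

/-! ### Ricci curvature as the trace of the curvature -/

section Ricci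

variable {m : ℕ} {M : Type*} [TopologicalSpace M]
  [ChartedSpace (EuclideanSpace ℝ (Fin (m + 1))) M]
  [IsManifold (𝓡 (m + 1)) ∞ M] {F : TangentBundle (𝓡 (m + 1)) M → ℝ}

theorem gInner_eq_dotProduct (p : M) (v a b : Vec (m + 1)) : gInner F p v a b =
    a.ofLp ⬝ᵥ (gMatrix (inChart F p) (extChartAt (𝓡 (m + 1)) p p) v).mulVec b.ofLp := by
  simp only [gInner, dotProduct, Matrix.mulVec, Finset.mul_sum, gMatrix, Matrix.of_apply]
  exact Finset.sum_congr rfl fun i _ => Finset.sum_congr rfl fun j _ => by ring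

theorem gInner_self (hF : IsFinslerStructure F) (p : M) {v : Vec (m + 1)} (hv : v ≠ 0) :
    gInner F p v v v = F ⟨p, v⟩ ^ 2 := by
  have := (isLocalFinsler_inChart hF p).sum_sum_gLow_mul (mem_extChartAt_target p) hv
  rw [energy, inChart_self] at this
  exact this

/-- For an adapted frame the denominator of each flag curvature is F², which cancels the prefactor.
The sum is then a trace, so the frame chosen in the definition is immaterial. -/
theorem ricci_eq_trace (hF : IsFinslerStructure F) (p : M) {v : Vec (m + 1)} (hv : v ≠ 0)
    (hR : ∀ i, ∑ j, curvCoeff (inChart F p) i j (extChartAt (𝓡 (m + 1)) p p) v * v j = 0) :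
    ricci F p v = ∑ i, curvCoeff (inChart F p) i i (extChartAt (𝓡 (m + 1)) p p) v := by
  classical
  have hL := isLocalFinsler_inChart hF p
  have hp := mem_extChartAt_target (I := 𝓡 (m + 1)) p
  set G := gMatrix (inChart F p) (extChartAt (𝓡 (m + 1)) p p) v with hG
  have hsymm : G.transpose = G := by
    ext i j
    exact hL.gLow_symm hp hv j i
  have hF0 : F ⟨p, v⟩ ≠ 0 := fun h0 => hv (hF.apply_eq_zero_iff.1 h0)
  set u : Vec (m + 1) := (F ⟨p, v⟩)⁻¹ • v with hu
  have hGv : v.ofLp ⬝ᵥ G.mulVec v.ofLp = F ⟨p, v⟩ ^ 2 := by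
    rw [← gInner_self hF p hv, gInner_eq_dotProduct]
  have hGu : u.ofLp ⬝ᵥ G.mulVec u.ofLp = 1 := by
    rw [hu, WithLp.ofLp_smul, Matrix.mulVec_smul, dotProduct_smul, smul_dotProduct, hGv]
    simp only [smul_eq_mul]
    field_simp
  have hex : ∃ e : Fin m → Vec (m + 1), IsAdapted F p v e := by
    obtain ⟨e, he, heu⟩ := exists_frame (hL.posDef _ hp v hv) hGu
    refine ⟨fun i => WithLp.toLp 2 (e i), fun i j => ?_, fun i => ?_⟩
    · exact (gInner_eq_dotProduct p v _ _).trans (he i j)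
    · refine (gInner_eq_dotProduct p v _ _).trans ?_
      have := heu i
      rw [hu, WithLp.ofLp_smul, Matrix.mulVec_smul, dotProduct_smul, smul_eq_mul] at this
      exact (mul_eq_zero.1 this).resolve_left (inv_ne_zero hF0)
  have hcond : (show TangentSpace (𝓡 (m + 1)) p from v) ≠ 0 ∧ ∃ e, IsAdapted F p v e := ⟨hv, hex⟩
  have hric : ricci F p v = F ⟨p, v⟩ ^ 2 * ∑ i, flagCurvature F p v (hcond.2.choose i) :=
    dif_pos hcond
  rw [hric]
  obtain ⟨he, hev⟩ := hcond.2.choose_spec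
  set e : Fin m → Vec (m + 1) := hcond.2.choose with he'
  set R : Matrix (Fin (m + 1)) (Fin (m + 1)) ℝ := Matrix.of fun i j =>
    curvCoeff (inChart F p) i j (extChartAt (𝓡 (m + 1)) p p) v with hRdef
  have hev' : ∀ i, (e i).ofLp ⬝ᵥ G.mulVec v.ofLp = 0 := fun i =>
    (gInner_eq_dotProduct p v (e i) v).symm.trans (hev i)
  have hev'' : ∀ i, v.ofLp ⬝ᵥ G.mulVec (e i).ofLp = 0 := fun i => by
    rw [Matrix.dotProduct_mulVec, ← Matrix.mulVec_transpose, hsymm, dotProduct_comm, hev']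
  have hRv : R.mulVec v.ofLp = 0 := funext hR
  have htr := sum_frame_eq_trace (R := R) (e := fun i => (e i).ofLp) hsymm hGu
    (by rw [hu, WithLp.ofLp_smul, Matrix.mulVec_smul, hRv, smul_zero])
    (fun i j => (gInner_eq_dotProduct p v (e i) (e j)).symm.trans (he i j))
    (fun i => by rw [hu, WithLp.ofLp_smul, Matrix.mulVec_smul, dotProduct_smul, hev', smul_zero])
  change _ = R.trace
  rw [← htr, Finset.mul_sum]
  refine Finset.sum_congr rfl fun i _ => ?_
  have h1 : gInner F p v (e i) (e i) = 1 := (he i i).trans (if_pos rfl)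
  have h2 : gInner F p v v (e i) = 0 := (gInner_eq_dotProduct p v v (e i)).trans (hev'' i)
  change F ⟨p, v⟩ ^ 2 * (gInner F p v (curvature F p v (e i)) (e i) /
    (F ⟨p, v⟩ ^ 2 * gInner F p v (e i) (e i) - gInner F p v v (e i) ^ 2)) = _
  rw [h1, h2, show gInner F p v (curvature F p v (e i)) (e i) = _ from
    gInner_eq_dotProduct p v (curvature F p v (e i)) (e i)]
  have h3 : (curvature F p v (e i) : Vec (m + 1)).ofLp = R.mulVec (e i).ofLp := rfl
  rw [h3]
  field_simp
  ring

theorem ricci_smul (hF : IsFinslerStructure F) (p : M) {v : Vec (m + 1)} (hv : v ≠ 0)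
    (hR : ∀ i, ∑ j, curvCoeff (inChart F p) i j (extChartAt (𝓡 (m + 1)) p p) v * v j = 0)
    {a : ℝ} (ha : 0 < a) : ricci F p (a • v : Vec (m + 1)) =
      a ^ 2 * ∑ i, curvCoeff (inChart F p) i i (extChartAt (𝓡 (m + 1)) p p) v := by
  have h1 : ∀ i j, curvCoeff (inChart F p) i j (extChartAt (𝓡 (m + 1)) p p) (a • v) =
      a ^ 2 * curvCoeff (inChart F p) i j (extChartAt (𝓡 (m + 1)) p p) v := fun i j => by
    have := (isLocalFinsler_inChart hF p).homog_curvCoeff i j _ (mem_extChartAt_target p) v hv a ha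
    exact_mod_cast this
  rw [ricci_eq_trace hF p (smul_ne_zero ha.ne' hv)]
  · simp only [h1, Finset.mul_sum]
  · intro i
    calc _ = a ^ 3 * ∑ j, curvCoeff (inChart F p) i j (extChartAt (𝓡 (m + 1)) p p) v * v j := by
          rw [Finset.mul_sum]
          refine Finset.sum_congr rfl fun j _ => ?_
          rw [h1, PiLp.smul_apply, smul_eq_mul]
          ring
      _ = 0 := by rw [hR, mul_zero]

end Ricci

/-! ### Weights along geodesics -/

section Weights

variable {n : ℕ} {M : Type*} [TopologicalSpace M] [ChartedSpace (EuclideanSpace ℝ (Fin n)) M]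
  [IsManifold (𝓡 n) ∞ M] {F ψ : TangentBundle (𝓡 n) M → ℝ}

/-- At an interior time, continuity of the velocity in a chart is enough for regularity nearby. This
is used for the geodesic selected in `geodesicThrough`, whose velocity is prescribed only at 0. -/
theorem IsGeodesicOn.isRegularGeodesic_nhds (hF : IsFinslerStructure F) {γ : ℝ → M} {S : Set ℝ}
    {t : ℝ} (hS : IsOpen S) (h : IsGeodesicOn F γ S) (ht : t ∈ S)
    (h0 : (velocity (n := n) γ S t).2 ≠ 0) :
    ∃ T ⊆ S, IsOpen T ∧ t ∈ T ∧ IsRegularGeodesic F γ T ∧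
      velocity (n := n) γ T t = velocity γ S t := by
  have hu : UniqueDiffOn ℝ S := hS.uniqueDiffOn
  have hr := h.geodRep hF hu ht h0 (mem_extChartAt_source (γ t))
  have hev : ∀ᶠ s in 𝓝 t, s ∈ S ∧ (velocity (n := n) γ S s).2 ≠ 0 := by
    have h1 := hr.velocity_eventually hu
    have h2 := hr.rep
    have h3 := hr.acc.continuousWithinAt.eventually_ne hr.ne_zero
    rw [hS.nhdsWithin_eq ht] at h1 h2 h3
    filter_upwards [h1, h2, h3, hS.mem_nhds ht] with s h1 h2 h3 hs
    refine ⟨hs, ?_⟩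
    rw [h1]
    exact tangentOfChart_snd_ne_zero _ h2.1 h3
  obtain ⟨T, hT, hTo, htT⟩ := eventually_nhds_iff.1 hev
  have hTS : T ⊆ S := fun s hs => (hT s hs).1
  have hrep : ∀ s ∈ T, GeodRep F γ S s (γ s) (fun r => extChartAt (𝓡 n) (γ s) (γ r))
      (derivWithin (fun r => extChartAt (𝓡 n) (γ s) (γ r)) S) := fun s hs =>
    h.geodRep hF hu (hTS hs) (hT s hs).2 (mem_extChartAt_source (γ s))
  refine ⟨T, hTS, hTo, htT, .of_geodRep hF hTo.uniqueDiffOn (h.1.mono hTS) fun s hs =>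
    ⟨γ s, _, _, (hrep s hs).mono hTS hs⟩, ?_⟩
  rw [((hrep t htT).mono hTS htT).velocity_eq hTo.uniqueDiffOn, hr.velocity_eq hu]

theorem velocity_congr_of_eventuallyEq {γ γ' : ℝ → M} {S : Set ℝ} {t : ℝ} (h : γ =ᶠ[𝓝 t] γ') :
    velocity (n := n) γ S t = velocity γ' S t := by
  have h1 := (h.filter_mono nhdsWithin_le_nhds : γ =ᶠ[𝓝[S] t] γ').mfderivWithin_eq (I := 𝓘(ℝ, ℝ))
    (I' := 𝓡 n) h.self_of_nhds
  unfold velocity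
  have h2 : ∀ (p q : M) (a : Vec n) (b : Vec n), p = q → a = b →
      (⟨p, a⟩ : TangentBundle (𝓡 n) M) = ⟨q, b⟩ := by
    rintro p q a b rfl rfl
    rfl
  exact h2 _ _ _ _ h.self_of_nhds (congrArg (fun L : ℝ →L[ℝ] Vec n => L 1) h1)

theorem velocity_of_mem_nhds {γ : ℝ → M} {S S' : Set ℝ} {t : ℝ} (hS : S ∈ 𝓝 t) (hS' : S' ∈ 𝓝 t) :
    velocity (n := n) γ S t = velocity γ S' t := by
  rw [velocity, velocity, mfderivWithin_of_mem_nhds hS, mfderivWithin_of_mem_nhds hS']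

/-- By local uniqueness the selected geodesic is s ↦ γ(as + t) near 0. Its velocity carries a factor
a, which the weight ignores by 0-homogeneity. -/
theorem alongCurve_geodesicThrough (hF : IsFinslerStructure F) (hψ : IsWeight ψ) {γ : ℝ → M}
    {S : Set ℝ} {t a : ℝ} (hS : IsOpen S) (h : IsRegularGeodesic F γ S) (ht : t ∈ S) (ha : 0 < a) :
    alongCurve ψ (geodesicThrough F (γ t) (a • (velocity (n := n) γ S t).2)) univ =ᶠ[𝓝 0]
      fun s => alongCurve ψ γ S (a * s + t) := by
  have hop : IsOpen ((fun s : ℝ => a * s + t) ⁻¹' S) := hS.preimage (by fun_prop)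
  have h0 : (0 : ℝ) ∈ (fun s : ℝ => a * s + t) ⁻¹' S := by simpa using ht
  have hu : UniqueDiffOn ℝ S := hS.uniqueDiffOn
  have h1 := h.affine hF hu ha t hop.uniqueDiffOn
  have hvel : ∀ s, a * s + t ∈ S → _ := fun s hs => h.velocity_affine hF hu ha t hop.uniqueDiffOn hs
  set W : TangentBundle (𝓡 n) M := ⟨γ t, a • (velocity (n := n) γ S t).2⟩ with hW
  have hv0 : velocity (n := n) (fun s => γ (a * s + t)) ((fun s : ℝ => a * s + t) ⁻¹' S) 0 = W := by
    rw [hvel 0 h0]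
    have e : a * 0 + t = t := by ring
    rw [e]
  obtain ⟨δ, hδ, hsub⟩ := Metric.isOpen_iff.1 hop 0 h0
  rw [Real.ball_eq_Ioo, zero_sub, zero_add] at hsub
  have huI : UniqueDiffOn ℝ (Ioo (-δ) δ) := isOpen_Ioo.uniqueDiffOn
  have hex : ∃ γ : ℝ → M, ∃ δ > 0, IsGeodesicOn F γ (Ioo (-δ) δ) ∧
      velocity γ (Ioo (-δ) δ) 0 = W := by
    refine ⟨_, δ, hδ, (h1.mono hF hop.uniqueDiffOn huI hsub).isGeodesicOn, ?_⟩
    rw [h1.velocity_mono hF hop.uniqueDiffOn huI hsub ⟨by linarith, hδ⟩, hv0]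
  have hW0 : W.2 ≠ 0 := smul_ne_zero ha.ne' (h.velocity_ne_zero t ht)
  have hthr : geodesicThrough F (γ t) (a • (velocity (n := n) γ S t).2) = hex.choose := dif_pos hex
  rw [hthr]
  obtain ⟨δ', hδ', hg, hgv⟩ := hex.choose_spec
  set γ' := hex.choose
  have h0' : (0 : ℝ) ∈ Ioo (-δ') δ' := ⟨by linarith, hδ'⟩
  obtain ⟨T, hTS, hTo, h0T, hTr, hTv⟩ := hg.isRegularGeodesic_nhds hF isOpen_Ioo h0' (by
    rw [hgv]; exact hW0)
  have heq := IsRegularGeodesic.eventuallyEq hF hTo hop hTr h1 h0T h0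
    (by rw [hTv, hgv, hv0])
  filter_upwards [eventually_eventually_nhds.2 heq, hop.mem_nhds h0] with s hs hsS
  rw [alongCurve, velocity_congr_of_eventuallyEq hs, velocity_of_mem_nhds univ_mem
    (hop.mem_nhds hsS), hvel s hsS]
  exact hψ.homog (γ (a * s + t)) _ a (h.velocity_ne_zero _ hsS) ha

theorem dWeight_smul (hF : IsFinslerStructure F) (hψ : IsWeight ψ) {γ : ℝ → M}
    {S : Set ℝ} {t a : ℝ} (hS : IsOpen S) (h : IsRegularGeodesic F γ S) (ht : t ∈ S) (ha : 0 < a) :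
    dWeight F ψ (γ t) (a • (velocity (n := n) γ S t).2) = a * deriv (alongCurve ψ γ S) t := by
  unfold dWeight
  rw [(alongCurve_geodesicThrough hF hψ hS h ht ha).deriv_eq]
  have := deriv_comp_mul_left a (fun s => alongCurve ψ γ S (s + t)) 0
  rw [this, deriv_comp_add_const, smul_eq_mul]
  simp

theorem ddWeight_smul (hF : IsFinslerStructure F) (hψ : IsWeight ψ) {γ : ℝ → M}
    {S : Set ℝ} {t a : ℝ} (hS : IsOpen S) (h : IsRegularGeodesic F γ S) (ht : t ∈ S) (ha : 0 < a) :
    ddWeight F ψ (γ t) (a • (velocity (n := n) γ S t).2) =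
      a ^ 2 * deriv (deriv (alongCurve ψ γ S)) t := by
  unfold ddWeight
  rw [(alongCurve_geodesicThrough hF hψ hS h ht ha).deriv.deriv_eq]
  have h1 : deriv (fun s => alongCurve ψ γ S (a * s + t)) =
      fun s => a * deriv (alongCurve ψ γ S) (a * s + t) := funext fun s => by
    have := deriv_comp_mul_left a (fun s => alongCurve ψ γ S (s + t)) s
    rw [this, deriv_comp_add_const, smul_eq_mul]
  rw [h1, deriv_const_mul_field]
  have := deriv_comp_mul_left a (fun s => deriv (alongCurve ψ γ S) (s + t)) 0
  rw [this, deriv_comp_add_const, smul_eq_mul]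
  simp only [mul_zero, zero_add]
  ring

theorem velocity_comp {γ : ℝ → M} {S : Set ℝ} {φ : ℝ → ℝ} {τ φ' : ℝ} (hS : S ∈ 𝓝 (φ τ))
    (hγ : ContMDiffOn 𝓘(ℝ, ℝ) (𝓡 n) ∞ γ S) (hφ : HasDerivAt φ φ' τ) :
    velocity (n := n) (γ ∘ φ) univ τ = ⟨γ (φ τ), φ' • (velocity (n := n) γ S (φ τ)).2⟩ := by
  have h1 : MDifferentiableAt 𝓘(ℝ, ℝ) (𝓡 n) γ (φ τ) :=
    (hγ.contMDiffAt hS).mdifferentiableAt (by simp)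
  have h2 : HasMFDerivAt 𝓘(ℝ, ℝ) 𝓘(ℝ, ℝ) φ τ (ContinuousLinearMap.toSpanSingleton ℝ φ') :=
    hφ.hasFDerivAt.hasMFDerivAt
  have h3 := (h1.hasMFDerivAt.comp τ h2).mfderiv
  simp only [velocity, mfderivWithin_univ, mfderivWithin_of_mem_nhds hS]
  refine congrArg (fun w : Vec n => (⟨γ (φ τ), w⟩ : TangentBundle (𝓡 n) M)) ?_
  refine (congrArg (fun L : ℝ →L[ℝ] Vec n => L 1) h3).trans ?_
  change (show ℝ →L[ℝ] Vec n from mfderiv 𝓘(ℝ, ℝ) (𝓡 n) γ (φ τ)) ((1 : ℝ) • φ') =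
    φ' • (show ℝ →L[ℝ] Vec n from mfderiv 𝓘(ℝ, ℝ) (𝓡 n) γ (φ τ)) 1
  rw [← map_smul]
  simp

end Weights

/-! ### The interval `[0, l)` -/

section TimeInterval

variable {l : EReal} {t : ℝ}

theorem exists_between_timeInterval (ht : t ∈ timeInterval l) :
    ∃ b, t < b ∧ Icc 0 b ⊆ timeInterval l := by
  obtain ⟨b, hb, hbl⟩ := EReal.lt_iff_exists_real_btwn.1 ht.2
  exact ⟨b, EReal.coe_lt_coe_iff.1 hb, fun s hs =>
    ⟨hs.1, (EReal.coe_le_coe_iff.2 hs.2).trans_lt hbl⟩⟩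

theorem ordConnected_timeInterval : (timeInterval l).OrdConnected :=
  ⟨fun _ ha _ hb _ hs => ⟨ha.1.trans hs.1, (EReal.coe_le_coe_iff.2 hs.2).trans_lt hb.2⟩⟩

theorem zero_mem_timeInterval (hl : 0 < l) : (0 : ℝ) ∈ timeInterval l := ⟨le_rfl, by simpa using hl⟩

theorem timeInterval_mem_nhds (ht : t ∈ timeInterval l) (h0 : 0 < t) : timeInterval l ∈ 𝓝 t := by
  obtain ⟨b, hb, hsub⟩ := exists_between_timeInterval ht
  exact mem_of_superset (Icc_mem_nhds h0 hb) hsub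

theorem uniqueDiffOn_timeInterval (hl : 0 < l) : UniqueDiffOn ℝ (timeInterval l) := by
  obtain ⟨b, hb, hsub⟩ := exists_between_timeInterval (zero_mem_timeInterval hl)
  exact uniqueDiffOn_convex ordConnected_timeInterval.convex
    ⟨b / 2, interior_mono hsub (by rw [interior_Icc]; constructor <;> linarith)⟩

theorem isOpen_timeInterval_inter : IsOpen (timeInterval l ∩ Ioi 0) := by
  refine isOpen_iff_mem_nhds.2 fun t ht => ?_
  exact inter_mem (timeInterval_mem_nhds ht.1 ht.2) (Ioi_mem_nhds ht.2)

end TimeInterval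

/-! ### Jacobi fields along a geodesic -/

theorem contDiffAt_det {m : ℕ} {A : ℝ → Matrix (Fin m) (Fin m) ℝ} {t : ℝ} {k : WithTop ℕ∞}
    (hA : ∀ i j, ContDiffAt ℝ k (fun s => A s i j) t) : ContDiffAt ℝ k (fun s => (A s).det) t := by
  simp only [Matrix.det_apply]
  exact ContDiffAt.sum fun σ _ => (contDiffAt_prod fun i _ => hA (σ i) i).const_smul _

theorem SmoothOnSlit.comp_contDiffAt {n : ℕ} {O : Set (Vec n)} {f : Vec n → Vec n → ℝ}
    (hf : SmoothOnSlit O f) (hO : IsOpen O) {y w : ℝ → Vec n} {t : ℝ} (hx : y t ∈ O)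
    (hv : w t ≠ 0) (hy : ContDiffAt ℝ ∞ y t) (hw : ContDiffAt ℝ ∞ w t) :
    ContDiffAt ℝ ∞ (fun s => f (y s) (w s)) t :=
  ContDiffAt.comp t (g := fun p : Vec n × Vec n => f p.1 p.2) (f := fun s => (y s, w s))
    (hf.contDiffAt hO hx hv) (hy.prodMk hw)

section AlongGeodesic

variable {n : ℕ} {M : Type*} [TopologicalSpace M] [T2Space M]
  [ChartedSpace (EuclideanSpace ℝ (Fin n)) M]
  [IsManifold (𝓡 n) ∞ M] {F ψ : TangentBundle (𝓡 n) M → ℝ}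
  {x : M} {v : Vec n} {l : EReal} {η : ℝ → M} {t : ℝ}

/-- A segment of η reaching past t is embedded in a family whose time domain is open and contains
both 0 and t. Since velocities agree, smoothness of the family passes to quantities along η. -/
theorem exists_isGeodFamily_of_mem (hF : IsFinslerStructure F) (hl : 0 < l)
    (hη : IsRegularGeodesic F η (timeInterval l))
    (hη0 : velocity (n := n) η (timeInterval l) 0 = ⟨x, v⟩) (ht : t ∈ timeInterval l) :
    ∃ U J Γ, IsGeodFamily F x U J Γ ∧ v ∈ U ∧ t ∈ J ∧
      (∀ᶠ s in 𝓝[timeInterval l] t, velocity (n := n) η (timeInterval l) s = velocity (Γ v) J s) ∧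
      (0 < t → ∀ᶠ s in 𝓝 t, 0 < s ∧ s ∈ J ∧
        velocity (n := n) η (timeInterval l) s = velocity (Γ v) J s) := by
  obtain ⟨b, htb, hsub⟩ := exists_between_timeInterval ht
  have hb : 0 < b := ht.1.trans_lt htb
  have hu := uniqueDiffOn_timeInterval hl
  have hub : UniqueDiffOn ℝ (Icc 0 b) := uniqueDiffOn_Icc hb
  have h0 : (0 : ℝ) ∈ Icc 0 b := ⟨le_rfl, hb.le⟩
  have hηb := hη.mono hF hu hub hsub
  have hη0b : velocity (n := n) η (Icc 0 b) 0 = ⟨x, v⟩ := by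
    rw [hη.velocity_mono hF hu hub hsub h0, hη0]
  have hv : v ≠ 0 := by
    have := hη.velocity_ne_zero 0 (zero_mem_timeInterval hl)
    rw [hη0] at this
    exact this
  obtain ⟨U, J, Γ, hΓ, hvU, hJ⟩ := exists_isGeodFamily hF hv hηb hb hη0b
  have heq : ∀ s ∈ Icc 0 b, velocity (n := n) η (timeInterval l) s = velocity (Γ v) J s :=
    fun s hs => by
      rw [← hη.velocity_mono hF hu hub hsub hs]
      exact velocity_family_eq hF hΓ.isOpen_right hηb hb (hΓ.regular v hvU)
        (by rw [hη0b, hΓ.velocity_zero v hvU]) hs ((Icc_subset_Icc_right hs.2).trans hJ)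
  refine ⟨U, J, Γ, hΓ, hvU, hJ ⟨ht.1, htb.le⟩, ?_, fun h0t => ?_⟩
  · filter_upwards [self_mem_nhdsWithin, nhdsWithin_le_nhds (Iio_mem_nhds htb)] with s hs hsb
      using heq s ⟨hs.1, hsb.le⟩
  · filter_upwards [Ioo_mem_nhds h0t htb] with s hs
      using ⟨hs.1, hJ ⟨hs.1.le, hs.2.le⟩, heq s ⟨hs.1.le, hs.2.le⟩⟩

theorem IsGeodFamily.contDiffAt_alongCurve {U : Set (Vec n)} {J : Set ℝ} {Γ : Vec n → ℝ → M}
    (hψ : IsWeight ψ) (h : IsGeodFamily F x U J Γ) (hv : v ∈ U) (ht : t ∈ J) :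
    ContDiffAt ℝ ∞ (alongCurve ψ (Γ v) J) t := by
  have hq : (v, t) ∈ famDomain U J Γ (Γ v t) := ⟨⟨hv, ht⟩, mem_extChartAt_source _⟩
  have hN := (h.isOpen_famDomain (Γ v t)).mem_nhds hq
  have hline : ContDiffAt ℝ ∞ (fun s : ℝ => (v, s)) t := contDiffAt_const.prodMk contDiffAt_id
  have h1 : ContDiffAt ℝ ∞ (fun s => inChart ψ (Γ v t) (famChart Γ (Γ v t) (v, s))
      (famVel Γ (Γ v t) (v, s))) t :=
    (smoothOnSlit_inChart hψ.smooth (Γ v t)).comp_contDiffAt (isOpen_target _)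
      (IsGeodFamily.mem_target hq) (h.famVel_ne_zero hq)
      (((h.contDiffOn_famChart _).contDiffAt hN).comp t hline)
      (((h.contDiffOn_famVel _).contDiffAt hN).comp t hline)
  refine h1.congr_of_eventuallyEq ?_
  filter_upwards [h.eventually_mem hq] with s hs
  rw [alongCurve, h.velocity_eq hs, inChart_def]

theorem contDiffAt_alongCurve (hF : IsFinslerStructure F) (hψ : IsWeight ψ) (hl : 0 < l)
    (hη : IsRegularGeodesic F η (timeInterval l)) (ht : t ∈ timeInterval l) (h0 : 0 < t) :
    ContDiffAt ℝ ∞ (alongCurve ψ η (timeInterval l)) t := by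
  have hη0 := rfl (a := velocity (n := n) η (timeInterval l) 0)
  obtain ⟨U, J, Γ, hΓ, hv, htJ, -, hev⟩ := exists_isGeodFamily_of_mem hF hl hη hη0 ht
  refine (hΓ.contDiffAt_alongCurve hψ hv htJ).congr_of_eventuallyEq ?_
  filter_upwards [hev h0] with s hs
  rw [alongCurve, hs.2.2, alongCurve]

theorem continuousOn_alongCurve (hF : IsFinslerStructure F) (hψ : IsWeight ψ) (hl : 0 < l)
    (hη : IsRegularGeodesic F η (timeInterval l)) :
    ContinuousOn (alongCurve ψ η (timeInterval l)) (timeInterval l) := fun t ht => by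
  obtain ⟨x, v, hη0⟩ : ∃ (x : M) (v : Vec n), velocity (n := n) η (timeInterval l) 0 = ⟨x, v⟩ :=
    ⟨_, _, rfl⟩
  obtain ⟨U, J, Γ, hΓ, hv, htJ, hev, -⟩ := exists_isGeodFamily_of_mem hF hl hη hη0 ht
  have hev' : alongCurve ψ η (timeInterval l) =ᶠ[𝓝[timeInterval l] t] alongCurve ψ (Γ v) J := by
    filter_upwards [hev] with s hs
    rw [alongCurve, hs, alongCurve]
  exact (hΓ.contDiffAt_alongCurve hψ hv htJ).continuousAt.continuousWithinAt.congr_of_eventuallyEq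
    hev' (hev'.self_of_nhdsWithin ht)

theorem gInner_congr {V W : TangentBundle (𝓡 n) M} (h : V = W) (a b : Vec n) :
    gInner F V.1 V.2 a b = gInner F W.1 W.2 a b := by
  subst h
  rfl

theorem IsGeodFamily.gInner_jacobiField {U : Set (Vec n)} {J : Set ℝ} {Γ : Vec n → ℝ → M}
    (hF : IsFinslerStructure F) (h : IsGeodFamily F x U J Γ) {p : M}
    (hq : (v, t) ∈ famDomain U J Γ p) (ht : 0 < t)
    (hηv : velocity (n := n) η (timeInterval l) t = velocity (Γ v) J t) (a b : Vec n) :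
    gInner F (η t) (velocity (n := n) η (timeInterval l) t).2 (jacobiField F x v a t)
      (jacobiField F x v b t) = gForm (inChart F p) (famChart Γ p (v, t))
      (famVel Γ p (v, t)) (famJacobi Γ p a (v, t)) (famJacobi Γ p b (v, t)) := by
  have h1 := gInner_congr (F := F) hηv (jacobi Γ a v t) (jacobi Γ b v t)
  have h2 := h.gInner_eq hF hq (jacobi Γ a v t) (jacobi Γ b v t)
  rw [h.toChart_jacobi hq, h.toChart_jacobi hq] at h2
  have ha := h.jacobiField_eq hF hq.1.1 ht hq.1.2 a
  have hb := h.jacobiField_eq hF hq.1.1 ht hq.1.2 b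
  refine Eq.trans ?_ (h1.trans h2)
  exact congrArg₂ (fun a b : Vec n => gInner F (η t) (velocity (n := n) η (timeInterval l) t).2 a b)
    ha hb

end AlongGeodesic

/-! ### The Riccati inequality along η -/

section Riccati

variable {m : ℕ} {M : Type*} [TopologicalSpace M] [T2Space M]
  [ChartedSpace (EuclideanSpace ℝ (Fin (m + 1))) M]
  [IsManifold (𝓡 (m + 1)) ∞ M] {F : TangentBundle (𝓡 (m + 1)) M → ℝ}
  {x : M} {v : Vec (m + 1)} {l : EReal} {η : ℝ → M} {t : ℝ}

/-- The trace of the curvature `R_V`. -/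
def curvTrace (F : TangentBundle (𝓡 (m + 1)) M → ℝ) (V : TangentBundle (𝓡 (m + 1)) M) : ℝ :=
  ∑ i, curvCoeff (inChart F V.1) i i (extChartAt (𝓡 (m + 1)) V.1 V.1) V.2

/-- The Riccati inequality for the determinant of the Gram matrix of the Jacobi fields. -/
theorem jacobiGram_riccati (hF : IsFinslerStructure F) (hv : F ⟨x, v⟩ = 1)
    {e : Fin m → Vec (m + 1)} (he : IsAdapted F x v e) (hl : 0 < l)
    (hη : IsRegularGeodesic F η (timeInterval l))
    (hη0 : velocity (n := m + 1) η (timeInterval l) 0 = ⟨x, v⟩) (ht : t ∈ timeInterval l)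
    (h0 : 0 < t) {D : ℝ → ℝ} (hD : D = fun s => (jacobiGram F x v e η (timeInterval l) s).det)
    (hD0 : D t ≠ 0) :
    ContDiffAt ℝ ∞ D t ∧ 0 < D t ∧
    (∃ u : ℝ → ℝ, (∀ᶠ s in 𝓝 t, HasDerivAt (fun s => Real.log (D s)) (2 * u s) s) ∧
      ∃ u', HasDerivAt u u' t ∧
        u' ≤ -curvTrace F (velocity η (timeInterval l) t) - u t ^ 2 / m) ∧
    ∀ a : ℝ, 0 < a → ricci F (η t) (a • (velocity (n := m + 1) η (timeInterval l) t).2) =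
      a ^ 2 * curvTrace F (velocity η (timeInterval l) t) := by
  obtain ⟨U, J, Γ, hΓ, hvU, htJ, -, hev⟩ := exists_isGeodFamily_of_mem hF hl hη hη0 ht
  specialize hev h0
  -- Centring the chart at the point reached at time t makes its coordinates those of the tangent
  -- space there, so local curvature coefficients are the ones entering `curvTrace` and `ricci`.
  set p := Γ v t with hp
  have hL := isLocalFinsler_inChart hF p
  have hq : (v, t) ∈ famDomain U J Γ p := ⟨⟨hvU, htJ⟩, mem_extChartAt_source _⟩
  have hN := (hΓ.isOpen_famDomain p).mem_nhds hq
  have hline : ContDiffAt ℝ ∞ (fun s : ℝ => (v, s)) t := contDiffAt_const.prodMk contDiffAt_id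
  have hvel : velocity (n := m + 1) η (timeInterval l) t =
      ⟨p, famVel Γ p (v, t)⟩ := by
    rw [hev.self_of_nhds.2.2, hΓ.velocity_eq hq]
    exact tangentOfChart_self p _
  have hgram : ∀ᶠ s in 𝓝 t, D s = (Matrix.of fun a b : Fin m =>
      gForm (inChart F p) (famChart Γ p (v, s)) (famVel Γ p (v, s)) (famJacobi Γ p (e a) (v, s))
        (famJacobi Γ p (e b) (v, s))).det := by
    filter_upwards [hev, hΓ.eventually_mem hq] with s hs hsq
    rw [hD]
    refine congrArg Matrix.det ?_
    ext a b
    exact hΓ.gInner_jacobiField hF hsq hs.1 hs.2.2 (e a) (e b)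
  have hperp : ∀ a, gInner F x v v (e a) = 0 := fun a => by
    have hsum : ∀ a b : Vec (m + 1), gInner F x v a b = ∑ i, ∑ j,
        gLow (inChart F x) i j (extChartAt (𝓡 (m + 1)) x x) v * a i * b j := fun _ _ => rfl
    have h1 : gInner F x v (e a) v = 0 := he.2 a
    have h2 := (isLocalFinsler_inChart hF x).gLow_symm (mem_extChartAt_target x)
      (hΓ.fst_ne_zero hvU)
    rw [hsum, Finset.sum_comm] at h1
    rw [hsum, ← h1]
    refine Finset.sum_congr rfl fun i _ => Finset.sum_congr rfl fun j _ => ?_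
    rw [h2 i j]
    ring
  have hyw := hΓ.geodesic_nhds hF hq
  refine ⟨?_, ?_⟩
  · refine ContDiffAt.congr_of_eventuallyEq ?_ hgram
    refine contDiffAt_det fun a b => ?_
    simp only [Matrix.of_apply, gForm]
    have hvec : ∀ a i, ContDiffAt ℝ ∞ (fun s => famJacobi Γ p (e a) (v, s) i) t := fun a i =>
      (contDiffAt_piLp 2).1 (((hΓ.contDiffOn_famJacobi p (e a)).contDiffAt hN).comp t hline) i
    refine ContDiffAt.sum fun i _ => ContDiffAt.sum fun j _ => ContDiffAt.mul (.mul ?_ (hvec a i))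
      (hvec b j)
    exact (hL.smooth_gLow i j).comp_contDiffAt hL.isOpen (IsGeodFamily.mem_target hq)
      (hΓ.famVel_ne_zero hq) (((hΓ.contDiffOn_famChart p).contDiffAt hN).comp t hline)
      (((hΓ.contDiffOn_famVel p).contDiffAt hN).comp t hline)
  · have hric := IsLocalFinsler.log_det_gram_deriv_le (y := fun s => famChart Γ p (v, s))
      (w := fun s => famVel Γ p (v, s)) (Y := fun a s => famJacobi Γ p (e a) (v, s))
      (Z := fun a s => famJacobiDeriv Γ p (e a) (v, s)) hL hyw ?_ (fun a => ?_) (fun a => ?_)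
      (fun a b => hΓ.wronskian_symm hF hq (e a) (e b)) hgram hD0
    · have htr : curvTrace F (velocity η (timeInterval l) t) = ∑ i, curvCoeff (inChart F p) i i
          (famChart Γ p (v, t)) (famVel Γ p (v, t)) := by
        rw [hvel]
        rfl
      rw [htr]
      refine ⟨hric.1, hric.2, fun a ha => ?_⟩
      have h1 := ricci_smul hF p (v := famVel Γ p (v, t)) (hΓ.famVel_ne_zero hq)
        (fun i => hL.sum_curvCoeff_mul_velocity hyw i) ha
      refine Eq.trans ?_ h1
      have : ∀ V W : TangentBundle (𝓡 (m + 1)) M, V = W →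
          ricci F V.1 (a • V.2) = ricci F W.1 (a • W.2) := by
        rintro V W rfl
        rfl
      exact this _ _ hvel
    · filter_upwards [hΓ.eventually_mem hq] with s hs
      have := hΓ.energy_eq hF hs
      rw [hv, one_pow, energy] at this
      nlinarith [hF.nonneg (tangentOfChart p (famChart Γ p (v, s)) (famVel Γ p (v, s))),
        inChart_def F p (famChart Γ p (v, s)) (famVel Γ p (v, s))]
    · filter_upwards [hΓ.eventually_mem hq] with s hs
        using ⟨hΓ.hasDerivAt_famJacobi hs (e a), hΓ.hasDerivAt_famJacobiDeriv hF hs (e a)⟩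
    · filter_upwards [hΓ.eventually_mem hq] with s hs
        using hΓ.gForm_famVel_famJacobi_eq_zero hF hs (hperp a)

end Riccati

/-! ### The reparametrization -/

section Reparametrization

variable {n : ℕ} {ε : ℝ} {f : ℝ → ℝ} {l : EReal} {a b t τ : ℝ}

theorem paramDensity_pos : 0 < paramDensity n ε f t := Real.exp_pos _

theorem continuousOn_paramDensity {S : Set ℝ} (hf : ContinuousOn f S) :
    ContinuousOn (paramDensity n ε f) S :=
  Real.continuous_exp.comp_continuousOn (continuousOn_const.mul hf)

theorem intervalIntegrable_paramDensity (hf : ContinuousOn f (timeInterval l))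
    (ha : a ∈ timeInterval l) (hb : b ∈ timeInterval l) :
    IntervalIntegrable (paramDensity n ε f) volume a b :=
  ((continuousOn_paramDensity hf).mono
    (ordConnected_timeInterval.uIcc_subset ha hb)).intervalIntegrable

theorem strictMonoOn_paramFun (hl : 0 < l) (hf : ContinuousOn f (timeInterval l)) :
    StrictMonoOn (paramFun n ε f) (timeInterval l) := fun a ha b hb hab => by
  have h0 := zero_mem_timeInterval hl
  have h1 := intervalIntegral.integral_interval_sub_left
    (intervalIntegrable_paramDensity (n := n) (ε := ε) hf h0 hb)
    (intervalIntegrable_paramDensity hf h0 ha)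
  have h2 := intervalIntegral.intervalIntegral_pos_of_pos_on
    (intervalIntegrable_paramDensity (n := n) (ε := ε) hf ha hb)
    (fun _ _ => paramDensity_pos) hab
  rw [← h1] at h2
  exact sub_pos.1 h2

theorem hasDerivAt_paramFun (hl : 0 < l) (hf : ContinuousOn f (timeInterval l))
    (ht : t ∈ timeInterval l) (h0 : 0 < t) :
    HasDerivAt (paramFun n ε f) (paramDensity n ε f t) t := by
  have hc : ContinuousOn (paramDensity n ε f) (timeInterval l ∩ Ioi 0) :=
    (continuousOn_paramDensity hf).mono inter_subset_left
  exact intervalIntegral.integral_hasDerivAt_right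
    (intervalIntegrable_paramDensity hf (zero_mem_timeInterval hl) ht)
    (hc.stronglyMeasurableAtFilter isOpen_timeInterval_inter t ⟨ht, h0⟩)
    (hc.continuousAt (isOpen_timeInterval_inter.mem_nhds ⟨ht, h0⟩))

theorem contDiffAt_paramFun (hl : 0 < l) (hf : ContinuousOn f (timeInterval l))
    (hf' : ∀ t ∈ timeInterval l, 0 < t → ContDiffAt ℝ ∞ f t) (ht : t ∈ timeInterval l)
    (h0 : 0 < t) : ContDiffAt ℝ ∞ (paramFun n ε f) t := by
  have hop := isOpen_timeInterval_inter (l := l)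
  refine ContDiffOn.contDiffAt ?_ (hop.mem_nhds ⟨ht, h0⟩)
  rw [contDiffOn_infty_iff_deriv_of_isOpen hop]
  refine ⟨fun s hs =>
    (hasDerivAt_paramFun hl hf hs.1 hs.2).differentiableAt.differentiableWithinAt, ?_⟩
  refine ContDiffOn.congr (f := paramDensity n ε f) (fun s hs => ?_)
    fun s hs => (hasDerivAt_paramFun hl hf hs.1 hs.2).deriv
  exact ((contDiffAt_const.mul (hf' s hs.1 hs.2)).exp).contDiffWithinAt

theorem lintegral_Icc_paramDensity (hl : 0 < l) (hf : ContinuousOn f (timeInterval l))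
    (hb : b ∈ timeInterval l) : ∫⁻ s in Icc 0 b, ENNReal.ofReal (paramDensity n ε f s) =
      ENNReal.ofReal (paramFun n ε f b) := by
  have h1 := intervalIntegrable_paramDensity (n := n) (ε := ε) hf (zero_mem_timeInterval hl) hb
  rw [intervalIntegrable_iff_integrableOn_Ioc_of_le hb.1] at h1
  rw [paramFun, intervalIntegral.integral_of_le hb.1, ofReal_integral_eq_lintegral_ofReal h1
    (ae_of_all _ fun _ => paramDensity_pos.le)]
  exact setLIntegral_congr Ioc_ae_eq_Icc.symm

/-- The interval is a directed countable union of segments [0, q] with q rational, so by monotone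
convergence the end value is the supremum of the values φ(q). -/
theorem exists_lt_paramFun (hl : 0 < l) (hf : ContinuousOn f (timeInterval l))
    (hτ : ENNReal.ofReal τ < paramEnd n ε f l) : ∃ b ∈ timeInterval l, τ < paramFun n ε f b := by
  by_contra! hcon
  have hU : timeInterval l = ⋃ q : {q : ℚ // (q : ℝ) ∈ timeInterval l}, Icc (0 : ℝ) (q : ℚ) := by
    ext s
    simp only [mem_iUnion]
    constructor
    · intro hs
      obtain ⟨b, hb, hsub⟩ := exists_between_timeInterval hs
      obtain ⟨q, hq, hqb⟩ := exists_rat_btwn hb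
      exact ⟨⟨q, hsub ⟨hs.1.trans hq.le, hqb.le⟩⟩, hs.1, hq.le⟩
    · rintro ⟨q, hq⟩
      exact ordConnected_timeInterval.out (zero_mem_timeInterval hl) q.2 hq
  have hdir : Directed (· ⊆ ·)
      fun q : {q : ℚ // (q : ℝ) ∈ timeInterval l} => Icc (0 : ℝ) (q : ℚ) :=
    Monotone.directed_le fun p q hpq => Icc_subset_Icc_right (by exact_mod_cast hpq)
  refine hτ.not_ge ?_
  rw [paramEnd, hU, setLIntegral_iUnion_of_directed _ hdir]
  refine iSup_le fun q => ?_
  rw [lintegral_Icc_paramDensity hl hf q.2]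
  exact ENNReal.ofReal_le_ofReal (hcon _ q.2)

theorem continuousOn_paramFun (hf : ContinuousOn f (timeInterval l)) (hl : 0 < l)
    (hb : b ∈ timeInterval l) : ContinuousOn (paramFun n ε f) (Icc 0 b) := by
  have h0 := zero_mem_timeInterval hl
  have := intervalIntegral.continuousOn_primitive_interval (f := paramDensity n ε f)
    (μ := volume) (a := 0) (b := b)
    (((continuousOn_paramDensity hf).mono
      (ordConnected_timeInterval.uIcc_subset h0 hb)).integrableOn_compact isCompact_uIcc)
  rwa [uIcc_of_le hb.1] at this

/-- The intermediate value theorem gives a preimage below some b with φ(b) > τ; since φ(0) = 0, a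
positive τ has a positive preimage. -/
theorem paramInv_spec (hl : 0 < l) (hf : ContinuousOn f (timeInterval l)) (h0 : 0 < τ)
    (hτ : ENNReal.ofReal τ < paramEnd n ε f l) :
    paramInv n ε f l τ ∈ timeInterval l ∧ 0 < paramInv n ε f l τ ∧
      paramFun n ε f (paramInv n ε f l τ) = τ := by
  obtain ⟨b, hb, hτb⟩ := exists_lt_paramFun hl hf hτ
  have hz : paramFun n ε f 0 = 0 := intervalIntegral.integral_same
  obtain ⟨t, ht, htτ⟩ := intermediate_value_Icc hb.1 (continuousOn_paramFun (n := n) (ε := ε) hf hl hb)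
    (show τ ∈ Icc _ _ from ⟨by rw [hz]; exact h0.le, hτb.le⟩)
  have hex : ∃ t ∈ timeInterval l, paramFun n ε f t = τ :=
    ⟨t, ordConnected_timeInterval.out (zero_mem_timeInterval hl) hb ht, htτ⟩
  have h1 := Function.invFunOn_mem hex
  have h2 := Function.invFunOn_eq hex
  refine ⟨h1, lt_of_le_of_ne h1.1 fun h => h0.ne ?_, h2⟩
  have h3 : (0 : ℝ) = paramInv n ε f l τ := h
  rw [paramInv] at h3
  rw [← h2, ← h3, hz]

/-- `paramInv` is defined by choice. The local inverse from the inverse function theorem takes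
values in the same interval, and strict monotonicity of φ identifies the two near τ. -/
theorem contDiffAt_paramInv (hl : 0 < l) (hf : ContinuousOn f (timeInterval l))
    (hf' : ∀ t ∈ timeInterval l, 0 < t → ContDiffAt ℝ ∞ f t) (h0 : 0 < τ)
    (hτ : ENNReal.ofReal τ < paramEnd n ε f l) : ContDiffAt ℝ ∞ (paramInv n ε f l) τ ∧
      HasDerivAt (paramInv n ε f l) (paramDensity n ε f (paramInv n ε f l τ))⁻¹ τ := by
  obtain ⟨ht, ht0, heq⟩ := paramInv_spec hl hf h0 hτ
  set t := paramInv n ε f l τ with htdef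
  have hc := contDiffAt_paramFun (n := n) (ε := ε) hl hf hf' ht ht0
  have hd := hasDerivAt_paramFun (n := n) (ε := ε) hl hf ht ht0
  have hne : paramDensity n ε f t ≠ 0 := paramDensity_pos.ne'
  have hd' : HasFDerivAt (paramFun n ε f) (ContinuousLinearEquiv.unitsEquivAut ℝ
      (Units.mk0 _ hne) : ℝ →L[ℝ] ℝ) t := hd.hasFDerivAt_equiv hne
  have hinf : (∞ : WithTop ℕ∞) ≠ 0 := by simp
  have hr := (hc.hasStrictFDerivAt' hd' hinf).eventually_right_inverse
  have hL := hc.to_localInverse hd' hinf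
  have hL0 := hc.localInverse_apply_image hd' hinf
  set g := hc.localInverse hd' hinf with hg
  rw [heq] at hr hL hL0
  have hev : paramInv n ε f l =ᶠ[𝓝 τ] g := by
    have h1 : ∀ᶠ σ in 𝓝 τ, g σ ∈ timeInterval l :=
      hL.continuousAt.eventually_mem (by rw [hL0]; exact timeInterval_mem_nhds ht ht0)
    filter_upwards [h1, hr] with σ h1 h2
    have hex : ∃ t ∈ timeInterval l, paramFun n ε f t = σ := ⟨g σ, h1, h2⟩
    exact (strictMonoOn_paramFun (n := n) (ε := ε) hl hf).injOn (Function.invFunOn_mem hex) h1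
      ((Function.invFunOn_eq hex).trans h2.symm)
  have hP : ContDiffAt ℝ ∞ (paramInv n ε f l) τ := hL.congr_of_eventuallyEq hev
  refine ⟨hP, HasDerivAt.of_local_left_inverse hP.continuousAt hd hne ?_⟩
  filter_upwards [hev, hr] with σ h1 h2
  rw [h1]
  exact h2

theorem eventually_lt_paramEnd (h0 : 0 < τ) (hτ : ENNReal.ofReal τ < paramEnd n ε f l) :
    ∀ᶠ σ in 𝓝 τ, 0 < σ ∧ ENNReal.ofReal σ < paramEnd n ε f l :=
  (lt_mem_nhds h0).and (ENNReal.continuous_ofReal.continuousAt.eventually_lt_const hτ)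

end Reparametrization

/-! ### The differential inequality -/

section Scalar

/-- Since T' = exp(-k f(T)), one has T'' = -k f'(T) T'², so T'² factors out of the whole second
derivative. Here y plays the role of (log h)/c. -/
theorem deriv_deriv_exp_comp {T y w f h : ℝ → ℝ} {c k τ w' f' : ℝ}
    (hT : ∀ᶠ σ in 𝓝 τ, HasDerivAt T (Real.exp (k * f (T σ)))⁻¹ σ)
    (hy : ∀ᶠ s in 𝓝 (T τ), HasDerivAt y (w s) s) (hw : HasDerivAt w w' (T τ))
    (hf : HasDerivAt f f' (T τ)) (hh : h =ᶠ[𝓝 τ] fun σ => Real.exp (c * y (T σ))) :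
    deriv (deriv h) τ = c * h τ * (Real.exp (k * f (T τ)))⁻¹ ^ 2 *
      (w' - k * f' * w (T τ) + c * w (T τ) ^ 2) := by
  have hTτ := hT.self_of_nhds
  have h1 : ∀ᶠ σ in 𝓝 τ, HasDerivAt (fun σ => Real.exp (c * y (T σ)))
      (Real.exp (c * y (T σ)) * (c * (w (T σ) * Real.exp (-(k * f (T σ)))))) σ := by
    filter_upwards [hT, hTτ.continuousAt.eventually hy] with σ h1 h2
    rw [Real.exp_neg]
    exact ((h2.comp σ h1).const_mul c).exp
  have h2 : deriv h =ᶠ[𝓝 τ] fun σ =>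
      Real.exp (c * y (T σ)) * (c * (w (T σ) * Real.exp (-(k * f (T σ))))) :=
    hh.deriv.trans (h1.mono fun σ h => h.deriv)
  have h3 := h1.self_of_nhds.mul (((hw.comp τ hTτ).mul
    (((hf.comp τ hTτ).const_mul k).neg.exp)).const_mul c)
  rw [h2.deriv_eq, hh.self_of_nhds]
  refine h3.deriv.trans ?_
  simp only [Function.comp_apply, Pi.neg_apply, Pi.mul_apply, Real.exp_neg]
  ring

theorem sq_completion {κ ε a b : ℝ} (hκ : 0 < κ) :
    0 ≤ κ * ε ^ 2 * a ^ 2 + 2 * ε * a * b + b ^ 2 / κ := by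
  have : κ * ε ^ 2 * a ^ 2 + 2 * ε * a * b + b ^ 2 / κ = (κ * ε * a + b) ^ 2 / κ := by
    field_simp
    ring
  rw [this]
  positivity

/-- The algebra behind the Bishop inequality; `q` is the term `f'² / (N - n)`. -/
theorem bishop_algebra {m c ε f' f'' w R u' q : ℝ} (hm : 0 < m)
    (hu' : u' ≤ -R - (w + f') ^ 2 / m)
    (hq : 0 ≤ (1 - m * c) * w ^ 2 + 2 * ε * w * f' + f' ^ 2 + m * q) :
    (-f'' + u') - 2 * (ε - 1) / m * f' * w + c * w ^ 2 ≤ -(R + f'' - q) := by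
  have h1 : 0 ≤ ((1 - m * c) * w ^ 2 + 2 * ε * w * f' + f' ^ 2 + m * q) / m := by positivity
  have h2 : ((1 - m * c) * w ^ 2 + 2 * ε * w * f' + f' ^ 2 + m * q) / m =
      (w + f') ^ 2 / m + 2 * (ε - 1) / m * f' * w - c * w ^ 2 + q := by
    field_simp
    ring
  linarith

end Scalar

/-! ### The admissible range of N and ε -/

section Constants

variable {n : ℕ} {N : WithTop ℝ} {ε : ℝ}

/-- `f'² / (N - n)`, which is `0` for `N = ∞`. -/
def weightCorrection (n : ℕ) (N : WithTop ℝ) (f' : ℝ) : ℝ :=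
  match N with
  | ⊤ => 0
  | (N : ℝ) => f' ^ 2 / (N - n)

/-- Outside [1, n] the quantities N - n and N - 1 have the same sign. -/
theorem div_pos_of_range {N : ℝ} {n : ℕ} (hn : 2 ≤ n) (hN : N ≤ 1 ∨ (n : ℝ) ≤ N) (h1 : N ≠ 1)
    (h2 : N ≠ n) : 0 < (N - n) / (N - 1) := by
  have hn' : (2 : ℝ) ≤ n := by exact_mod_cast hn
  rcases hN with h | h
  · have := lt_of_le_of_ne h h1
    exact div_pos_of_neg_of_neg (by linarith) (by linarith)
  · have := lt_of_le_of_ne h (Ne.symm h2)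
    exact div_pos (by linarith) (by linarith)

/-- For finite N other than 1 and n, the condition on ε says precisely ε² (N - n)/(N - 1) < 1; for N
= ∞ it says ε² < 1. -/
theorem bishopConst_pos (hn : 2 ≤ n)
    (hN : N ≤ ((1 : ℝ) : WithTop ℝ) ∨ ((n : ℝ) : WithTop ℝ) ≤ N) (hε : EpsilonRange n N ε) :
    0 < bishopConst n N ε := by
  have hn' : (2 : ℝ) ≤ n := by exact_mod_cast hn
  have hm : 0 < 1 / ((n : ℝ) - 1) := by
    have : (0 : ℝ) < n - 1 := by linarith
    positivity
  induction N with
  | top =>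
    simp only [EpsilonRange] at hε
    simp only [bishopConst]
    have := abs_lt.1 hε
    refine mul_pos hm ?_
    nlinarith
  | coe N =>
    simp only [WithTop.coe_le_coe] at hN
    simp only [EpsilonRange] at hε
    simp only [bishopConst]
    split_ifs at hε ⊢ with h1 h2
    · exact hm
    · rw [h2, sub_self, zero_div, mul_zero, sub_zero, mul_one]
      exact hm
    · have hκ := div_pos_of_range hn hN h1 h2
      have h3 : ε ^ 2 < (N - 1) / (N - n) := Real.sqrt_lt_sqrt_iff (sq_nonneg _) |>.1 (by
        rwa [Real.sqrt_sq_eq_abs])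
      rw [← inv_div] at h3
      have h4 := mul_lt_mul_of_pos_right h3 hκ
      rw [inv_mul_cancel₀ hκ.ne'] at h4
      exact mul_pos hm (by linarith)

/-- With κ = (N - n)/(N - 1), the coefficient of w² is κε², and f'² together with the correction is
f'²/κ: a completed square. For N = ∞ it is (εw + f')². -/
theorem bishop_quadratic_nonneg (hn : 2 ≤ n)
    (hN : N ≤ ((1 : ℝ) : WithTop ℝ) ∨ ((n : ℝ) : WithTop ℝ) ≤ N) (hε : EpsilonRange n N ε)
    {f' : ℝ} (hf' : N = ((n : ℝ) : WithTop ℝ) → f' = 0) (w : ℝ) :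
    0 ≤ (1 - ((n : ℝ) - 1) * bishopConst n N ε) * w ^ 2 + 2 * ε * w * f' + f' ^ 2 +
      ((n : ℝ) - 1) * weightCorrection n N f' := by
  have hn' : (2 : ℝ) ≤ n := by exact_mod_cast hn
  have hm : (n : ℝ) - 1 ≠ 0 := by linarith
  induction N with
  | top =>
    simp only [bishopConst, weightCorrection]
    have := sq_nonneg (ε * w + f')
    have e : ((n : ℝ) - 1) * (1 / ((n : ℝ) - 1) * (1 - ε ^ 2)) = 1 - ε ^ 2 := by field_simp
    rw [e]
    linarith
  | coe N =>
    simp only [WithTop.coe_le_coe, WithTop.coe_inj] at hN hf'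
    simp only [EpsilonRange] at hε
    simp only [bishopConst, weightCorrection]
    split_ifs at hε ⊢ with h1 h2
    -- At N = 1 and ε = 0 the coefficient of w² is zero and the correction term equals -f'², so the
    -- form vanishes identically.
    · rw [hε, h1]
      have h3 : (1 : ℝ) - n ≠ 0 := by linarith
      have e : (1 - ((n : ℝ) - 1) * (1 / ((n : ℝ) - 1))) * w ^ 2 + 2 * 0 * w * f' + f' ^ 2 +
        ((n : ℝ) - 1) * (f' ^ 2 / (1 - n)) = 0 := by
        have : ((n : ℝ) - 1) * (f' ^ 2 / (1 - n)) = - f' ^ 2 := by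
          field_simp
          ring
        rw [this]
        field_simp
        ring
      rw [e]
    · rw [hf' h2, h2]
      have : ((n : ℝ) - 1) * (1 / ((n : ℝ) - 1) * (1 - ε ^ 2 * (((n : ℝ) - n) / (n - 1)))) = 1 := by
        rw [sub_self, zero_div]
        field_simp
        ring
      rw [this]
      simp
    · have hκ := div_pos_of_range hn hN h1 h2
      have h3 : N - 1 ≠ 0 := sub_ne_zero.2 h1
      have h4 : N - n ≠ 0 := sub_ne_zero.2 h2
      have h5 := sq_completion (ε := ε) (a := w) (b := f') hκ
      have e1 : ((n : ℝ) - 1) * (1 / ((n : ℝ) - 1) * (1 - ε ^ 2 * ((N - n) / (N - 1)))) =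
        1 - ε ^ 2 * ((N - n) / (N - 1)) := by field_simp
      have e2 : f' ^ 2 + ((n : ℝ) - 1) * (f' ^ 2 / (N - n)) = f' ^ 2 / ((N - n) / (N - 1)) := by
        field_simp
        ring
      rw [e1]
      linarith

end Constants

/-! ### The weighted Ricci curvature in uniform notation -/

section WeightedRicci

variable {n : ℕ} {M : Type*} [TopologicalSpace M] [ChartedSpace (EuclideanSpace ℝ (Fin n)) M]
  [IsManifold (𝓡 n) ∞ M] {F ψ : TangentBundle (𝓡 n) M → ℝ}

/-- Puts the finite cases under one formula. At N = n the correction reads 0 / 0, which is 0 by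
convention, in agreement with the limit when the derivative of the weight vanishes. -/
theorem weightedRicci_of_ne {N : WithTop ℝ} {p : M} {v : TangentSpace (𝓡 n) p} (hv : v ≠ 0)
    (h : N = ((n : ℝ) : WithTop ℝ) → dWeight F ψ p v = 0) : weightedRicci F ψ N p v =
      ((ricci F p v + ddWeight F ψ p v - weightCorrection n N (dWeight F ψ p v) : ℝ) : EReal) := by
  induction N with
  | top => simp [weightedRicci, hv, weightCorrection]
  | coe N =>
    simp only [WithTop.coe_inj] at h
    by_cases hN : N = n
    · simp [weightedRicci, hv, weightCorrection, hN, h hN]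
    · simp [weightedRicci, hv, weightCorrection, hN]

theorem weightedRicci_dim_eq_bot {p : M} {v : TangentSpace (𝓡 n) p} (hv : v ≠ 0)
    (h : dWeight F ψ p v ≠ 0) : weightedRicci F ψ ((n : ℝ) : WithTop ℝ) p v = ⊥ := by
  simp [weightedRicci, hv, h]

theorem weightCorrection_mul (N : WithTop ℝ) (a f' : ℝ) :
    weightCorrection n N (a * f') = a ^ 2 * weightCorrection n N f' := by
  induction N with
  | top => simp [weightCorrection]
  | coe N => simp only [weightCorrection]; ring

end WeightedRicci

/-! ### The Bishop inequality -/

section Bishop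

variable {m : ℕ} {M : Type*} [TopologicalSpace M] [T2Space M]
  [ChartedSpace (EuclideanSpace ℝ (Fin (m + 1))) M]
  [IsManifold (𝓡 (m + 1)) ∞ M] {F ψ : TangentBundle (𝓡 (m + 1)) M → ℝ}
  {x : M} {v : Vec (m + 1)} {l : EReal} {η : ℝ → M} {t : ℝ}

/-- Restricting η to positive times makes its domain open, as the two-sided derivatives in the
definition of the weighted curvature require. -/
theorem weights_along_geodesic (hF : IsFinslerStructure F) (hψ : IsWeight ψ) (hl : 0 < l)
    (hη : IsRegularGeodesic F η (timeInterval l)) (ht : t ∈ timeInterval l) (h0 : 0 < t)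
    {f : ℝ → ℝ} (hf : f = alongCurve ψ η (timeInterval l)) {a : ℝ} (ha : 0 < a) :
    dWeight F ψ (η t) (a • (velocity (n := m + 1) η (timeInterval l) t).2) = a * deriv f t ∧
    ddWeight F ψ (η t) (a • (velocity (n := m + 1) η (timeInterval l) t).2) =
      a ^ 2 * deriv (deriv f) t := by
  have hop := isOpen_timeInterval_inter (l := l)
  have hu := uniqueDiffOn_timeInterval hl
  have hu' : UniqueDiffOn ℝ (timeInterval l ∩ Ioi 0) := hop.uniqueDiffOn
  have hr := hη.mono hF hu hu' inter_subset_left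
  have hvel : ∀ s ∈ timeInterval l ∩ Ioi 0, velocity (n := m + 1) η (timeInterval l ∩ Ioi 0) s =
      velocity η (timeInterval l) s := fun s hs =>
    hη.velocity_mono hF hu hu' inter_subset_left hs
  have heq : alongCurve ψ η (timeInterval l ∩ Ioi 0) =ᶠ[𝓝 t] f := by
    filter_upwards [hop.mem_nhds ⟨ht, h0⟩] with s hs
    rw [hf, alongCurve, hvel s hs, alongCurve]
  have h1 := dWeight_smul hF hψ hop hr ⟨ht, h0⟩ ha
  have h2 := ddWeight_smul hF hψ hop hr ⟨ht, h0⟩ ha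
  rw [hvel t ⟨ht, h0⟩, heq.deriv_eq] at h1
  rw [hvel t ⟨ht, h0⟩, heq.deriv.deriv_eq] at h2
  exact ⟨h1, h2⟩

/-- Combines the Riccati inequality, the scaling of Ric_N and the scalar algebra at the time T(τ).
-/
theorem bishop_inequality (hm : 2 ≤ m + 1) (hF : IsFinslerStructure F) (hψ : IsWeight ψ)
    (hv : F ⟨x, v⟩ = 1) {e : Fin m → Vec (m + 1)} (he : IsAdapted F x v e)
    (hl : 0 < l) (hη : IsGeodesicOn F η (timeInterval l))
    (hη0 : velocity (n := m + 1) η (timeInterval l) 0 = ⟨x, v⟩)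
    {N : WithTop ℝ} (hN : N ≤ ((1 : ℝ) : WithTop ℝ) ∨ (((m + 1 : ℕ) : ℝ) : WithTop ℝ) ≤ N)
    {ε c : ℝ} (hε : EpsilonRange (m + 1) N ε) (hc : c = bishopConst (m + 1) N ε)
    {f : ℝ → ℝ} (hf : f = alongCurve ψ η (timeInterval l))
    {A : ℝ → Matrix (Fin m) (Fin m) ℝ} (hA : A = jacobiGram F x v e η (timeInterval l))
    {T : ℝ → ℝ} (hT : T = paramInv (m + 1) ε f l)
    {h : ℝ → ℝ} (hh : h = fun τ => bishopFun c f A (T τ))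
    {τ : ℝ} (hτ : 0 < τ) (hτl : ENNReal.ofReal τ < paramEnd (m + 1) ε f l)
    (hdet : (A (T τ)).det ≠ 0) :
    ContDiffAt ℝ 2 h τ ∧ ((deriv (deriv h) τ : ℝ) : EReal) ≤ ((-c * h τ : ℝ) : EReal) *
      weightedRicci F ψ N (η (T τ)) (velocity (η ∘ T) univ τ).2 := by
  have hv0 : v ≠ 0 := fun h0 => by
    have := hF.apply_eq_zero_iff (V := ⟨x, v⟩).2 h0
    rw [hv] at this
    exact one_ne_zero this
  have hu := uniqueDiffOn_timeInterval hl
  have hreg : IsRegularGeodesic F η (timeInterval l) :=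
    hη.isRegularGeodesic hF hu ordConnected_timeInterval (zero_mem_timeInterval hl)
      (fun t ht => ht.1) (by rw [hη0]; exact hv0)
  have hfc : ContinuousOn f (timeInterval l) := hf ▸ continuousOn_alongCurve hF hψ hl hreg
  have hfs : ∀ t ∈ timeInterval l, 0 < t → ContDiffAt ℝ ∞ f t := fun t ht h0 =>
    hf ▸ contDiffAt_alongCurve hF hψ hl hreg ht h0
  obtain ⟨ht, h0, -⟩ := paramInv_spec (n := m + 1) (ε := ε) hl hfc hτ hτl
  obtain ⟨hTs, -⟩ := contDiffAt_paramInv (n := m + 1) (ε := ε) hl hfc hfs hτ hτl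
  have hTev : ∀ᶠ σ in 𝓝 τ, HasDerivAt T
      (Real.exp (2 * (ε - 1) / (((m + 1 : ℕ) : ℝ) - 1) * f (T σ)))⁻¹ σ := by
    filter_upwards [eventually_lt_paramEnd hτ hτl] with σ hσ
    rw [hT]
    exact (contDiffAt_paramInv hl hfc hfs hσ.1 hσ.2).2
  rw [← hT] at ht h0 hTs
  set t := T τ with htdef
  -- This is T'(τ), so the velocity of η ∘ T at τ is a • η'. The degree-two scaling of Ric_N then
  -- matches the factor T'² in the second derivative.
  set a : ℝ := (Real.exp (2 * (ε - 1) / (((m + 1 : ℕ) : ℝ) - 1) * f t))⁻¹ with ha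
  have ha0 : 0 < a := inv_pos.2 (Real.exp_pos _)
  obtain ⟨hDs, hDpos, ⟨u, hlog, u', hu', hle⟩, hric⟩ := jacobiGram_riccati hF hv he hl hreg hη0 ht
    h0 (D := fun s => (A s).det) (by rw [hA]) hdet
  obtain ⟨hdW, hddW⟩ := weights_along_geodesic hF hψ hl hreg ht h0 hf ha0
  have hm1 : ((m + 1 : ℕ) : ℝ) - 1 = m := by push_cast; ring
  have hm0 : (0 : ℝ) < ((m + 1 : ℕ) : ℝ) - 1 := by
    rw [hm1]
    exact_mod_cast (show 0 < m by omega)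
  have hc0 : 0 < c := hc ▸ bishopConst_pos hm hN hε
  have hmem : ∀ᶠ s in 𝓝 t, s ∈ timeInterval l ∩ Ioi 0 :=
    isOpen_timeInterval_inter.mem_nhds ⟨ht, h0⟩
  have hDev : ∀ᶠ s in 𝓝 t, 0 < (A s).det := hDs.continuousAt.eventually (lt_mem_nhds hDpos)
  have hfd : ∀ᶠ s in 𝓝 t, HasDerivAt f (deriv f s) s := hmem.mono fun s hs =>
    ((hfs s hs.1 hs.2).differentiableAt (by simp)).hasDerivAt
  have hfdd : HasDerivAt (deriv f) (deriv (deriv f) t) t :=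
    (((hfs t ht h0).derivWithin (m := 1) (by norm_cast)).differentiableAt (by simp)).hasDerivAt
  -- The function differentiated is (log h)/c, meaningful near t because det A is positive there and
  -- not merely nonzero.
  have hy : ∀ᶠ s in 𝓝 t, HasDerivAt (fun s => -f s + 1 / 2 * Real.log (A s).det)
      (-deriv f s + u s) s := by
    filter_upwards [hfd, hlog] with s h1 h2
    exact (h1.neg.add (h2.const_mul (1 / 2))).congr_deriv (by ring)
  have hheq : h =ᶠ[𝓝 τ] fun σ => Real.exp (c * (-f (T σ) + 1 / 2 * Real.log (A (T σ)).det)) := by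
    filter_upwards [hTs.continuousAt.eventually hDev] with σ hσ
    simp only [hh, bishopFun]
    rw [Real.rpow_def_of_pos hσ, ← Real.exp_add]
    congr 1
    ring
  have hhpos : 0 < h τ := by
    rw [hheq.self_of_nhds]
    exact Real.exp_pos _
  refine ⟨?_, ?_⟩
  · have h1 : ContDiffAt ℝ ∞ (fun s => Real.exp (c * (-f s + 1 / 2 * Real.log (A s).det))) t :=
      (contDiffAt_const.mul ((hfs t ht h0).neg.add (contDiffAt_const.mul
        (hDs.log hDpos.ne')))).exp
    exact ((h1.comp τ hTs).congr_of_eventuallyEq hheq).of_le (by norm_cast)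
  have hsecond := deriv_deriv_exp_comp hTev hy (hfdd.neg.add hu') hfd.self_of_nhds hheq
  have hvel : velocity (n := m + 1) (η ∘ T) univ τ =
      ⟨η t, a • (velocity (n := m + 1) η (timeInterval l) t).2⟩ :=
    velocity_comp (timeInterval_mem_nhds ht h0) hη.1 hTev.self_of_nhds
  have hW0 : a • (velocity (n := m + 1) η (timeInterval l) t).2 ≠ 0 :=
    smul_ne_zero ha0.ne' (hreg.velocity_ne_zero t ht)
  have hRic : weightedRicci F ψ N (η t) (velocity (η ∘ T) univ τ).2 = weightedRicci F ψ N (η t)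
      (a • (velocity (n := m + 1) η (timeInterval l) t).2) := by
    have : ∀ V W : TangentBundle (𝓡 (m + 1)) M, V = W →
        weightedRicci F ψ N V.1 V.2 = weightedRicci F ψ N W.1 W.2 := by
      rintro V W rfl
      rfl
    exact this _ _ hvel
  obtain ⟨W, hW, hdW, hddW, hricW, hRic⟩ : ∃ W : TangentSpace (𝓡 (m + 1)) (η t), W ≠ 0 ∧
      dWeight F ψ (η t) W = a * deriv f t ∧ ddWeight F ψ (η t) W = a ^ 2 * deriv (deriv f) t ∧
      ricci F (η t) W = a ^ 2 * curvTrace F (velocity η (timeInterval l) t) ∧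
      weightedRicci F ψ N (η t) (velocity (η ∘ T) univ τ).2 = weightedRicci F ψ N (η t) W :=
    ⟨_, hW0, hdW, hddW, hric a ha0, hRic⟩
  rw [hRic]
  -- At N = n with f' ≠ 0 one has Ric_n = -∞; its product with the negative number -c h₁ is +∞, and
  -- nothing is left to prove.
  by_cases hdim : N = (((m + 1 : ℕ) : ℝ) : WithTop ℝ) ∧ deriv f t ≠ 0
  · have hbot : weightedRicci F ψ N (η t) W = ⊥ := by
      rw [hdim.1]
      exact weightedRicci_dim_eq_bot hW (by rw [hdW]; exact mul_ne_zero ha0.ne' hdim.2)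
    rw [hbot, EReal.coe_mul_bot_of_neg (by nlinarith)]
    exact le_top
  · have hdim' : N = (((m + 1 : ℕ) : ℝ) : WithTop ℝ) → deriv f t = 0 := fun h1 =>
      not_not.1 fun h2 => hdim ⟨h1, h2⟩
    rw [weightedRicci_of_ne hW fun h1 => by rw [hdW, hdim' h1, mul_zero], hdW, hddW,
      weightCorrection_mul, hricW, ← EReal.coe_mul, EReal.coe_le_coe_iff, hsecond]
    rw [← hm1] at hle
    -- Here w = -f' + u, so that w + f' = u is the quantity controlled by the Riccati inequality.
    have halg := bishop_algebra (m := ((m + 1 : ℕ) : ℝ) - 1) (c := c) (ε := ε) (f' := deriv f t)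
      (f'' := deriv (deriv f) t) (w := -deriv f t + u t)
      (q := weightCorrection (m + 1) N (deriv f t)) (u' := u')
      (R := curvTrace F (velocity η (timeInterval l) t)) hm0
      (by rwa [neg_add_cancel_comm]) (by
        rw [hc]
        exact bishop_quadratic_nonneg hm hN hε hdim' _)
    have hpos : 0 ≤ c * h τ * a ^ 2 := by positivity
    have := mul_le_mul_of_nonneg_left halg hpos
    refine this.trans (le_of_eq ?_)
    ring

end Bishop

end Finsler

end

theorem proposition3p4 {n : ℕ} (hn : 2 ≤ n)
    {M : Type*} [TopologicalSpace M] [T2Space M] [ChartedSpace (EuclideanSpace ℝ (Fin n)) M]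
    [IsManifold (𝓡 n) ∞ M]
    {F : TangentBundle (𝓡 n) M → ℝ} (hF : Finsler.IsFinslerStructure F)
    {ψ : TangentBundle (𝓡 n) M → ℝ} (hψ : Finsler.IsWeight ψ)
    -- a unit tangent vector, completed to an orthonormal basis `e_1, …, e_{n-1}, v`
    {x : M} {v : TangentSpace (𝓡 n) x} (hv : F ⟨x, v⟩ = 1)
    {e : Fin (n - 1) → TangentSpace (𝓡 n) x} (he : Finsler.IsAdapted F x v e)
    -- the geodesic `η : [0, l) → M` with `η'(0) = v`
    {l : EReal} (hl : 0 < l) {η : ℝ → M}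
    (hη : Finsler.IsGeodesicOn F η (Finsler.timeInterval l))
    (hη0 : Finsler.velocity η (Finsler.timeInterval l) 0 = ⟨x, v⟩)
    {N : WithTop ℝ} (hN : N ≤ ((1 : ℝ) : WithTop ℝ) ∨ ((n : ℝ) : WithTop ℝ) ≤ N)
    {ε : ℝ} (hε : Finsler.EpsilonRange n N ε)
    {c : ℝ} (hc : c = Finsler.bishopConst n N ε)
    -- notation: `ψη(t) = ψ(η'(t))`, the matrix `A(t)`, `φinv = φ_η⁻¹`, `h₁ = h ∘ φ_η⁻¹`
    {ψη : ℝ → ℝ} (hψη : ψη = Finsler.alongCurve ψ η (Finsler.timeInterval l))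
    {A : ℝ → Matrix (Fin (n - 1)) (Fin (n - 1)) ℝ}
    (hA : A = Finsler.jacobiGram F x v e η (Finsler.timeInterval l))
    {φinv : ℝ → ℝ} (hφinv : φinv = Finsler.paramInv n ε ψη l)
    {h₁ : ℝ → ℝ} (hh₁ : h₁ = fun τ => Finsler.bishopFun c ψη A (φinv τ))
    {τ : ℝ} (hτ : 0 < τ) (hτl : ENNReal.ofReal τ < Finsler.paramEnd n ε ψη l)
    (hdet : (A (φinv τ)).det ≠ 0) :
    ContDiffAt ℝ 2 h₁ τ ∧
    ((deriv (deriv h₁) τ : ℝ) : EReal) ≤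
      ((-c * h₁ τ : ℝ) : EReal) *
        Finsler.weightedRicci F ψ N (η (φinv τ)) (Finsler.velocity (η ∘ φinv) univ τ).2 := by
  -- With n = m + 1 the index type of the frame becomes `Fin m`, and the matrices acquire an extra
  -- index 0 for the velocity.
  obtain ⟨m, rfl⟩ : ∃ m, n = m + 1 := ⟨n - 1, by omega⟩
  exact Finsler.bishop_inequality hn hF hψ hv he hl hη hη0 hN hε hc hψη hA hφinv hh₁ hτ hτl hdet
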